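/- **Definitions.** A nondeterministic Büchi automaton (NBA) $\mathcal A=(Q,\Sigma,\delta,Q_0,F)$ is *$k$-ambiguous* if every infinite word has at most $k$ final paths (paths $q_0q_1\ldots$ over the word with $q_0\in Q_0$ that visit some state of $F$ infinitely often). Its *$k$-disambiguation* $\mathrm{kdis}(\mathcal A)$ is the following weighted Büchi automaton over $\mathbb Q$. Let $P$ be a finite nonempty set of pairs $(s,b)$, where $s\in Q^+$ and $b\in\{\bot,\top\}$ and each $s$ occurs with only one bit. Put $b''=\bot$ if all bits in $P$ are $\top$, and $b''=\top$ otherwise. An *extension* of $(s,b)\in P$ along $a$ is a pair $(s\cdot q,\ ((\mathrm{last}(s)\in F)\vee b)\wedge b'')$ with $q\in\delta(\mathrm{last}(s),a)$. An *$a$-successor* of $P$ is a set of such extensions of elements of $P$ that contains at least one extension of every element of $P$. Let $\pi_{\mathrm{last}}(P)_{q,b}$ be the number of $(s,b)\in P$ with $\mathrm{last}(s)=q$. For vectors $\vec r\neq\vec 0$ and $\vec r\,'$, let $w(\vec r,a,\vec r\,')$ be the number of $a$-successors $P'$ of $P$ with $\pi_{\mathrm{last}}(P')=\vec r\,'$,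 where $P$ is any set as above with $\pi_{\mathrm{last}}(P)=\vec r$ (the number does not depend on the choice of $P$). Write $\mathrm{size}(\vec r)=\sum_{q,b}\vec r_{q,b}$. The automaton $\mathrm{kdis}'(\mathcal A)$ has the states $\{0,\dots,k\}^{Q\times\{\bot,\top\}}\setminus\{\vec 0\}$ and the transition weights $\Delta(a)_{\vec r,\vec r\,'}=(-1)^{\mathrm{size}(\vec r\,')-\mathrm{size}(\vec r)}\,w(\vec r,a,\vec r\,')$. The initial weight of $\vec r$ is $(-1)^{\mathrm{size}(\vec r)-1}$ if all entries of $\vec r$ are at most $1$ and $\vec r_{q,b}=0$ whenever $q\notin Q_0$ or $b=\top$; otherwise it is $0$. A state $\vec r$ is final if $\vec r_{q,\bot}=0$ for all $q\in Q$. Finally, $\mathrm{kdis}(\mathcal A)$ is the restriction of $\mathrm{kdis}'(\mathcal A)$ to the states that are reachable from an initial state (one of nonzero initial weight) and can reach a loop through a final state, along edges of nonzero weight. A *POLYLOGSPACE transducer* is a deterministic Turing machine with a read-only input tape, finitely many work tapes and a write-only output tape that halts on every input and uses $O((\log N)^d)$ cells of its work tapes, for some constant $d$, where $N$ is the length of the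 input. **Theorem.** Let $\kappa:\mathbb N\to\mathbb N$ with $\kappa(n)=O(\log n)$. 1. There is a function $g(n)=O(\log n)$ such that for every NBA $\mathcal A$ with $n$ states that is $k$-ambiguous for some $k\le\kappa(n)$, the automaton $\mathrm{kdis}(\mathcal A)$ has at most $(2n)^{g(n)}$ states. 2. There is a POLYLOGSPACE transducer that, given any NBA $\mathcal A$ with $n$ states that is $k$-ambiguous for some $k\le\kappa(n)$, outputs $\mathrm{kdis}(\mathcal A)$. Here NBAs are given by the numbers of states and letters in unary, the characteristic vectors of $Q_0$ and $F$, and the adjacency matrices of the letters. The automaton $\mathrm{kdis}(\mathcal A)$ is output as the numbers of states and letters, its initial weights, final states and transition matrices (rational weights in binary) with respect to some ordering of its states, together with the list of the vectors that are its states. -/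

import Mathlib

open Filter Asymptotics

noncomputable section

/-! ### Nondeterministic Büchi automata and their ambiguity -/

/-- A nondeterministic Büchi automaton with state set `Q` and alphabet `S`. -/
structure NBA (Q : Type*) (S : Type*) where
  /-- the transition relation: `δ q a` is the set of `a`-successors of `q` -/
  δ : Q → S → Set Q
  /-- the initial states -/
  init : Set Q
  /-- the final states -/
  final : Set Q

namespace NBA

variable {Q S : Type*}

/-- `ρ` is a path of `A` over the infinite word `w`. -/
def IsPath (A : NBA Q S) (w : ℕ → S) (ρ : ℕ → Q) : Prop :=
  ρ 0 ∈ A.init ∧ ∀ i, ρ (i + 1) ∈ A.δ (ρ i) (w i)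

/-- The final paths over `w`: the paths in which some final state occurs infinitely often. -/
def finalPaths (A : NBA Q S) (w : ℕ → S) : Set (ℕ → Q) :=
  {ρ | A.IsPath w ρ ∧ ∃ q ∈ A.final, ∃ᶠ i in atTop, ρ i = q}

/-- `A` is `k`-ambiguous: every infinite word has at most `k` final paths. -/
def IsAmbiguous (A : NBA Q S) (k : ℕ) : Prop :=
  ∀ w : ℕ → S, (A.finalPaths w).encard ≤ k

end NBA

/-! ### Weighted Büchi automata -/

/-- A weighted Büchi automaton over `𝔽` with state set `Q` and alphabet `S`. -/
structure WBA (𝔽 : Type*) (Q : Type*) (S : Type*) where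
  /-- the transition matrices -/
  M : S → Matrix Q Q 𝔽
  /-- the initial vector -/
  α : Q → 𝔽
  /-- the final states -/
  final : Set Q

namespace WBA

variable {𝔽 Q R S : Type*}

/-- There is an edge (of nonzero weight) from `q` to `q'` under some letter. -/
def Edge [Zero 𝔽] (B : WBA 𝔽 Q S) (q q' : Q) : Prop := ∃ a, B.M a q q' ≠ 0

/-- `q` is reachable from an initial state. -/
def IsReachable [Zero 𝔽] (B : WBA 𝔽 Q S) (q : Q) : Prop :=
  ∃ p, B.α p ≠ 0 ∧ Relation.ReflTransGen B.Edge p q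

/-- `q` can reach a (nonempty) loop that goes through a final state. -/
def CanReachFinalLoop [Zero 𝔽] (B : WBA 𝔽 Q S) (q : Q) : Prop :=
  ∃ f ∈ B.final, Relation.ReflTransGen B.Edge q f ∧ Relation.TransGen B.Edge f f

/-- The states that are kept when `B` is trimmed. -/
def trimStates [Zero 𝔽] (B : WBA 𝔽 Q S) : Set Q :=
  {q | B.IsReachable q ∧ B.CanReachFinalLoop q}

/-- The automaton on the states in the range of `e` (a restriction when `e` is a subtype inclusion,
a renaming of the states when `e` is a bijection). -/
def comap (B : WBA 𝔽 Q S) (e : R → Q) : WBA 𝔽 R S where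
  M a := (B.M a).submatrix e e
  α := B.α ∘ e
  final := e ⁻¹' B.final

/-- The restriction of `B` to the reachable states that can reach a loop over a final state. -/
def trim [Zero 𝔽] (B : WBA 𝔽 Q S) : WBA 𝔽 B.trimStates S := B.comap Subtype.val

end WBA

/-! ### The `k`-disambiguation -/

namespace NBA

variable {Q S : Type*}

/-- The sets of pairs (prefix of a path, bit) used as states of the infinite disambiguation:
finite, nonempty, with nonempty prefixes, each of which carries exactly one bit. -/
def IsPrefixSet (P : Finset (List Q × Bool)) : Prop :=
  P.Nonempty ∧ (∀ x ∈ P, x.1 ≠ []) ∧ Set.InjOn Prod.fst (P : Set (List Q × Bool))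

open Classical in
/-- `y = (r ⬝ q, b')` extends the element `x = (r, b)` of `P` along `a`: `q ∈ δ (last r) a` and
`b' = (last r ∈ F ∨ b) ∧ b''`, where `b''` is false iff all the bits in `P` are true. -/
def Extends (A : NBA Q S) (a : S) (P : Finset (List Q × Bool)) (x y : List Q × Bool) : Prop :=
  ∃ p q, x.1.getLast? = some p ∧ q ∈ A.δ p a ∧
    y = (x.1 ++ [q], decide ((p ∈ A.final ∨ x.2 = true) ∧ ¬ ∀ z ∈ P, z.2 = true))

/-- `P'` is an `a`-successor of `P`. -/
def IsSucc (A : NBA Q S) (a : S) (P P' : Finset (List Q × Bool)) : Prop :=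
  (∀ x ∈ P, ∃ y ∈ P', A.Extends a P x y) ∧ (∀ y ∈ P', ∃ x ∈ P, A.Extends a P x y)

open Classical in
/-- `πlast P (q, b)` is the number of `(r, b) ∈ P` with `last r = q`. -/
def πlast (P : Finset (List Q × Bool)) : Q × Bool → ℕ :=
  fun qb => (P.filter fun x => x.1.getLast? = some qb.1 ∧ x.2 = qb.2).card

open Classical in
/-- `w(r, a, r')`: the number of `a`-successors `P'` of `P` with `πlast P' = r'`, where `P` is any
state with `πlast P = r`. (Such a `P` exists for all `r ≠ 0`, and the number does not depend on
its choice.) -/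
def succCount (A : NBA Q S) (a : S) (r r' : Q × Bool → ℕ) : ℕ :=
  if h : ∃ P : Finset (List Q × Bool), IsPrefixSet P ∧ πlast P = r then
    {P' | A.IsSucc a h.choose P' ∧ πlast P' = r'}.ncard
  else 0

/-- The nonzero vectors in `{0, …, k} ^ (Q × {⊥, ⊤})`. -/
def KVec (k : ℕ) (Q : Type*) : Type _ := {r : Q × Bool → Fin (k + 1) // r ≠ 0}

/-- The underlying vector of natural numbers. -/
def KVec.toNat {k : ℕ} (r : KVec k Q) : Q × Bool → ℕ := fun qb => (r.1 qb : ℕ)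

/-- The sum of the entries. -/
def KVec.size [Fintype Q] {k : ℕ} (r : KVec k Q) : ℕ := ∑ qb, r.toNat qb

open Classical in
/-- The untrimmed `k`-disambiguation. -/
def kdis' [Fintype Q] (A : NBA Q S) (k : ℕ) : WBA ℚ (KVec k Q) S where
  M a := Matrix.of fun r r' =>
    (-1 : ℚ) ^ ((r'.size : ℤ) - (r.size : ℤ)) * (A.succCount a r.toNat r'.toNat : ℚ)
  α r :=
    if ∀ q b, (q ∉ A.init ∨ b = true → r.toNat (q, b) = 0) ∧ r.toNat (q, b) ≤ 1 then
      (-1 : ℚ) ^ (r.size - 1)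
    else 0
  final := {r | ∀ q, r.toNat (q, false) = 0}

/-- The states of the `k`-disambiguation of `A`. -/
abbrev KdisState [Fintype Q] (A : NBA Q S) (k : ℕ) : Type _ := (A.kdis' k).trimStates

/-- The `k`-disambiguation of `A`. -/
def kdis [Fintype Q] (A : NBA Q S) (k : ℕ) : WBA ℚ (A.KdisState k) S := (A.kdis' k).trim

instance [Fintype Q] (A : NBA Q S) (k : ℕ) : Finite (A.KdisState k) := by
  unfold KdisState KVec
  infer_instance

end NBA

/-! ### Turing machine transducers and the space they use -/

/-- A move of a head. -/
inductive HeadMove where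
  | left
  | stay
  | right

/-- What the input head can see: an end marker or a symbol of the input. -/
inductive InputCell (I : Type) where
  | leftEnd
  | symbol (i : I)
  | rightEnd

/-- A deterministic Turing machine with a read-only two-way input tape over the alphabet `I`,
finitely many read-write work tapes, and a write-only output tape over the alphabet `O`. -/
structure Transducer (I O : Type) where
  /-- the finite control -/
  Control : Type
  /-- the finite work alphabet -/
  Work : Type
  /-- the finite set of work tapes -/
  Tapes : Type
  [finiteControl : Finite Control]
  [finiteWork : Finite Work]
  [finiteTapes : Finite Tapes]
  /-- the blank symbol -/
  blank : Work
  /-- the initial control state -/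
  start : Control
  /-- The transition function. From the control state, the scanned input cell and the scanned work
  cells, it either halts (`none`) or gives the next control state, the move of the input head, the
  symbol to write and the move for each work tape, and optionally an output symbol. -/
  trans : Control → InputCell I → (Tapes → Work) →
    Option (Control × HeadMove × (Tapes → Work × HeadMove) × Option O)

namespace Transducer

variable {I O : Type}

/-- A configuration. Input cell `0` holds the left end marker, cells `1, …, |x|` the input `x` and
cell `|x| + 1` the right end marker; work tapes are infinite to the right, with cells `0, 1, …`. -/
structure Cfg (T : Transducer I O) where
  /-- the control state -/
  control : T.Control
  /-- the position of the input head -/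
  inputHead : ℕ
  /-- the contents of the work tapes -/
  tape : T.Tapes → ℕ → T.Work
  /-- the positions of the heads of the work tapes -/
  head : T.Tapes → ℕ
  /-- the output written so far -/
  output : List O

/-- The content of a cell of the input tape. -/
def inputCell (x : List I) : ℕ → InputCell I
  | 0 => .leftEnd
  | p + 1 => match x[p]? with
    | some i => .symbol i
    | none => .rightEnd

/-- The effect of a move on a head position; a left move in cell `0` has no effect. -/
def moveHead : HeadMove → ℕ → ℕ
  | .left, p => p - 1
  | .stay, p => p
  | .right, p => p + 1

/-- The initial configuration. -/
def initCfg (T : Transducer I O) : T.Cfg where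
  control := T.start
  inputHead := 0
  tape := fun _ _ => T.blank
  head := fun _ => 0
  output := []

/-- One step on input `x`, or `none` when the machine halts. The input head cannot move beyond the
end markers. -/
def step (T : Transducer I O) (x : List I) (c : T.Cfg) : Option T.Cfg :=
  (T.trans c.control (inputCell x c.inputHead) fun t => c.tape t (c.head t)).map
    fun (s, m, act, o) =>
      { control := s
        inputHead := min (moveHead m c.inputHead) (x.length + 1)
        tape := fun t => Function.update (c.tape t) (c.head t) (act t).1
        head := fun t => moveHead (act t).2 (c.head t)
        output := c.output ++ o.toList }

/-- `c` occurs in the computation of `T` on input `x`. -/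
def Reaches (T : Transducer I O) (x : List I) (c : T.Cfg) : Prop :=
  Relation.ReflTransGen (fun c₁ c₂ => T.step x c₁ = some c₂) T.initCfg c

/-- On input `x`, the machine `T` halts with output `y`. -/
def HaltsWith (T : Transducer I O) (x : List I) (y : List O) : Prop :=
  ∃ c, T.Reaches x c ∧ T.step x c = none ∧ c.output = y

/-- On input `x`, the heads of the work tapes of `T` stay within the first `m` cells. -/
def UsesSpace (T : Transducer I O) (x : List I) (m : ℕ) : Prop :=
  ∀ c, T.Reaches x c → ∀ t, c.head t < m

/-- `T` is a POLYLOGSPACE transducer: on every input it halts, and it uses work space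
`O((log N) ^ d)` for some `d`, where `N` is the length of the input. -/
def IsPolylogSpace (T : Transducer I O) : Prop :=
  ∃ C d : ℕ, ∀ x : List I,
    (∃ y, T.HaltsWith x y) ∧ T.UsesSpace x (C * Nat.log 2 x.length ^ d + C)

end Transducer

/-! ### Automata as strings

The input alphabet is `Bool`. The output alphabet is `Option Bool`, with `none` as a separator. -/

open Classical in
/-- The input: the numbers of states and of letters in unary, the characteristic vectors of the
initial and of the final states, and the adjacency matrix of every letter. -/
def NBA.encode {n s : ℕ} (A : NBA (Fin n) (Fin s)) : List Bool :=
  List.replicate n true ++ [false] ++ List.replicate s true ++ [false] ++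
  (List.finRange n).map (fun q => decide (q ∈ A.init)) ++
  (List.finRange n).map (fun q => decide (q ∈ A.final)) ++
  (List.finRange s).flatMap fun a => (List.finRange n).flatMap fun q =>
    (List.finRange n).map fun q' => decide (q' ∈ A.δ q a)

/-- A natural number in binary, least significant bit first, with a separator at the end. -/
def encodeNat (m : ℕ) : List (Option Bool) := m.bits.map some ++ [none]

/-- A number in unary, with a separator at the end. -/
def encodeUnary (m : ℕ) : List (Option Bool) := List.replicate m (some true) ++ [none]

/-- A rational number: its sign, numerator and denominator. -/
def encodeRat (x : ℚ) : List (Option Bool) :=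
  [some (decide (x < 0))] ++ encodeNat x.num.natAbs ++ encodeNat x.den

open Classical in
/-- A weighted Büchi automaton with states `0, …, m - 1` and letters `0, …, s - 1`: the numbers of
states and of letters, the initial vector, the final states, and the matrix of every letter. -/
def WBA.encode {m s : ℕ} (B : WBA ℚ (Fin m) (Fin s)) : List (Option Bool) :=
  encodeUnary m ++ encodeUnary s ++
  (List.finRange m).flatMap (fun i => encodeRat (B.α i)) ++
  (List.finRange m).map (fun i => some (decide (i ∈ B.final))) ++
  (List.finRange s).flatMap fun a => (List.finRange m).flatMap fun i =>
    (List.finRange m).flatMap fun j => encodeRat (B.M a i j)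

/-- The `k`-disambiguation of `A`, with its states listed in the order `e`: the number `n` of
states of `A`, the disambiguation as a weighted automaton on the indices in that list, and the
list of the vectors (with entries indexed by `(q, ⊥), (q, ⊤)` for `q = 0, …, n - 1`) that these
indices stand for. -/
def NBA.encodeKdis {n s : ℕ} (A : NBA (Fin n) (Fin s)) (k : ℕ) {m : ℕ}
    (e : Fin m ≃ A.KdisState k) : List (Option Bool) :=
  encodeUnary n ++ ((A.kdis k).comap e).encode ++
  (List.finRange m).flatMap fun i => (List.finRange n).flatMap fun q =>
    encodeNat ((e i).1.toNat (q, false)) ++ encodeNat ((e i).1.toNat (q, true))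

end

/-! ### Counter programs, and the Turing machine that runs them with registers in binary. -/

/-! ### Counter programs -/

/-! The heart of the matter is that a vector surviving the trimming has size at most `k`. Such a
vector lies on a lasso in the graph of all vectors: it is reachable from an initial vector and
reaches a loop through a final one. The lasso spells an infinite word and lifts to prefix sets `P
0`, `P 1`, ..., each a successor of the one before. Every element of `P t` has extensions forever,
so it grows into an infinite path. All bits are ⊤ at a final vector, they are reset to ⊥ right after
it, and a bit becomes ⊤ again only after a visit to `F`; hence the path is final. Distinct prefixes
give distinct final paths, so the size, which is the cardinality of `P t`, is at most `k`
(`sum_le_of_onLasso`).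

Consequently the cap `k` on the entries is never felt: the states of the disambiguation are exactly
the lasso vectors of an infinite graph that does not mention `k` (`mem_trimStates_iff`). A vector of
size at most `k` is a multiset of at most `k` labels from `Q × Bool`, so there are at most `(2n+1)^k
≤ (2n)^(2k)` of them when `n ≥ 1` (`card_kdisState_le`).

For the transducer, `k` may be replaced by any larger `K`; the choice `K = C * log n + C` is
computable even if `κ` is not. Vectors of size at most `K` are coded by numbers below `(2n+1)^K`,
and successors by lists of at most `K` pairs, which are numbers below `(Kn+1)^K` (`exists_node`,
`exists_setOf`). These bounds are quasi-polynomial, and a weight is a count of such codes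
(`Describes.weight_eq`). Trimming asks for reachability among quasi-polynomially many codes.
Savitch's midpoint recursion turns this into a game of polylogarithmic depth, evaluated depth-first
with its stack stored in a single number (`reachIn_iff`, `wins_savitch`, `PLP.wins`).

Machines are built once and for all. A function given by primitive recursion whose intermediate
values all stay below a quasi-polynomial (`PL`, and `OutPL` for strings) compiles to a counter
program. A machine that keeps the counters in binary then needs only polylogarithmically many cells
(`OutPL.transducer`). -/

/-- Programs with natural number registers, a read-only input and an output. The program
`loop r p` runs `p` as long as the register `r` can be decremented. -/
inductive Prog where
  | skip
  | inc (r : ℕ)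
  | out (o : Option Bool)
  | right
  | home
  | ifCell (f : InputCell Bool → Bool) (p : Prog)
  | seq (p q : Prog)
  | loop (r : ℕ) (p : Prog)

/-- A state of a counter program. -/
structure ProgState where
  /-- the contents of the registers -/
  reg : ℕ → ℕ
  /-- the position of the input head -/
  hd : ℕ
  /-- the output written so far -/
  out : List (Option Bool)

/-- `Exec x B p s s'`: on input `x`, the program `p` leads from `s` to `s'` and no register is
incremented beyond `B`. -/
inductive Exec (x : List Bool) (B : ℕ) : Prog → ProgState → ProgState → Prop
  | skip (s) : Exec x B .skip s s
  | inc (r s) : s.reg r + 1 ≤ B →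
      Exec x B (.inc r) s { s with reg := Function.update s.reg r (s.reg r + 1) }
  | out (o s) : Exec x B (.out o) s { s with out := s.out ++ [o] }
  | right (s) : Exec x B .right s { s with hd := min (s.hd + 1) (x.length + 1) }
  | home (s) : Exec x B .home s { s with hd := 0 }
  | ifTrue (f p s s') : f (Transducer.inputCell x s.hd) = true → Exec x B p s s' →
      Exec x B (.ifCell f p) s s'
  | ifFalse (f p s) : f (Transducer.inputCell x s.hd) = false → Exec x B (.ifCell f p) s s
  | seq (p q s₁ s₂ s₃) : Exec x B p s₁ s₂ → Exec x B q s₂ s₃ → Exec x B (.seq p q) s₁ s₃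
  | loopZero (r p s) : s.reg r = 0 → Exec x B (.loop r p) s s
  | loopSucc (r p s s₁ s₂) : s.reg r ≠ 0 →
      Exec x B p { s with reg := Function.update s.reg r (s.reg r - 1) } s₁ →
      Exec x B (.loop r p) s₁ s₂ → Exec x B (.loop r p) s s₂

/-- All registers of the program are below `m`. -/
def Prog.Below (m : ℕ) : Prog → Prop
  | .skip => True
  | .inc r => r < m
  | .out _ => True
  | .right => True
  | .home => True
  | .ifCell _ p => p.Below m
  | .seq p q => p.Below m ∧ q.Below m
  | .loop r p => r < m ∧ p.Below m

theorem Prog.Below.mono {m m' : ℕ} (h : m ≤ m') : ∀ {p : Prog}, p.Below m → p.Below m'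
  | .skip, _ => trivial
  | .inc _, hp => lt_of_lt_of_le hp h
  | .out _, _ => trivial
  | .right, _ => trivial
  | .home, _ => trivial
  | .ifCell _ p, hp => Prog.Below.mono (p := p) h hp
  | .seq _ _, hp => ⟨hp.1.mono h, hp.2.mono h⟩
  | .loop _ _, hp => ⟨lt_of_lt_of_le hp.1 h, hp.2.mono h⟩

theorem Prog.exists_below : ∀ p : Prog, ∃ m, p.Below m
  | .skip => ⟨0, trivial⟩
  | .inc r => ⟨r + 1, Nat.lt_succ_self r⟩
  | .out _ => ⟨0, trivial⟩
  | .right => ⟨0, trivial⟩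
  | .home => ⟨0, trivial⟩
  | .ifCell _ p => p.exists_below
  | .seq p q => by
    obtain ⟨a, ha⟩ := p.exists_below
    obtain ⟨b, hb⟩ := q.exists_below
    exact ⟨max a b, ha.mono (le_max_left _ _), hb.mono (le_max_right _ _)⟩
  | .loop r p => by
    obtain ⟨a, ha⟩ := p.exists_below
    exact ⟨max a (r + 1), lt_of_lt_of_le (Nat.lt_succ_self r) (le_max_right _ _),
      ha.mono (le_max_left _ _)⟩

/-! ### The machine that runs a program -/

namespace CounterMachine

/-- The work symbols: `none` is blank, `some none` marks the first cell, the others are bits. -/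
abbrev Sym := Option (Option Bool)

/-- Control states, carrying the list of programs that remain to be run. -/
inductive Ctl where
  | boot (K : List Prog)
  | main (K : List Prog)
  | carry (r : ℕ) (K : List Prog)
  | back (r : ℕ) (K : List Prog)
  | borrow (r : ℕ) (K K' : List Prog)
  | fix (r : ℕ) (K : List Prog)

variable {m : ℕ}

/-- Leave all tapes unchanged. -/
def keep (y : Fin m → Sym) : Fin m → Sym × HeadMove := fun t => (y t, .stay)

/-- Write `a` on tape `r` and move its head. -/
def onTape (y : Fin m → Sym) (r : ℕ) (a : Sym) (d : HeadMove) : Fin m → Sym × HeadMove :=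
  fun t => if (t : ℕ) = r then (a, d) else (y t, .stay)

/-- The symbol scanned on tape `r`. -/
def symAt (y : Fin m → Sym) (r : ℕ) : Sym := if h : r < m then y ⟨r, h⟩ else none

/-- The control state, the move of the input head, the actions on the tapes and the output. -/
abbrev Action (m : ℕ) := Ctl × HeadMove × (Fin m → Sym × HeadMove) × Option (Option Bool)

/-- The transition function. -/
def delta (m : ℕ) : Ctl → InputCell Bool → (Fin m → Sym) → Option (Action m)
  | .boot K, _, _ => some (.main K, .stay, fun _ => (some none, .stay), none)
  | .main [], _, _ => none
  | .main (.skip :: K), _, y => some (.main K, .stay, keep y, none)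
  | .main (.inc r :: K), _, y => some (.carry r K, .stay, onTape y r (symAt y r) .right, none)
  | .main (.out o :: K), _, y => some (.main K, .stay, keep y, some o)
  | .main (.right :: K), _, y => some (.main K, .right, keep y, none)
  | .main (.home :: K), .leftEnd, y => some (.main K, .stay, keep y, none)
  | .main (.home :: K), _, y => some (.main (.home :: K), .left, keep y, none)
  | .main (.ifCell f p :: K), c, y =>
    some (.main (if f c then p :: K else K), .stay, keep y, none)
  | .main (.seq p q :: K), _, y => some (.main (p :: q :: K), .stay, keep y, none)
  | .main (.loop r p :: K), _, y =>
    some (.borrow r (p :: .loop r p :: K) K, .stay, onTape y r (symAt y r) .right, none)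
  | .carry r K, _, y => match symAt y r with
    | some (some true) => some (.carry r K, .stay, onTape y r (some (some false)) .right, none)
    | _ => some (.back r K, .stay, onTape y r (some (some true)) .left, none)
  | .back r K, _, y => match symAt y r with
    | some none => some (.main K, .stay, keep y, none)
    | _ => some (.back r K, .stay, onTape y r (symAt y r) .left, none)
  | .borrow r K K', _, y => match symAt y r with
    | some (some false) => some (.borrow r K K', .stay, onTape y r (some (some true)) .right, none)
    | some (some true) => some (.back r K, .stay, onTape y r (some (some false)) .left, none)
    | _ => some (.fix r K', .stay, onTape y r none .left, none)
  | .fix r K, _, y => match symAt y r with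
    | some none => some (.main K, .stay, keep y, none)
    | _ => some (.fix r K, .stay, onTape y r (some (some false)) .left, none)

/-- A configuration with an arbitrary control state. -/
structure Config (m : ℕ) where
  /-- the control state -/
  ctl : Ctl
  /-- the position of the input head -/
  ih : ℕ
  /-- the contents of the tapes -/
  tape : Fin m → ℕ → Sym
  /-- the positions of the heads -/
  head : Fin m → ℕ
  /-- the output -/
  out : List (Option Bool)

/-- The effect of an action. -/
def Config.act (x : List Bool) (c : Config m) (a : Action m) : Config m where
  ctl := a.1
  ih := min (Transducer.moveHead a.2.1 c.ih) (x.length + 1)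
  tape := fun t => Function.update (c.tape t) (c.head t) (a.2.2.1 t).1
  head := fun t => Transducer.moveHead (a.2.2.1 t).2 (c.head t)
  out := c.out ++ a.2.2.2.toList

/-- One step. -/
def step (x : List Bool) (c : Config m) : Option (Config m) :=
  (delta m c.ctl (Transducer.inputCell x c.ih) fun t => c.tape t (c.head t)).map (c.act x)

/-- A step to a configuration whose heads are below `M`. -/
def StepIn (x : List Bool) (M : ℕ) (c d : Config m) : Prop :=
  step x c = some d ∧ ∀ t, d.head t < M

/-- A run through configurations whose heads are below `M`. -/
abbrev RunIn (x : List Bool) (M : ℕ) : Config m → Config m → Prop :=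
  Relation.ReflTransGen (StepIn x M)

/-! #### Binary counters on tapes -/

/-- The tape that holds the bits `l` after the marked first cell. -/
def tp (l : List Bool) : ℕ → Sym
  | 0 => some none
  | p + 1 => (l[p]?).map some

/-- The number with the bits `l`, least significant bit first. -/
def val : List Bool → ℕ
  | [] => 0
  | b :: l => b.toNat + 2 * val l

/-- Increment. -/
def incL : List Bool → List Bool
  | [] => [true]
  | false :: l => true :: l
  | true :: l => false :: incL l

/-- Decrement. -/
def decL : List Bool → List Bool
  | [] => []
  | true :: l => false :: l
  | false :: l => true :: decL l

theorem val_incL : ∀ l, val (incL l) = val l + 1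
  | [] => rfl
  | false :: l => by simp [incL, val]; omega
  | true :: l => by simp [incL, val, val_incL l]; omega

theorem val_decL : ∀ l, val l ≠ 0 → val (decL l) = val l - 1
  | [], h => absurd rfl h
  | true :: l, _ => by simp [decL, val]
  | false :: l, h => by
    have h' : val l ≠ 0 := by simpa [val] using h
    simp [decL, val, val_decL l h']; omega

theorem length_decL : ∀ l, (decL l).length = l.length
  | [] => rfl
  | true :: l => rfl
  | false :: l => by simp [decL, length_decL l]

theorem length_incL : ∀ l, (incL l).length = l.length ∨
    (incL l).length = l.length + 1 ∧ val (incL l) = 2 ^ l.length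
  | [] => Or.inr ⟨rfl, rfl⟩
  | false :: l => Or.inl rfl
  | true :: l => by
    rcases length_incL l with h | ⟨h, h'⟩
    · exact Or.inl (by simp [incL, h])
    · exact Or.inr ⟨by simp [incL, h], by simp [incL, val, h', pow_succ]; omega⟩

/-- A list grows only when the carry leaves its top bit, and then the new value is the power `2 ^
l.length`. A value at most `B < 2 ^ n` therefore never needs more than `n` bits. -/
theorem length_incL_le {l : List Bool} {n B : ℕ} (hl : l.length ≤ n) (hv : val l + 1 ≤ B)
    (hB : B < 2 ^ n) : (incL l).length ≤ n := by
  rcases length_incL l with h | ⟨h, h'⟩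
  · omega
  · rw [val_incL] at h'
    have : l.length < n := (Nat.pow_lt_pow_iff_right (by norm_num : 1 < 2)).1 (by omega)
    omega

theorem eq_replicate_of_val : ∀ l, val l = 0 → l = List.replicate l.length false
  | [], _ => rfl
  | true :: l, h => by simp [val] at h
  | false :: l, h => by
    have h' : val l = 0 := by simpa [val] using h
    rw [List.length_cons, List.replicate_succ, ← eq_replicate_of_val l h']

theorem tp_write (u v : List Bool) (a b : Bool) :
    Function.update (tp (u ++ a :: v)) (u.length + 1) (some (some b)) = tp (u ++ b :: v) := by
  funext p
  rcases p with _ | p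
  · simp [Function.update, tp]
  · rcases eq_or_ne p u.length with rfl | h
    · simp [tp]
    · rw [Function.update_of_ne (by omega)]
      simp only [tp]
      rcases lt_or_gt_of_ne h with h | h
      · rw [List.getElem?_append_left h, List.getElem?_append_left h]
      · rw [List.getElem?_append_right h.le, List.getElem?_append_right h.le]
        obtain ⟨j, hj⟩ : ∃ j, p - u.length = j + 1 := ⟨p - u.length - 1, by omega⟩
        rw [hj]; simp

theorem tp_append (u : List Bool) (b : Bool) :
    Function.update (tp u) (u.length + 1) (some (some b)) = tp (u ++ [b]) := by
  funext p
  rcases p with _ | p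
  · simp [Function.update, tp]
  · rcases eq_or_ne p u.length with rfl | h
    · simp [tp]
    · rw [Function.update_of_ne (by omega)]
      simp only [tp]
      rcases lt_or_gt_of_ne h with h | h
      · rw [List.getElem?_append_left h]
      · rw [List.getElem?_eq_none h.le, List.getElem?_eq_none (by simp; omega)]

theorem tp_at (u v : List Bool) (b : Bool) : tp (u ++ b :: v) (u.length + 1) = some (some b) := by
  simp [tp]

theorem tp_end (u : List Bool) : tp u (u.length + 1) = none := by simp [tp]

theorem tp_succ_ne (l : List Bool) (p : ℕ) : tp l (p + 1) ≠ some none := by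
  simp only [tp]
  rcases l[p]? with _ | b <;> simp

/-- The configuration with the bits `ls t` on tape `t`. -/
def cfg (k : Ctl) (ih : ℕ) (ls : Fin m → List Bool) (hd : Fin m → ℕ) (o : List (Option Bool)) :
    Config m := ⟨k, ih, fun t => tp (ls t), hd, o⟩

section

variable {x : List Bool} {M : ℕ}

theorem act_keep {k k' : Ctl} {ih : ℕ} {ls : Fin m → List Bool} {hd : Fin m → ℕ}
    {o : List (Option Bool)} {mv : HeadMove} {e : Option (Option Bool)} :
    (cfg k ih ls hd o).act x (k', mv, keep (fun t => tp (ls t) (hd t)), e) =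
      cfg k' (min (Transducer.moveHead mv ih) (x.length + 1)) ls hd (o ++ e.toList) := by
  simp [Config.act, cfg, keep, Transducer.moveHead]

theorem act_onTape {k k' : Ctl} {ih : ℕ} (hih : ih ≤ x.length + 1) {ls : Fin m → List Bool}
    {hd : Fin m → ℕ} {o : List (Option Bool)} {r : Fin m} {l : List Bool} {p : ℕ} {a : Sym}
    {d : HeadMove} {l' : List Bool} (hl : Function.update (tp l) p a = tp l') :
    (cfg k ih (Function.update ls r l) (Function.update hd r p) o).act x
      (k', .stay, onTape (fun t => tp (Function.update ls r l t) (Function.update hd r p t)) r a d,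
        none) =
      cfg k' ih (Function.update ls r l') (Function.update hd r (Transducer.moveHead d p)) o := by
  have h1 : min (Transducer.moveHead .stay ih) (x.length + 1) = ih := by
    simp [Transducer.moveHead, hih]
  simp only [Config.act, cfg, h1, Option.toList_none, List.append_nil, Config.mk.injEq, true_and,
    and_true]
  constructor
  · funext t
    rcases eq_or_ne t r with rfl | h
    · simp [onTape, hl]
    · have : (t : ℕ) ≠ r := fun h' => h (Fin.ext h')
      simp [onTape, h, this]
  · funext t
    rcases eq_or_ne t r with rfl | h
    · simp [onTape]
    · have : (t : ℕ) ≠ r := fun h' => h (Fin.ext h')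
      simp [onTape, h, this, Transducer.moveHead]

theorem symAt_update {ls : Fin m → List Bool} {hd : Fin m → ℕ} {r : Fin m} {l : List Bool}
    {p : ℕ} :
    symAt (fun t => tp (Function.update ls r l t) (Function.update hd r p t)) r = tp l p := by
  simp [symAt]

theorem step_keep {k k' : Ctl} {ih : ℕ} {ls : Fin m → List Bool} {hd : Fin m → ℕ}
    {o : List (Option Bool)} {mv : HeadMove} {e : Option (Option Bool)} (hM : ∀ t, hd t < M)
    (h : delta m k (Transducer.inputCell x ih) (fun t => tp (ls t) (hd t)) =
      some (k', mv, keep (fun t => tp (ls t) (hd t)), e)) :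
    RunIn x M (cfg k ih ls hd o)
      (cfg k' (min (Transducer.moveHead mv ih) (x.length + 1)) ls hd (o ++ e.toList)) := by
  refine .single ⟨?_, hM⟩
  rw [← act_keep (k := k)]
  exact congrArg (Option.map _) h

theorem step_onTape {k k' : Ctl} {ih : ℕ} (hih : ih ≤ x.length + 1) {ls : Fin m → List Bool}
    {o : List (Option Bool)} {r : Fin m} {l : List Bool} {p : ℕ} {a : Sym}
    {d : HeadMove} {l' : List Bool} (hl : Function.update (tp l) p a = tp l')
    (hM : Transducer.moveHead d p < M)
    (h : ∀ y : Fin m → Sym, symAt y r = tp l p →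
      delta m k (Transducer.inputCell x ih) y = some (k', .stay, onTape y r a d, none)) :
    RunIn x M (cfg k ih (Function.update ls r l) (Function.update 0 r p) o)
      (cfg k' ih (Function.update ls r l')
        (Function.update 0 r (Transducer.moveHead d p)) o) := by
  refine .single ⟨?_, ?_⟩
  · rw [← act_onTape (k := k) hih hl]
    exact congrArg (Option.map _) (h _ symAt_update)
  · intro t
    simp only [cfg]
    rcases eq_or_ne t r with rfl | h
    · simpa using hM
    · simp [h]; omega

/-- The marker `some none` occurs in cell 0 only (`tp_succ_ne`), so the head recognises when it is
home. -/
theorem run_back {ih : ℕ} (hih : ih ≤ x.length + 1) {ls : Fin m → List Bool}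
    {o : List (Option Bool)} {r : Fin m} {l : List Bool} {K : List Prog} :
    ∀ p < M, RunIn x M (cfg (.back r K) ih (Function.update ls r l) (Function.update 0 r p) o)
      (cfg (.main K) ih (Function.update ls r l) 0 o)
  | 0, hp => by
    have h := step_keep (x := x) (M := M) (k := .back r K) (k' := .main K) (ih := ih)
      (ls := Function.update ls r l) (hd := 0) (o := o) (mv := .stay) (e := none)
      (fun _ => hp)
      (by simp [delta, symAt, tp])
    have e : Function.update (0 : Fin m → ℕ) r 0 = 0 := by simp
    rw [e]
    simpa [Transducer.moveHead, hih] using h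
  | p + 1, hp => by
    refine .trans ?_ (run_back hih p (by omega))
    refine step_onTape (d := .left) hih (a := tp l (p + 1)) (by simp)
      (by simp [Transducer.moveHead]; omega) fun y hy => ?_
    have := tp_succ_ne l p
    rw [← hy] at this ⊢
    simp only [delta]

/-- Undoes a failed decrement: a borrow that met only zeros has turned them into ones, and the way
back restores them. -/
theorem run_fix {ih : ℕ} (hih : ih ≤ x.length + 1) {ls : Fin m → List Bool}
    {o : List (Option Bool)} {r : Fin m} {K : List Prog} :
    ∀ p < M, ∀ l, RunIn x M (cfg (.fix r K) ih
      (Function.update ls r (List.replicate p true ++ l)) (Function.update 0 r p) o)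
      (cfg (.main K) ih (Function.update ls r (List.replicate p false ++ l)) 0 o)
  | 0, hp, l => by
    have h := step_keep (x := x) (M := M) (k := .fix r K) (k' := .main K) (ih := ih)
      (ls := Function.update ls r l) (hd := 0) (o := o) (mv := .stay) (e := none)
      (fun _ => hp)
      (by simp [delta, symAt, tp])
    have e : Function.update (0 : Fin m → ℕ) r 0 = 0 := by simp
    rw [e]
    simpa [Transducer.moveHead, hih] using h
  | p + 1, hp, l => by
    rw [List.replicate_succ' (a := false), List.append_assoc]
    refine .trans ?_ (run_fix hih p (by omega) _)
    have h := tp_write (List.replicate p true) l true false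
    have h2 := tp_at (List.replicate p true) l true
    rw [List.length_replicate] at h h2
    rw [List.replicate_succ', List.append_assoc]
    refine step_onTape (d := .left) hih (a := some (some false)) h
      (by simp [Transducer.moveHead]; omega) fun y hy => ?_
    rw [List.singleton_append, h2] at hy
    simp only [delta, hy]

theorem run_carry {ih : ℕ} (hih : ih ≤ x.length + 1) {ls : Fin m → List Bool}
    {o : List (Option Bool)} {r : Fin m} {K : List Prog} :
    ∀ l u, (u ++ incL l).length + 1 < M →
      RunIn x M (cfg (.carry r K) ih (Function.update ls r (u ++ l))
        (Function.update 0 r (u.length + 1)) o)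
      (cfg (.main K) ih (Function.update ls r (u ++ incL l)) 0 o)
  | [], u, h => by
    simp [incL] at h
    refine .trans ?_ (run_back hih u.length (by omega))
    rw [List.append_nil]
    refine step_onTape (d := .left) hih (tp_append u true)
      (by simp [Transducer.moveHead]; omega) fun y hy => ?_
    rw [tp_end] at hy
    simp only [delta, hy]
  | false :: l, u, h => by
    simp [incL] at h
    refine .trans ?_ (run_back hih u.length (by omega))
    refine step_onTape (d := .left) hih (tp_write u l false true)
      (by simp [Transducer.moveHead]; omega) fun y hy => ?_
    rw [tp_at] at hy
    simp only [delta, hy]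
  | true :: l, u, h => by
    simp [incL] at h
    have := run_carry hih (ls := ls) (o := o) (r := r) (K := K) l (u ++ [false])
      (by simp; omega)
    rw [List.append_assoc, List.append_assoc, List.length_append] at this
    refine .trans ?_ this
    refine step_onTape (d := .right) hih (tp_write u l true false)
      (by simp [Transducer.moveHead]; omega) fun y hy => ?_
    rw [tp_at] at hy
    simp only [delta, hy]

theorem run_borrow {ih : ℕ} (hih : ih ≤ x.length + 1) {ls : Fin m → List Bool}
    {o : List (Option Bool)} {r : Fin m} {K K' : List Prog} :
    ∀ l u, val l ≠ 0 → (u ++ l).length + 1 < M →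
      RunIn x M (cfg (.borrow r K K') ih (Function.update ls r (u ++ l))
        (Function.update 0 r (u.length + 1)) o)
      (cfg (.main K) ih (Function.update ls r (u ++ decL l)) 0 o)
  | [], u, h0, h => absurd rfl h0
  | true :: l, u, h0, h => by
    simp at h
    refine .trans ?_ (run_back hih u.length (by omega))
    refine step_onTape (d := .left) hih (tp_write u l true false)
      (by simp [Transducer.moveHead]; omega) fun y hy => ?_
    rw [tp_at] at hy
    simp only [delta, hy]
  | false :: l, u, h0, h => by
    simp at h
    have := run_borrow hih (ls := ls) (o := o) (r := r) (K := K) (K' := K') l (u ++ [true])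
      (by simpa [val] using h0) (by simp; omega)
    rw [List.append_assoc, List.append_assoc, List.length_append] at this
    refine .trans ?_ this
    refine step_onTape (d := .right) hih (tp_write u l false true)
      (by simp [Transducer.moveHead]; omega) fun y hy => ?_
    rw [tp_at] at hy
    simp only [delta, hy]

/-- This is the zero test. Here `i` zeros have been flipped and `j` are still ahead; reaching the
blank shows that the register was 0, and `run_fix` repairs the tape. -/
theorem run_borrow_zero {ih : ℕ} (hih : ih ≤ x.length + 1) {ls : Fin m → List Bool}
    {o : List (Option Bool)} {r : Fin m} {K K' : List Prog} :
    ∀ j i, i + j + 1 < M →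
      RunIn x M (cfg (.borrow r K K') ih
        (Function.update ls r (List.replicate i true ++ List.replicate j false))
        (Function.update 0 r (i + 1)) o)
      (cfg (.main K') ih (Function.update ls r (List.replicate (i + j) false)) 0 o)
  | 0, i, h => by
    have h3 := run_fix (M := M) hih (ls := ls) (o := o) (r := r) (K := K') i (by omega) []
    simp only [List.append_nil] at h3
    simp only [List.replicate_zero, List.append_nil, Nat.add_zero]
    refine .trans ?_ h3
    have h1 := tp_end (List.replicate i true)
    rw [List.length_replicate] at h1
    refine step_onTape (d := .left) hih (a := none) (by rw [← h1]; simp)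
      (by simp [Transducer.moveHead]; omega) fun y hy => ?_
    rw [h1] at hy
    simp only [delta, hy]
  | j + 1, i, h => by
    have := run_borrow_zero hih (ls := ls) (o := o) (r := r) (K := K) (K' := K') j (i + 1)
      (by omega)
    rw [List.replicate_succ', List.append_assoc, show i + 1 + j = i + (j + 1) by omega] at this
    refine .trans ?_ this
    have h1 := tp_write (List.replicate i true) (List.replicate j false) false true
    have h2 := tp_at (List.replicate i true) (List.replicate j false) false
    rw [List.length_replicate] at h1 h2
    refine step_onTape (d := .right) hih h1
      (by simp [Transducer.moveHead]; omega) fun y hy => ?_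
    rw [List.replicate_succ, h2] at hy
    simp only [delta, hy]

/-- The lists `ls` are binary representations, of length at most `n`, of the registers of `s`. -/
def Rep (x : List Bool) (n : ℕ) (s : ProgState) (ls : Fin m → List Bool) : Prop :=
  s.hd ≤ x.length + 1 ∧ ∀ t, val (ls t) = s.reg t ∧ (ls t).length ≤ n

theorem Rep.update {n : ℕ} {s : ProgState} {ls : Fin m → List Bool} (h : Rep x n s ls) (r : Fin m)
    {l : List Bool} {v : ℕ} (hv : val l = v) (hl : l.length ≤ n) :
    Rep x n { s with reg := Function.update s.reg r v } (Function.update ls r l) := by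
  refine ⟨h.1, fun t => ?_⟩
  rcases eq_or_ne t r with rfl | ht
  · simp [hv, hl]
  · have : (t : ℕ) ≠ r := fun h' => ht (Fin.ext h')
    simpa [ht, this] using h.2 t

theorem inputCell_eq_leftEnd {p : ℕ} :
    Transducer.inputCell x p = .leftEnd ↔ p = 0 := by
  rcases p with _ | p
  · simp [Transducer.inputCell]
  · simp only [Transducer.inputCell]
    rcases x[p]? with _ | b <;> simp

theorem run_home {ls : Fin m → List Bool} {o : List (Option Bool)} {K : List Prog} (hM : 0 < M) :
    ∀ p, RunIn x M (cfg (.main (.home :: K)) p ls 0 o) (cfg (.main K) 0 ls 0 o) := by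
  intro p
  induction p using Nat.strong_induction_on with
  | _ p ih =>
    rcases Nat.eq_zero_or_pos p with rfl | hp
    · have := step_keep (x := x) (M := M) (k := .main (.home :: K)) (k' := .main K) (ih := 0)
        (ls := ls) (hd := 0) (o := o) (mv := .stay) (e := none) (fun _ => hM)
        (by simp [delta, Transducer.inputCell])
      simpa [Transducer.moveHead] using this
    · have := step_keep (x := x) (M := M) (k := .main (.home :: K)) (k' := .main (.home :: K))
        (ih := p) (ls := ls) (hd := 0) (o := o) (mv := .left) (e := none) (fun _ => hM)
        (by
          have h : Transducer.inputCell x p ≠ .leftEnd := by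
            rw [Ne, inputCell_eq_leftEnd]; omega
          rcases h' : Transducer.inputCell x p with _ | _ | _
          · exact absurd h' h
          · simp only [delta]
          · simp only [delta])
      simp only [Option.toList_none, List.append_nil] at this
      exact this.trans (ih _ (by simp [Transducer.moveHead]; omega))

/-- Induction on the execution, with the list `K` of remaining programs as a continuation and all
work heads back in cell 0 between instructions. The `n + 2` cells are the marker, at most `n` bits,
and the blank behind them that the zero test must see. -/
theorem run_prog {n B : ℕ} (hB : B < 2 ^ n) {p : Prog} {s s' : ProgState} (h : Exec x B p s s') :
    p.Below m → ∀ (K : List Prog) (ls : Fin m → List Bool), Rep x n s ls → ∃ ls', Rep x n s' ls' ∧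
      RunIn x (n + 2) (cfg (.main (p :: K)) s.hd ls 0 s.out) (cfg (.main K) s'.hd ls' 0 s'.out) := by
  have stay : ∀ {p : ℕ}, p ≤ x.length + 1 →
      min (Transducer.moveHead .stay p) (x.length + 1) = p := fun h => min_eq_left h
  have move : ∀ {p : ℕ}, p ≤ x.length + 1 → ∀ {k k' : Ctl} {ls : Fin m → List Bool}
      {o : List (Option Bool)} {e : Option (Option Bool)},
      delta m k (Transducer.inputCell x p) (fun t => tp (ls t) 0) =
        some (k', .stay, keep (fun t => tp (ls t) 0), e) →
      RunIn x (n + 2) (cfg k p ls 0 o) (cfg k' p ls 0 (o ++ e.toList)) := by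
    intro p hp k k' ls o e h
    have := step_keep (x := x) (M := n + 2) (hd := 0) (o := o) (fun _ => by simp) h
    rwa [stay hp] at this
  have start : ∀ {p : ℕ}, p ≤ x.length + 1 → ∀ {k k' : Ctl} {ls : Fin m → List Bool}
      {o : List (Option Bool)} (r : Fin m), (∀ y : Fin m → Sym, delta m k
        (Transducer.inputCell x p) y = some (k', .stay, onTape y r (symAt y r) .right, none)) →
      RunIn x (n + 2) (cfg k p ls 0 o)
        (cfg k' p (Function.update ls r ([] ++ ls r))
          (Function.update 0 r (([] : List Bool).length + 1)) o) := by
    intro p hp k k' ls o r h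
    have := step_onTape (x := x) (M := n + 2) (k := k) (k' := k') (o := o) (r := r) (p := 0)
      (a := tp (ls r) 0) (d := .right) (ls := ls) (l := ls r) (l' := ls r) hp (by simp)
      (by simp [Transducer.moveHead]) (fun y hy => by rw [h, hy])
    have e : Function.update (0 : Fin m → ℕ) r 0 = 0 := by simp
    simpa [e, Transducer.moveHead] using this
  induction h with
  | skip s =>
    intro _ K ls hr
    refine ⟨ls, hr, ?_⟩
    simpa using move hr.1 (e := none) (o := s.out) (by simp [delta])
  | inc r s hs =>
    intro hp K ls hr
    obtain ⟨hv, hl⟩ := hr.2 ⟨r, hp⟩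
    have hle : (incL (ls ⟨r, hp⟩)).length ≤ n := length_incL_le hl (by rw [hv]; exact hs) hB
    refine ⟨_, hr.update ⟨r, hp⟩ (by rw [val_incL, hv]) hle, ?_⟩
    exact (start hr.1 ⟨r, hp⟩ fun y => by simp [delta]).trans
      (run_carry hr.1 _ _ (by simp; omega))
  | out o s =>
    intro _ K ls hr
    exact ⟨ls, hr, move hr.1 (e := some o) (by simp [delta])⟩
  | right s =>
    intro _ K ls hr
    refine ⟨ls, ⟨by simp, hr.2⟩, ?_⟩
    have := step_keep (x := x) (M := n + 2) (k := .main (.right :: K)) (k' := .main K)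
      (ih := s.hd) (ls := ls) (hd := 0) (o := s.out) (mv := .right) (e := none)
      (fun _ => by simp) (by simp [delta])
    rwa [Option.toList_none, List.append_nil] at this
  | home s =>
    intro _ K ls hr
    exact ⟨ls, ⟨by simp, hr.2⟩, run_home (by simp) _⟩
  | ifTrue f p s s' hf _ ih =>
    intro hp K ls hr
    obtain ⟨ls', hr', h'⟩ := ih hp K ls hr
    refine ⟨ls', hr', .trans ?_ h'⟩
    simpa using move hr.1 (e := none) (o := s.out) (by simp [delta, hf])
  | ifFalse f p s hf =>
    intro _ K ls hr
    refine ⟨ls, hr, ?_⟩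
    simpa using move hr.1 (e := none) (o := s.out) (by simp [delta, hf])
  | seq p q s₁ s₂ s₃ _ _ ih₁ ih₂ =>
    intro hp K ls hr
    obtain ⟨ls₁, hr₁, h₁⟩ := ih₁ hp.1 (q :: K) ls hr
    obtain ⟨ls₂, hr₂, h₂⟩ := ih₂ hp.2 K ls₁ hr₁
    refine ⟨ls₂, hr₂, .trans ?_ (h₁.trans h₂)⟩
    simpa using move hr.1 (e := none) (o := s₁.out) (by simp [delta])
  | loopZero r p s hs =>
    rintro ⟨hp, -⟩ K ls hr
    obtain ⟨hv, hl⟩ := hr.2 ⟨r, hp⟩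
    refine ⟨ls, hr, ?_⟩
    have hz := eq_replicate_of_val (ls ⟨r, hp⟩) (by rw [hv]; exact hs)
    refine (start (k' := .borrow r (p :: .loop r p :: K) K) hr.1 ⟨r, hp⟩
      fun y => by simp [delta]).trans ?_
    have := run_borrow_zero (x := x) (M := n + 2) hr.1 (ls := ls) (o := s.out) (r := ⟨r, hp⟩)
      (K := p :: .loop r p :: K) (K' := K) (ls ⟨r, hp⟩).length 0 (by omega)
    rw [Nat.zero_add (ls ⟨r, hp⟩).length, ← hz, Function.update_eq_self] at this
    exact this
  | loopSucc r p s s₁ s₂ hs _ _ ih₁ ih₂ =>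
    rintro ⟨hp, hp'⟩ K ls hr
    obtain ⟨hv, hl⟩ := hr.2 ⟨r, hp⟩
    have hne : val (ls ⟨r, hp⟩) ≠ 0 := by rw [hv]; exact hs
    obtain ⟨ls₁, hr₁, h₁⟩ := ih₁ hp' (.loop r p :: K) _ (hr.update ⟨r, hp⟩
      (by rw [val_decL _ hne, hv]) (by rw [length_decL]; exact hl))
    obtain ⟨ls₂, hr₂, h₂⟩ := ih₂ ⟨hp, hp'⟩ K ls₁ hr₁
    refine ⟨ls₂, hr₂, .trans ?_ (h₁.trans h₂)⟩
    exact (start (k' := .borrow r (p :: .loop r p :: K) K) hr.1 ⟨r, hp⟩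
      fun y => by simp [delta]).trans
      (run_borrow (M := n + 2) (ls := ls) (o := s.out) (r := ⟨r, hp⟩)
        (K := p :: .loop r p :: K) (K' := K) hr.1 (ls ⟨r, hp⟩) [] hne (by simp only [List.nil_append]; omega))

end

/-! #### The finite set of control states -/

/-- The lists of remaining programs that occur while `p` is run before `K`. -/
def conts : Prog → List Prog → Set (List Prog)
  | .ifCell f p, K => insert (.ifCell f p :: K) (conts p K)
  | .seq p q, K => insert (.seq p q :: K) (conts p (q :: K) ∪ conts q K)
  | .loop r p, K => insert (.loop r p :: K) (conts p (.loop r p :: K))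
  | p, K => {p :: K}

theorem finite_conts : ∀ (p : Prog) (K : List Prog), (conts p K).Finite
  | .ifCell _ p, K => (finite_conts p K).insert _
  | .seq p q, K => ((finite_conts p _).union (finite_conts q K)).insert _
  | .loop _ p, _ => (finite_conts p _).insert _
  | .skip, _ => Set.finite_singleton _
  | .inc _, _ => Set.finite_singleton _
  | .out _, _ => Set.finite_singleton _
  | .right, _ => Set.finite_singleton _
  | .home, _ => Set.finite_singleton _

theorem mem_conts (p : Prog) (K : List Prog) : p :: K ∈ conts p K := by
  cases p <;> simp [conts]

/-- The lists that can follow `K` are in `𝒦`, and registers are below `m`. -/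
def Next (m : ℕ) (𝒦 : Set (List Prog)) : List Prog → Prop
  | [] => True
  | .inc r :: K => r < m ∧ K ∈ 𝒦
  | .ifCell _ p :: K => p :: K ∈ 𝒦 ∧ K ∈ 𝒦
  | .seq p q :: K => p :: q :: K ∈ 𝒦
  | .loop r p :: K => r < m ∧ p :: .loop r p :: K ∈ 𝒦 ∧ K ∈ 𝒦
  | _ :: K => K ∈ 𝒦

/-- Finitely many continuations suffice although loops push themselves back: the body of a loop is
run before the very list that starts with this loop, which is already in `𝒦`. -/
theorem next_of_mem_conts {𝒦 : Set (List Prog)} : ∀ (p : Prog) (K : List Prog), p.Below m →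
    conts p K ⊆ 𝒦 → K ∈ 𝒦 → ∀ K' ∈ conts p K, Next m 𝒦 K'
  | .ifCell f p, K, hp, hs, hK, K', h => by
    rw [conts, Set.insert_subset_iff] at hs
    rcases h with rfl | h
    · exact ⟨hs.2 (mem_conts _ _), hK⟩
    · exact next_of_mem_conts p K hp hs.2 hK K' h
  | .seq p q, K, hp, hs, hK, K', h => by
    rw [conts, Set.insert_subset_iff, Set.union_subset_iff] at hs
    rcases h with rfl | h | h
    · exact hs.2.1 (mem_conts _ _)
    · exact next_of_mem_conts p _ hp.1 hs.2.1 (hs.2.2 (mem_conts _ _)) K' h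
    · exact next_of_mem_conts q _ hp.2 hs.2.2 hK K' h
  | .loop r p, K, hp, hs, hK, K', h => by
    rw [conts, Set.insert_subset_iff] at hs
    rcases h with rfl | h
    · exact ⟨hp.1, hs.2 (mem_conts _ _), hK⟩
    · exact next_of_mem_conts p _ hp.2 hs.2 hs.1 K' h
  | .skip, _, _, _, hK, _, h => by rw [Set.mem_singleton_iff.1 h]; exact hK
  | .inc _, _, hp, _, hK, _, h => by rw [Set.mem_singleton_iff.1 h]; exact ⟨hp, hK⟩
  | .out _, _, _, _, hK, _, h => by rw [Set.mem_singleton_iff.1 h]; exact hK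
  | .right, _, _, _, hK, _, h => by rw [Set.mem_singleton_iff.1 h]; exact hK
  | .home, _, _, _, hK, _, h => by rw [Set.mem_singleton_iff.1 h]; exact hK

/-- The control states with lists from `𝒦` and registers below `m`. -/
def ctls (m : ℕ) (𝒦 : Set (List Prog)) : Set Ctl :=
  (Ctl.boot '' 𝒦 ∪ Ctl.main '' 𝒦) ∪
  ((fun y : ℕ × List Prog => Ctl.carry y.1 y.2) '' (Set.Iio m ×ˢ 𝒦) ∪
  (fun y : ℕ × List Prog => Ctl.back y.1 y.2) '' (Set.Iio m ×ˢ 𝒦)) ∪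
  ((fun y : ℕ × List Prog => Ctl.fix y.1 y.2) '' (Set.Iio m ×ˢ 𝒦) ∪
  (fun y : ℕ × List Prog × List Prog => Ctl.borrow y.1 y.2.1 y.2.2) '' (Set.Iio m ×ˢ 𝒦 ×ˢ 𝒦))

theorem finite_ctls {𝒦 : Set (List Prog)} (h : 𝒦.Finite) : (ctls m 𝒦).Finite := by
  have h' := (Set.finite_Iio m).prod h
  exact (((h.image _).union (h.image _)).union ((h'.image _).union (h'.image _))).union
    ((h'.image _).union (((Set.finite_Iio m).prod (h.prod h)).image _))

theorem trans_mem {𝒦 : Set (List Prog)} (h𝒦 : ∀ K ∈ 𝒦, Next m 𝒦 K) {k : Ctl}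
    (hk : k ∈ ctls m 𝒦) {c : InputCell Bool} {y : Fin m → Sym} {a : Action m}
    (h : delta m k c y = some a) : a.1 ∈ ctls m 𝒦 := by
  cases k with
  | boot K =>
    simp [ctls] at hk
    simp [delta] at h
    subst h
    simp [ctls, hk]
  | main K =>
    simp [ctls] at hk
    have hn := h𝒦 K hk
    rcases K with _ | ⟨p, K⟩
    · simp [delta] at h
    · cases p with
      | home =>
        cases c <;> simp [delta] at h <;> subst h <;> simp [ctls, hk]
        exact hn
      | ifCell f p =>
        simp [delta] at h
        subst h
        by_cases hf : f c = true
        · simp [ctls, hf]; exact hn.1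
        · simp [ctls, hf]; exact hn.2
      | _ =>
        simp [delta] at h
        subst h
        simpa [ctls, Next] using hn
  | carry r K =>
    simp [ctls] at hk
    simp only [delta] at h
    split at h <;> simp at h <;> subst h <;> simp [ctls, hk]
  | back r K =>
    simp [ctls] at hk
    simp only [delta] at h
    split at h <;> simp at h <;> subst h <;> simp [ctls, hk]
  | borrow r K K' =>
    simp [ctls] at hk
    simp only [delta] at h
    split at h <;> simp at h <;> subst h <;> simp [ctls, hk]
  | fix r K =>
    simp [ctls] at hk
    simp only [delta] at h
    split at h <;> simp at h <;> subst h <;> simp [ctls, hk]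

open Classical in
/-- The transducer with the control states in a finite set. -/
noncomputable def machine (m : ℕ) (S : Set Ctl) (hS : S.Finite) (k : S) :
    Transducer Bool (Option Bool) where
  Control := S
  Work := Sym
  Tapes := Fin m
  finiteControl := hS
  blank := none
  start := k
  trans c i y := (delta m c.1 i y).bind fun a =>
    if h : a.1 ∈ S then some (⟨a.1, h⟩, a.2) else none

/-- Forget that the control state is in the finite set. -/
def forget {S : Set Ctl} {hS : S.Finite} {k : S} (c : (machine m S hS k).Cfg) : Config m :=
  ⟨(show S from c.control).1, c.inputHead, c.tape, c.head, c.output⟩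

/-- When `S` is closed under `delta`, the membership test in `machine` never fails, so the cut to
finitely many control states changes no step. -/
theorem step_forget {S : Set Ctl} {hS : S.Finite} {k : S}
    (h : ∀ k ∈ S, ∀ (c : InputCell Bool) (y : Fin m → Sym) (a : Action m),
      delta m k c y = some a → a.1 ∈ S) (x : List Bool) (c : (machine m S hS k).Cfg) :
    ((machine m S hS k).step x c).map forget = step x (forget c) := by
  have hc := h _ (show S from c.control).2 (Transducer.inputCell x c.inputHead)
    (fun t => c.tape t (c.head t))
  simp only [Transducer.step, step, machine, forget]
  rcases e : delta m (show S from c.control).1 (Transducer.inputCell x c.inputHead)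
    (fun t => c.tape t (c.head t)) with _ | a
  · rfl
  · have := hc a e
    simp only [Option.bind_some, this, dif_pos, Option.map_some, Config.act]
    rfl

end CounterMachine

-- The machine depends on the program alone; `B` and `n` enter only into its analysis, so a single
-- machine serves all inputs.
open CounterMachine in
theorem Prog.exists_transducer (p : Prog) : ∃ T : Transducer Bool (Option Bool),
    ∀ (x : List Bool) (B n : ℕ) (s : ProgState), B < 2 ^ n →
      Exec x B p ⟨fun _ => 0, 0, []⟩ s → T.HaltsWith x s.out ∧ T.UsesSpace x (n + 2) := by
  obtain ⟨m, hm⟩ := p.exists_below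
  set 𝒦 : Set (List Prog) := insert [] (conts p []) with h𝒦
  have hn : ∀ K ∈ 𝒦, Next m 𝒦 K := by
    rintro K (rfl | hK)
    · trivial
    · exact next_of_mem_conts p [] hm (Set.subset_insert _ _) (Set.mem_insert _ _) K hK
  have hfin : (ctls m 𝒦).Finite := finite_ctls ((finite_conts p []).insert _)
  have hk : Ctl.boot [p] ∈ ctls m 𝒦 := by
    have := mem_conts p []
    simp [ctls, 𝒦, this]
  have hS : ∀ k ∈ ctls m 𝒦, ∀ (c : InputCell Bool) (y : Fin m → Sym) (a : Action m),
      delta m k c y = some a → a.1 ∈ ctls m 𝒦 := fun k hk c y a => trans_mem hn hk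
  refine ⟨machine m _ hfin ⟨_, hk⟩, fun x B n s hB hE => ?_⟩
  set T := machine m _ hfin ⟨_, hk⟩
  have hstep := step_forget (k := ⟨_, hk⟩) (hS := hfin) hS x
  -- The boot step marks cell 0 of every tape; each register then holds the empty list of bits, that
  -- is 0.
  have hboot : RunIn x (n + 2) (forget T.initCfg) (cfg (.main [p]) 0 (fun _ => []) 0 []) := by
    refine .single ⟨?_, fun t => by simp [cfg]⟩
    simp only [step, forget, T, machine, Transducer.initCfg, delta, Option.map_some, Config.act,
      cfg, Option.some.injEq, Config.mk.injEq, Transducer.moveHead]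
    refine ⟨trivial, by simp, ?_, rfl, by simp⟩
    funext t q
    rcases q with _ | q <;> simp [tp]
  obtain ⟨ls, -, hrun⟩ := run_prog (m := m) hB hE hm [] (fun _ => [])
    ⟨by simp, fun t => by simp [val]⟩
  have hrun := hboot.trans hrun
  set d := cfg (m := m) (.main []) s.hd ls 0 s.out
  have hd : step x d = none := by simp [step, d, cfg, delta]
  have lift : ∀ {c e : Config m}, RunIn x (n + 2) c e → ∀ c' : T.Cfg, T.Reaches x c' →
      forget c' = c → ∃ e' : T.Cfg, T.Reaches x e' ∧ forget e' = e := by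
    intro c e h
    induction h with
    | refl => exact fun c' h h' => ⟨c', h, h'⟩
    | tail _ h₂ ih =>
      intro c' hc hc'
      obtain ⟨e', he, rfl⟩ := ih c' hc hc'
      have := hstep e'
      rw [h₂.1] at this
      obtain ⟨f, hf, hf'⟩ := Option.map_eq_some_iff.1 this
      exact ⟨f, he.tail hf, hf'⟩
  refine ⟨?_, ?_⟩
  · obtain ⟨e, he, he'⟩ := lift hrun T.initCfg .refl rfl
    refine ⟨e, he, ?_, ?_⟩
    · have := hstep e
      rw [he', hd] at this
      exact Option.map_eq_none_iff.1 this
    · exact congrArg Config.out he'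
  · intro c hc
    -- By determinism every reachable configuration lies on the one halting run: the invariant says
    -- that `d` is still ahead of it.
    have : RunIn x (n + 2) (forget c) d ∧ ∀ t, (forget c).head t < n + 2 := by
      induction hc with
      | refl => exact ⟨hrun, fun t => by simp [forget, Transducer.initCfg]⟩
      | @tail c e _ h₂ ih =>
        have h₃ := hstep c
        rw [h₂] at h₃
        rcases ih.1.cases_head with h | ⟨f, hf, hf'⟩
        · rw [h, hd] at h₃; simp at h₃
        · rw [hf.1] at h₃
          simp at h₃
          rw [h₃]
          exact ⟨hf', hf.2⟩
    exact this.2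

/-! ### Derived programs -/

section

variable {x : List Bool} {B : ℕ}

theorem Exec.inc_of {r h : ℕ} {σ σ' : ℕ → ℕ} {o : List (Option Bool)} (hB : σ r + 1 ≤ B)
    (e : σ' = Function.update σ r (σ r + 1)) : Exec x B (.inc r) ⟨σ, h, o⟩ ⟨σ', h, o⟩ := by
  subst e
  exact Exec.inc r ⟨σ, h, o⟩ hB

/-- A loop passes through the states `f 0, …, f N`. -/
theorem Exec.loop_of {r : ℕ} {p : Prog} (f : ℕ → ProgState) (N : ℕ)
    (h : ∀ j < N, (f j).reg r ≠ 0 ∧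
      Exec x B p { f j with reg := Function.update (f j).reg r ((f j).reg r - 1) } (f (j + 1)))
    (hN : (f N).reg r = 0) : Exec x B (.loop r p) (f 0) (f N) := by
  -- Induction on the number `k` of passes still to be made.
  have : ∀ k ≤ N, Exec x B (.loop r p) (f (N - k)) (f N) := by
    intro k
    induction k with
    | zero => exact fun _ => Exec.loopZero r p _ hN
    | succ k ih =>
      intro hk
      obtain ⟨h1, h2⟩ := h (N - (k + 1)) (by omega)
      rw [show N - (k + 1) + 1 = N - k by omega] at h2
      exact Exec.loopSucc r p _ _ _ h1 h2 (ih (by omega))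
  simpa using this N le_rfl

/-- Set a register to zero. -/
def Prog.zero (r : ℕ) : Prog := .loop r .skip

theorem Exec.zero {r h : ℕ} {σ σ' : ℕ → ℕ} {o : List (Option Bool)}
    (e : σ' = Function.update σ r 0) : Exec x B (.zero r) ⟨σ, h, o⟩ ⟨σ', h, o⟩ := by
  subst e
  have := Exec.loop_of (x := x) (B := B) (r := r) (p := .skip)
    (fun j => ⟨Function.update σ r (σ r - j), h, o⟩) (σ r)
    (fun j hj => ⟨by simp; omega, by
      simp only [Function.update_self, Function.update_idem, Nat.sub_sub]
      exact Exec.skip _⟩) (by simp)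
  unfold Prog.zero
  simpa using this

/-- Add the register `r` to `t` and set it to zero. -/
def Prog.move (r t : ℕ) : Prog := .loop r (.inc t)

theorem Exec.move {r t h : ℕ} {σ σ' : ℕ → ℕ} {o : List (Option Bool)} (hrt : r ≠ t)
    (hB : σ t + σ r ≤ B)
    (e : σ' = Function.update (Function.update σ r 0) t (σ t + σ r)) :
    Exec x B (.move r t) ⟨σ, h, o⟩ ⟨σ', h, o⟩ := by
  subst e
  have := Exec.loop_of (x := x) (B := B) (r := r) (p := .inc t)
    (fun j => ⟨Function.update (Function.update σ r (σ r - j)) t (σ t + j), h, o⟩) (σ r)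
    (fun j hj => ⟨by simp [hrt]; omega, by
      refine Exec.inc_of ?_ ?_
      · simp [hrt.symm]; omega
      · funext i
        simp only [Function.update_apply]
        split_ifs <;> omega⟩) (by simp [hrt])
  unfold Prog.move
  simpa using this

/-- Copy the register `a` to `b`, using `t`. -/
def Prog.copy (a b t : ℕ) : Prog := .seq (.loop a (.seq (.inc b) (.inc t))) (.move t a)

theorem Exec.copy {a b t h : ℕ} {σ σ' : ℕ → ℕ} {o : List (Option Bool)} (hab : a ≠ b)
    (hat : a ≠ t) (hbt : b ≠ t) (hb : σ b = 0) (ht : σ t = 0) (hB : σ a ≤ B)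
    (e : σ' = Function.update σ b (σ a)) :
    Exec x B (.copy a b t) ⟨σ, h, o⟩ ⟨σ', h, o⟩ := by
  subst e
  have := Exec.loop_of (x := x) (B := B) (r := a) (p := .seq (.inc b) (.inc t))
    (fun j => ⟨Function.update (Function.update (Function.update σ a (σ a - j)) b j) t j, h, o⟩)
    (σ a)
    (fun j hj => ⟨by simp [hab, hat]; omega, by
      refine Exec.seq _ _ _
        ⟨Function.update (Function.update (Function.update σ a (σ a - (j + 1))) b (j + 1)) t j,
          h, o⟩ _ (Exec.inc_of ?_ ?_) (Exec.inc_of ?_ ?_)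
      · simp [hab.symm, hbt]; omega
      · funext i
        simp only [Function.update_apply]
        split_ifs <;> omega
      · simp; omega
      · simp⟩) (by simp [hab, hat])
  refine Exec.seq _ _ _ _ _ ?_ (Exec.move (σ := Function.update (Function.update
    (Function.update σ a 0) b (σ a)) t (σ a)) hat.symm ?_ ?_)
  · convert this using 2
    · funext i
      simp only [Function.update_apply]
      split_ifs <;> simp_all
    · simp
  · simp [hab, hat, hB]
  · funext i
    simp only [Function.update_apply]
    split_ifs <;> simp_all

end

/-! ### Primitive recursive expressions and their compilation to counter programs. -/

/-! ### Arithmetic expressions -/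

/-- Expressions with `n` variables, which can refer to the input. -/
inductive Code : ℕ → Type
  | zero {n : ℕ} : Code n
  | succ {n : ℕ} (e : Code n) : Code n
  | var {n : ℕ} (i : Fin n) : Code n
  | len {n : ℕ} : Code n
  | bit {n : ℕ} (e : Code n) : Code n
  | iter {n : ℕ} (e₀ e₁ : Code n) (e₂ : Code (n + 2)) : Code n

/-- Bit `i` of the input, and `0` beyond its end. -/
def bitAt (x : List Bool) (i : ℕ) : ℕ := if x[i]? = some true then 1 else 0

namespace Code

/-- The value of an expression. The expression `iter e₀ e₁ e₂` stands for primitive recursion. -/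
def eval (x : List Bool) : {n : ℕ} → Code n → (Fin n → ℕ) → ℕ
  | _, .zero, _ => 0
  | _, .succ e, ρ => e.eval x ρ + 1
  | _, .var i, ρ => ρ i
  | _, .len, _ => x.length
  | _, .bit e, ρ => bitAt x (e.eval x ρ)
  | _, .iter e₀ e₁ e₂, ρ =>
    Nat.rec (e₁.eval x ρ) (fun j a => e₂.eval x (Fin.cons a (Fin.cons j ρ))) (e₀.eval x ρ)

/-- All values that occur in the evaluation are at most `B`. -/
def Bdd (x : List Bool) (B : ℕ) : {n : ℕ} → Code n → (Fin n → ℕ) → Prop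
  | _, .zero, _ => True
  | _, .succ e, ρ => e.Bdd x B ρ ∧ e.eval x ρ + 1 ≤ B
  | _, .var i, ρ => ρ i ≤ B
  | _, .len, _ => x.length ≤ B
  | _, .bit e, ρ => e.Bdd x B ρ
  | _, .iter e₀ e₁ e₂, ρ => e₀.Bdd x B ρ ∧ e₁.Bdd x B ρ ∧ ∀ j < e₀.eval x ρ,
      e₂.Bdd x B (Fin.cons
        (Nat.rec (e₁.eval x ρ) (fun j a => e₂.eval x (Fin.cons a (Fin.cons j ρ))) j : ℕ)
        (Fin.cons j ρ))

theorem bitAt_le (x : List Bool) (i : ℕ) : bitAt x i ≤ 1 := by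
  unfold bitAt; split_ifs <;> simp

/-- The bound `1 ≤ B` is there for `bit`, whose value `Bdd` does not constrain; in a recursion the
last pass bounds the result. -/
theorem Bdd.eval_le {x : List Bool} {B : ℕ} (hB : 1 ≤ B) : ∀ {n : ℕ} {e : Code n}
    {ρ : Fin n → ℕ}, e.Bdd x B ρ → e.eval x ρ ≤ B
  | _, .zero, _, _ => Nat.zero_le _
  | _, .succ _, _, h => h.2
  | _, .var _, _, h => h
  | _, .len, _, h => h
  | _, .bit _, _, _ => (bitAt_le _ _).trans hB
  | _, .iter e₀ e₁ e₂, ρ, h => by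
    simp only [eval]
    rcases e : e₀.eval x ρ with _ | k
    · exact Bdd.eval_le hB h.2.1
    · exact Bdd.eval_le hB (h.2.2 k (by omega))

theorem Bdd.mono {x : List Bool} {B B' : ℕ} (hB : B ≤ B') : ∀ {n : ℕ} {e : Code n}
    {ρ : Fin n → ℕ}, e.Bdd x B ρ → e.Bdd x B' ρ
  | _, .zero, _, _ => trivial
  | _, .succ _, _, h => ⟨Bdd.mono hB h.1, h.2.trans hB⟩
  | _, .var _, _, h => le_trans h hB
  | _, .len, _, h => le_trans h hB
  | _, .bit e, _, h => Bdd.mono (e := e) hB h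
  | _, .iter _ _ _, _, h =>
    ⟨Bdd.mono hB h.1, Bdd.mono hB h.2.1, fun j hj => Bdd.mono hB (h.2.2 j hj)⟩

/-- Rename the variables. -/
def rename : {n m : ℕ} → (Fin n → Fin m) → Code n → Code m
  | _, _, _, .zero => .zero
  | _, _, ξ, .succ e => .succ (e.rename ξ)
  | _, _, ξ, .var i => .var (ξ i)
  | _, _, _, .len => .len
  | _, _, ξ, .bit e => .bit (e.rename ξ)
  | _, _, ξ, .iter e₀ e₁ e₂ => .iter (e₀.rename ξ) (e₁.rename ξ)
      (e₂.rename (Fin.cons 0 (Fin.cons 1 fun i => (ξ i).succ.succ)))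

theorem cons_comp_lift {n m : ℕ} (ξ : Fin n → Fin m) (ρ : Fin m → ℕ) (a j : ℕ) :
    (Fin.cons a (Fin.cons j ρ : Fin (m + 1) → ℕ) : Fin (m + 2) → ℕ) ∘
      (Fin.cons 0 (Fin.cons 1 fun i => (ξ i).succ.succ : Fin (n + 1) → Fin (m + 2)) :
        Fin (n + 2) → Fin (m + 2)) =
    Fin.cons a (Fin.cons j (ρ ∘ ξ) : Fin (n + 1) → ℕ) := by
  funext i
  refine Fin.cases ?_ (fun i => Fin.cases ?_ (fun i => ?_) i) i
  · simp
  · rw [Function.comp_apply, Fin.cons_succ, Fin.cons_zero, Fin.cons_succ, Fin.cons_zero]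
    exact Fin.cons_succ (α := fun _ => ℕ) a (Fin.cons j ρ) 0
  · simp

theorem eval_rename (x : List Bool) : ∀ {n m : ℕ} (e : Code n) (ξ : Fin n → Fin m)
    (ρ : Fin m → ℕ), (e.rename ξ).eval x ρ = e.eval x (ρ ∘ ξ)
  | _, _, .zero, _, _ => rfl
  | _, _, .succ e, ξ, ρ => by simp [rename, eval, eval_rename x e]
  | _, _, .var _, _, _ => rfl
  | _, _, .len, _, _ => rfl
  | _, _, .bit e, ξ, ρ => by simp [rename, eval, eval_rename x e]
  | _, _, .iter e₀ e₁ e₂, ξ, ρ => by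
    simp only [rename, eval, eval_rename x e₀, eval_rename x e₁, eval_rename x e₂, cons_comp_lift]

theorem bdd_rename (x : List Bool) (B : ℕ) : ∀ {n m : ℕ} (e : Code n) (ξ : Fin n → Fin m)
    (ρ : Fin m → ℕ), (e.rename ξ).Bdd x B ρ ↔ e.Bdd x B (ρ ∘ ξ)
  | _, _, .zero, _, _ => Iff.rfl
  | _, _, .succ e, ξ, ρ => by simp [rename, Bdd, eval_rename, bdd_rename x B e]
  | _, _, .var _, _, _ => Iff.rfl
  | _, _, .len, _, _ => Iff.rfl
  | _, _, .bit e, ξ, ρ => by simp [rename, Bdd, bdd_rename x B e]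
  | _, _, .iter e₀ e₁ e₂, ξ, ρ => by
    simp only [rename, Bdd, eval_rename, bdd_rename x B e₀, bdd_rename x B e₁, bdd_rename x B e₂,
      cons_comp_lift]

/-- Whether a cell is not the right end marker. -/
def notEnd : InputCell Bool → Bool
  | .rightEnd => false
  | _ => true

/-- Whether a cell holds `true`. -/
def isTrue : InputCell Bool → Bool
  | .symbol true => true
  | _ => false

/-- The program that computes an expression, with variables at `loc` and the result in `b`. -/
def compile : {n : ℕ} → Code n → (Fin n → ℕ) → ℕ → Prog
  | _, .zero, _, _ => .skip
  | _, .succ e, loc, b => .seq (e.compile loc b) (.inc b)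
  | _, .var i, loc, b => .copy (loc i) b (b + 1)
  | _, .len, _, b => .seq .right (.seq (.ifCell notEnd (.inc (b + 1)))
      (.seq (.loop (b + 1) (.seq (.inc b) (.seq .right (.ifCell notEnd (.inc (b + 1)))))) .home))
  | _, .bit e, loc, b => .seq (e.compile loc b) (.seq .right (.seq (.loop b .right)
      (.seq (.ifCell isTrue (.inc b)) .home)))
  | _, .iter e₀ e₁ e₂, loc, b => .seq (e₁.compile loc b) (.seq (e₀.compile loc (b + 1))
      (.seq (.loop (b + 1) (.seq (e₂.compile (Fin.cons b (Fin.cons (b + 2) loc)) (b + 3))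
        (.seq (.zero b) (.seq (.move (b + 3) b) (.inc (b + 2)))))) (.zero (b + 2))))

theorem exec_ifCell_inc {x : List Bool} {B : ℕ} {f : InputCell Bool → Bool} {r h : ℕ}
    {σ : ℕ → ℕ} {o : List (Option Bool)} {v : ℕ} (hB : 1 ≤ B)
    (hr : σ r = 0) (hv : v = if f (Transducer.inputCell x h) then 1 else 0) :
    Exec x B (.ifCell f (.inc r)) ⟨σ, h, o⟩ ⟨Function.update σ r v, h, o⟩ := by
  subst hv
  by_cases e : f (Transducer.inputCell x h) = true
  · exact Exec.ifTrue _ _ _ _ e (Exec.inc_of (by omega) (by simp [e, hr]))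
  · have : Function.update σ r (if f (Transducer.inputCell x h) = true then 1 else 0) = σ := by
      rw [if_neg e, ← hr, Function.update_eq_self]
    rw [this]
    exact Exec.ifFalse _ _ _ (by simpa using e)

theorem notEnd_inputCell (x : List Bool) (j : ℕ) :
    notEnd (Transducer.inputCell x (j + 1)) = decide (j < x.length) := by
  by_cases h : j < x.length
  · simp [Transducer.inputCell, h, notEnd]
  · simp [Transducer.inputCell, h, notEnd]

theorem isTrue_inputCell (x : List Bool) (j : ℕ) :
    (if isTrue (Transducer.inputCell x (min j x.length + 1)) then 1 else 0) = bitAt x j := by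
  by_cases h : j < x.length
  · rw [min_eq_left h.le]
    rcases e : x[j] with _ | _ <;>
    simp [Transducer.inputCell, h, isTrue, bitAt, e]
  · simp [Transducer.inputCell, min_eq_right (not_lt.1 h), isTrue, bitAt,
      List.getElem?_eq_none (not_lt.1 h)]

/-- The calling convention: variables live below `b`, all registers from `b` on are zero scratch
space, and the input head is at home. Afterwards only register `b` has changed, so the convention
holds again from `b + 1` on. -/
theorem exec_compile {x : List Bool} {B : ℕ} (hB : 1 ≤ B) : ∀ {n : ℕ} (e : Code n)
    (loc : Fin n → ℕ) (b : ℕ) (σ : ℕ → ℕ) (o : List (Option Bool)), (∀ i, loc i < b) →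
    (∀ i, b ≤ i → σ i = 0) → e.Bdd x B (σ ∘ loc) →
    Exec x B (e.compile loc b) ⟨σ, 0, o⟩ ⟨Function.update σ b (e.eval x (σ ∘ loc)), 0, o⟩
  | _, .zero, loc, b, σ, o, _, hz, _ => by
    have : Function.update σ b 0 = σ := by rw [← hz b le_rfl, Function.update_eq_self]
    simp only [eval, this]
    exact Exec.skip _
  | _, .succ e, loc, b, σ, o, hl, hz, h => by
    refine Exec.seq _ _ _ _ _ (exec_compile hB e loc b σ o hl hz h.1) (Exec.inc_of ?_ ?_)
    · simpa using h.2
    · simp [eval]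
  | _, .var i, loc, b, σ, o, hl, hz, h => by
    have := hl i
    exact Exec.copy (by omega) (by omega) (by omega) (hz _ le_rfl) (hz _ (by omega)) h rfl
  | _, .len, loc, b, σ, o, hl, hz, h => by
    have h' : x.length ≤ B := h
    have hz0 := hz b le_rfl
    have hz1 := hz (b + 1) (by omega)
    refine Exec.seq _ _ _ ⟨σ, 1, o⟩ _ (by simpa using Exec.right (x := x) (B := B) ⟨σ, 0, o⟩) ?_
    refine Exec.seq _ _ _ _ _ (exec_ifCell_inc hB (hz (b + 1) (by omega)) rfl) ?_
    refine Exec.seq _ _ _ ⟨Function.update σ b x.length, x.length + 1, o⟩ _ ?_ (Exec.home _)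
    -- After `j` passes the head is on cell `j + 1`, and register `b + 1` is a flag telling whether
    -- that cell still holds an input symbol.
    set f : ℕ → ProgState := fun j => ⟨Function.update (Function.update σ b j) (b + 1)
      (if j < x.length then 1 else 0), j + 1, o⟩ with hf
    have := Exec.loop_of (x := x) (B := B) (r := b + 1)
      (p := .seq (.inc b) (.seq .right (.ifCell notEnd (.inc (b + 1))))) f x.length
      (fun j hj => ⟨by simp [hf, hj], by
        refine Exec.seq _ _ _ ⟨Function.update σ b (j + 1), j + 1, o⟩ _ (Exec.inc_of ?_ ?_)
          (Exec.seq _ _ _ ⟨Function.update σ b (j + 1), j + 2, o⟩ _ ?_ ?_)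
        · simp [hf]; omega
        · funext i
          simp only [hf, Function.update_apply]
          split_ifs <;> first | omega | rfl | simp_all
        · have := Exec.right (x := x) (B := B) ⟨Function.update σ b (j + 1), j + 1, o⟩
          rwa [min_eq_left (by simp; omega)] at this
        · refine exec_ifCell_inc hB (by simp [hz1]) ?_
          rw [notEnd_inputCell]
          by_cases h : j + 1 < x.length <;> simp [h]⟩) (by simp [hf])
    convert this using 2
    · rw [notEnd_inputCell x 0]
      funext i
      simp only [Function.update_apply, decide_eq_true_eq]
      split_ifs <;> simp_all
    · funext i
      simp only [Function.update_apply]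
      split_ifs <;> first | omega | rfl | simp_all
  | _, .bit e, loc, b, σ, o, hl, hz, h => by
    refine Exec.seq _ _ _ _ _ (exec_compile hB e loc b σ o hl hz h) ?_
    set v := e.eval x (σ ∘ loc) with hv
    refine Exec.seq _ _ _ ⟨Function.update σ b v, 1, o⟩ _
      (by simpa using Exec.right (x := x) (B := B) ⟨Function.update σ b v, 0, o⟩) ?_
    -- The head is stopped by the right end marker, which does not count as `true`; this agrees with
    -- the value 0 of `bitAt` beyond the end of the input.
    have := Exec.loop_of (x := x) (B := B) (r := b) (p := .right)
      (fun j => ⟨Function.update σ b (v - j), min j x.length + 1, o⟩) v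
      (fun j hj => ⟨by simp; omega, by
        have := Exec.right (x := x) (B := B)
          ⟨Function.update σ b (v - (j + 1)), min j x.length + 1, o⟩
        rw [show min (min j x.length + 1 + 1) (x.length + 1) = min (j + 1) x.length + 1 by
          omega] at this
        simpa [Nat.sub_sub] using this⟩) (by simp)
    simp only [Nat.sub_zero, Nat.zero_min, zero_add, Nat.sub_self] at this
    refine Exec.seq _ _ _ _ _ this ?_
    refine Exec.seq _ _ _ _ _ (exec_ifCell_inc (v := bitAt x v) hB (by simp) ?_) ?_
    · exact (isTrue_inputCell x v).symm
    · simp only [Function.update_idem]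
      exact Exec.home _
  | _, .iter e₀ e₁ e₂, loc, b, σ, o, hl, hz, h => by
    obtain ⟨h0, h1, h2⟩ := h
    refine Exec.seq _ _ _ _ _ (exec_compile hB e₁ loc b σ o hl hz h1) ?_
    have hloc : ∀ v, (Function.update σ b v) ∘ loc = σ ∘ loc := fun v => by
      funext i
      simp [Function.update_of_ne (hl i).ne]
    have hE0 := exec_compile hB e₀ loc (b + 1) (Function.update σ b (e₁.eval x (σ ∘ loc))) o
      (fun i => (hl i).trans (Nat.lt_succ_self b))
      (fun i hi => by rw [Function.update_of_ne (by omega)]; exact hz i (by omega))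
      (by rw [hloc]; exact h0)
    rw [hloc] at hE0
    refine Exec.seq _ _ _ _ _ hE0 ?_
    set N := e₀.eval x (σ ∘ loc) with hN
    set acc : ℕ → ℕ := fun j => Nat.rec (e₁.eval x (σ ∘ loc))
      (fun j a => e₂.eval x (Fin.cons a (Fin.cons j (σ ∘ loc)))) j with hacc
    have hacc' : ∀ j, acc (j + 1) = e₂.eval x (Fin.cons (acc j) (Fin.cons j (σ ∘ loc))) :=
      fun j => rfl
    have hNB : N ≤ B := h0.eval_le hB
    have haccB : ∀ j ≤ N, acc j ≤ B := by
      intro j hj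
      rcases j with _ | j
      · exact h1.eval_le hB
      · rw [hacc']; exact (h2 j hj).eval_le hB
    -- Register layout: the accumulator in `b`, the remaining passes in `b + 1`, the index in `b +
    -- 2`; the new value is computed in `b + 3` and then moved to `b`.
    set f : ℕ → ProgState := fun j => ⟨Function.update (Function.update (Function.update σ b
      (acc j)) (b + 1) (N - j)) (b + 2) j, 0, o⟩ with hf
    have hz2 := hz (b + 2) (by omega)
    have hz3 := hz (b + 3) (by omega)
    have hloop := Exec.loop_of (x := x) (B := B) (r := b + 1)
      (p := .seq (e₂.compile (Fin.cons b (Fin.cons (b + 2) loc)) (b + 3))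
        (.seq (.zero b) (.seq (.move (b + 3) b) (.inc (b + 2))))) f N
      (fun j hj => ⟨by simp [hf]; omega, by
        set τ : ℕ → ℕ → ℕ := fun a => Function.update (Function.update (Function.update σ b a)
          (b + 1) (N - (j + 1))) (b + 2) j with hτ
        have e : ({ f j with reg := Function.update (f j).reg (b + 1) ((f j).reg (b + 1) - 1) } :
            ProgState) = ⟨τ (acc j), 0, o⟩ := by
          simp only [hf, hτ, ProgState.mk.injEq, and_true]
          funext i
          simp only [Function.update_apply]
          split_ifs <;> omega
        rw [e]
        have hρ : (τ (acc j)) ∘ (Fin.cons b (Fin.cons (b + 2) loc : Fin _ → ℕ) : Fin _ → ℕ) =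
            Fin.cons (acc j) (Fin.cons j (σ ∘ loc)) := by
          funext i
          refine Fin.cases ?_ (fun i => Fin.cases ?_ (fun i => ?_) i) i
          · simp [hτ]
          · simp [hτ]
          · have := hl i
            simp only [hτ, Function.comp_apply, Fin.cons_succ]
            rw [Function.update_of_ne (by omega), Function.update_of_ne (by omega),
              Function.update_of_ne (by omega)]
        have h2' := exec_compile hB e₂ (Fin.cons b (Fin.cons (b + 2) loc)) (b + 3)
          (τ (acc j)) o (by
            intro i
            refine Fin.cases ?_ (fun i => Fin.cases ?_ (fun i => ?_) i) i
            · simp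
            · simp
            · have := hl i
              simp; omega)
          (by
            intro i hi
            simp only [hτ]
            rw [Function.update_of_ne (by omega), Function.update_of_ne (by omega),
              Function.update_of_ne (by omega)]
            exact hz i (by omega)) (by rw [hρ]; exact h2 j hj)
        rw [hρ, ← hacc'] at h2'
        refine Exec.seq _ _ _ _ _ h2' ?_
        refine Exec.seq _ _ _ _ _ (Exec.zero (σ' := Function.update (τ 0) (b + 3) (acc (j + 1)))
          ?_) ?_
        · funext i
          simp only [hτ, Function.update_apply]
          split_ifs <;> omega
        · refine Exec.seq _ _ _ _ _ (Exec.move (σ' := τ (acc (j + 1))) (by omega) ?_ ?_)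
            (Exec.inc_of ?_ ?_)
          · have := haccB (j + 1) hj
            simp [hτ, this]
          · funext i
            simp only [hτ, Function.update_apply]
            split_ifs <;> first | omega | rfl | simp_all
          · simp [hτ]; omega
          · funext i
            simp only [hτ, Function.update_apply]
            split_ifs <;> omega⟩) (by simp [hf])
    refine Exec.seq _ _ _ (f N) _ ?_ (Exec.zero ?_)
    · convert hloop using 2
      funext i
      simp only [Function.update_apply]
      split_ifs <;> first | omega | rfl | simp_all
    · funext i
      simp only [Function.update_apply]
      split_ifs <;> first | omega | rfl | simp_all

end Code

/-! ### Expressions for outputs -/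

/-- Expressions for strings of output symbols. -/
inductive OutCode : ℕ → Type
  | nil {n : ℕ} : OutCode n
  | emit {n : ℕ} (o : Option Bool) : OutCode n
  | append {n : ℕ} (F G : OutCode n) : OutCode n
  | loop {n : ℕ} (e : Code n) (F : OutCode (n + 1)) : OutCode n

namespace OutCode

/-- The value of an expression. -/
def eval (x : List Bool) : {n : ℕ} → OutCode n → (Fin n → ℕ) → List (Option Bool)
  | _, .nil, _ => []
  | _, .emit o, _ => [o]
  | _, .append F G, ρ => F.eval x ρ ++ G.eval x ρ
  | _, .loop e F, ρ => (List.range (e.eval x ρ)).flatMap fun i => F.eval x (Fin.cons i ρ)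

/-- All numbers that occur in the evaluation are at most `B`. -/
def Bdd (x : List Bool) (B : ℕ) : {n : ℕ} → OutCode n → (Fin n → ℕ) → Prop
  | _, .nil, _ => True
  | _, .emit _, _ => True
  | _, .append F G, ρ => F.Bdd x B ρ ∧ G.Bdd x B ρ
  | _, .loop e F, ρ => e.Bdd x B ρ ∧ ∀ i < e.eval x ρ, F.Bdd x B (Fin.cons i ρ)

theorem Bdd.mono {x : List Bool} {B B' : ℕ} (hB : B ≤ B') : ∀ {n : ℕ} {F : OutCode n}
    {ρ : Fin n → ℕ}, F.Bdd x B ρ → F.Bdd x B' ρ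
  | _, .nil, _, _ => trivial
  | _, .emit _, _, _ => trivial
  | _, .append _ _, _, h => ⟨Bdd.mono hB h.1, Bdd.mono hB h.2⟩
  | _, .loop _ _, _, h => ⟨h.1.mono hB, fun j hj => Bdd.mono hB (h.2 j hj)⟩

/-- The program that writes the output, with variables at `loc` and free registers from `b`. -/
def compile : {n : ℕ} → OutCode n → (Fin n → ℕ) → ℕ → Prog
  | _, .nil, _, _ => .skip
  | _, .emit o, _, _ => .out o
  | _, .append F G, loc, b => .seq (F.compile loc b) (G.compile loc b)
  | _, .loop e F, loc, b => .seq (e.compile loc b) (.seq (.loop b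
      (.seq (F.compile (Fin.cons (b + 1) loc) (b + 2)) (.inc (b + 1)))) (.zero (b + 1)))

/-- Same convention as for `Code`, except that all registers are restored; hence consecutive outputs
can reuse the same scratch registers. -/
theorem exec_compile {x : List Bool} {B : ℕ} (hB : 1 ≤ B) : ∀ {n : ℕ} (F : OutCode n)
    (loc : Fin n → ℕ) (b : ℕ) (σ : ℕ → ℕ) (o : List (Option Bool)), (∀ i, loc i < b) →
    (∀ i, b ≤ i → σ i = 0) → F.Bdd x B (σ ∘ loc) →
    Exec x B (F.compile loc b) ⟨σ, 0, o⟩ ⟨σ, 0, o ++ F.eval x (σ ∘ loc)⟩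
  | _, .nil, loc, b, σ, o, _, _, _ => by
    simp only [eval, List.append_nil]
    exact Exec.skip _
  | _, .emit a, loc, b, σ, o, _, _, _ => Exec.out _ _
  | _, .append F G, loc, b, σ, o, hl, hz, h => by
    refine Exec.seq _ _ _ _ _ (exec_compile hB F loc b σ o hl hz h.1) ?_
    simp only [eval, ← List.append_assoc]
    exact exec_compile hB G loc b σ _ hl hz h.2
  | _, .loop e F, loc, b, σ, o, hl, hz, h => by
    obtain ⟨h1, h2⟩ := h
    refine Exec.seq _ _ _ _ _ (Code.exec_compile hB e loc b σ o hl hz h1) ?_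
    set N := e.eval x (σ ∘ loc) with hN
    have hNB : N ≤ B := h1.eval_le hB
    have hz1 := hz b le_rfl
    have hz2 := hz (b + 1) (by omega)
    set f : ℕ → ProgState := fun j => ⟨Function.update (Function.update σ b (N - j)) (b + 1) j, 0,
      o ++ (List.range j).flatMap fun i => F.eval x (Fin.cons i (σ ∘ loc))⟩ with hf
    have hloop := Exec.loop_of (x := x) (B := B) (r := b)
      (p := .seq (F.compile (Fin.cons (b + 1) loc) (b + 2)) (.inc (b + 1))) f N
      (fun j hj => ⟨by simp [hf]; omega, by
        set τ : ℕ → ℕ := Function.update (Function.update σ b (N - (j + 1))) (b + 1) j with hτ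
        have e : ({ f j with reg := Function.update (f j).reg b ((f j).reg b - 1) } :
            ProgState) = ⟨τ, 0, (f j).out⟩ := by
          simp only [hf, hτ, ProgState.mk.injEq, and_true]
          funext i
          simp only [Function.update_apply]
          split_ifs <;> omega
        rw [e]
        have hρ : τ ∘ (Fin.cons (b + 1) loc : Fin _ → ℕ) = Fin.cons j (σ ∘ loc) := by
          funext i
          refine Fin.cases ?_ (fun i => ?_) i
          · simp [hτ]
          · have := hl i
            simp only [hτ, Function.comp_apply, Fin.cons_succ]
            rw [Function.update_of_ne (by omega), Function.update_of_ne (by omega)]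
        have h2' := exec_compile hB F (Fin.cons (b + 1) loc) (b + 2) τ (f j).out (by
            intro i
            refine Fin.cases ?_ (fun i => ?_) i
            · simp
            · have := hl i
              simp; omega)
          (by
            intro i hi
            simp only [hτ]
            rw [Function.update_of_ne (by omega), Function.update_of_ne (by omega)]
            exact hz i (by omega)) (by rw [hρ]; exact h2 j hj)
        rw [hρ] at h2'
        refine Exec.seq _ _ _ _ _ h2' ?_
        have e' : (f (j + 1)).out = (f j).out ++ F.eval x (Fin.cons j (σ ∘ loc)) := by
          simp [hf, List.range_succ]
        rw [← e']
        refine Exec.inc_of ?_ ?_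
        · simp [hτ]; omega
        · funext i
          simp only [hτ, Function.update_apply]
          split_ifs <;> omega⟩) (by simp [hf])
    refine Exec.seq _ _ _ (f N) _ ?_ (Exec.zero ?_)
    · convert hloop using 2
      · funext i
        simp only [Function.update_apply]
        split_ifs <;> first | omega | rfl | simp_all
      · simp
    · funext i
      simp only [Function.update_apply]
      split_ifs <;> first | omega | rfl | simp_all

end OutCode

/-! ### The calculus of functions whose evaluation needs only quasi-polynomially bounded numbers. -/

/-! ### Quasi-polynomial bounds -/

/-- A family of quasi-polynomial bounds. -/
def qp (c m : ℕ) : ℕ := 2 ^ (c * (Nat.log 2 m + 1) ^ c)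

theorem one_le_qp (c m : ℕ) : 1 ≤ qp c m := Nat.one_le_two_pow

theorem qp_mono {c c' m m' : ℕ} (hc : c ≤ c') (hm : m ≤ m') : qp c m ≤ qp c' m' := by
  refine Nat.pow_le_pow_right (by norm_num) (Nat.mul_le_mul hc ?_)
  exact (Nat.pow_le_pow_left (Nat.succ_le_succ (Nat.log_mono_right hm)) c).trans
    (Nat.pow_le_pow_right (by omega) hc)

theorem le_qp_one (m : ℕ) : m ≤ qp 1 m := by
  have := Nat.lt_pow_succ_log_self (b := 2) (by norm_num) m
  simpa [qp] using this.le

theorem mul_pow_le {c d L : ℕ} (hL : 1 ≤ L) (h : c ≤ d) : c * L ^ c ≤ c * L ^ d :=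
  Nat.mul_le_mul_left c (Nat.pow_le_pow_right hL h)

theorem qp_mul_qp_le (c c' m : ℕ) : qp c m * qp c' m ≤ qp (c + c') m := by
  rw [qp, qp, ← pow_add]
  refine Nat.pow_le_pow_right (by norm_num) ?_
  rw [add_mul]
  exact add_le_add (mul_pow_le (by omega) (by omega)) (mul_pow_le (by omega) (by omega))

theorem log_qp (c m : ℕ) : Nat.log 2 (qp c m) = c * (Nat.log 2 m + 1) ^ c :=
  Nat.log_pow (by norm_num) _

/-- The logarithm of a quasi-polynomial is a polylogarithm, and a polynomial in a polylogarithm is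
again one. This closure under composition is what lets the calculus nest arbitrarily. -/
theorem qp_qp_le (c c' m : ℕ) : qp c' (qp c m) ≤ qp (c' * (c + 1) ^ c' + c * c') m := by
  rw [qp, log_qp, qp]
  refine Nat.pow_le_pow_right (by norm_num) ?_
  set L := Nat.log 2 m + 1
  have hL : 1 ≤ L := by omega
  calc c' * (c * L ^ c + 1) ^ c' ≤ c' * ((c + 1) * L ^ c) ^ c' := by
        refine Nat.mul_le_mul_left _ (Nat.pow_le_pow_left ?_ _)
        have := Nat.one_le_pow c L hL
        rw [add_mul]; omega
    _ = (c' * (c + 1) ^ c') * L ^ (c * c') := by rw [mul_pow, ← pow_mul, mul_assoc]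
    _ ≤ _ := Nat.mul_le_mul (by omega) (Nat.pow_le_pow_right hL (by omega))

/-- Contexts: an input and finitely many numbers. -/
class Ctx (α : Type) where
  /-- the number of variables -/
  n : ℕ
  /-- the input -/
  input : α → List Bool
  /-- the variables -/
  env : α → Fin n → ℕ

instance : Ctx (List Bool) := ⟨0, id, fun _ => Fin.elim0⟩

instance {α : Type} [Ctx α] : Ctx (α × ℕ) :=
  ⟨Ctx.n α + 1, fun v => Ctx.input v.1, fun v => Fin.cons v.2 (Ctx.env v.1)⟩

namespace Ctx

variable {α : Type} [Ctx α]

/-- The size of a context. -/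
def sz (v : α) : ℕ := (input v).length + ∑ i, env v i

theorem sz_prod (v : α × ℕ) : sz v = sz v.1 + v.2 := by
  have : ∑ i, env v i = v.2 + ∑ i, env v.1 i :=
    (Fin.sum_univ_succ (n := Ctx.n α) (env v)).trans (by simp [env])
  simp only [sz, this, input]
  omega

theorem env_le_sz (v : α) (i : Fin (n α)) : env v i ≤ sz v :=
  (Finset.single_le_sum (f := env v) (fun _ _ => Nat.zero_le _) (Finset.mem_univ i)).trans
    (Nat.le_add_left _ _)

end Ctx

open Ctx

section Computable

variable {α : Type} [Ctx α]

/-- `f` is bounded by a quasi-polynomial. -/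
def QB (f : α → ℕ) : Prop := ∃ c, ∀ v, f v ≤ qp c (sz v)

/-- `f` is bounded by a polylogarithm. -/
def LB (f : α → ℕ) : Prop := ∃ c, ∀ v, f v ≤ c * (Nat.log 2 (sz v) + 1) ^ c

theorem QB.mono {f g : α → ℕ} (hg : QB g) (h : ∀ v, f v ≤ g v) : QB f :=
  hg.imp fun _ hc v => (h v).trans (hc v)

theorem QB.sz : QB (Ctx.sz : α → ℕ) := ⟨1, fun _ => le_qp_one _⟩

theorem QB.mul {f g : α → ℕ} : QB f → QB g → QB fun v => f v * g v := by
  rintro ⟨c, hc⟩ ⟨d, hd⟩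
  exact ⟨c + d, fun v => (Nat.mul_le_mul (hc v) (hd v)).trans (qp_mul_qp_le _ _ _)⟩

theorem QB.const (k : ℕ) : QB fun _ : α => k :=
  ⟨k, fun _ => (Nat.lt_two_pow_self.le).trans (Nat.pow_le_pow_right (by norm_num)
    (Nat.le_mul_of_pos_right _ (Nat.pow_pos (by omega))))⟩

theorem QB.add {f g : α → ℕ} (hf : QB f) (hg : QB g) : QB fun v => f v + g v := by
  obtain ⟨c, hc⟩ := hf
  obtain ⟨d, hd⟩ := hg
  have h : QB fun v : α => 2 * (qp c (Ctx.sz v) * qp d (Ctx.sz v)) :=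
    (QB.const 2).mul (QB.mul ⟨c, fun _ => le_rfl⟩ ⟨d, fun _ => le_rfl⟩)
  refine h.mono fun v => (add_le_add (hc v) (hd v)).trans ?_
  have h1 := Nat.mul_le_mul_left (qp c (Ctx.sz v)) (one_le_qp d (Ctx.sz v))
  have h2 := Nat.mul_le_mul_right (qp d (Ctx.sz v)) (one_le_qp c (Ctx.sz v))
  omega

theorem QB.qp {f : α → ℕ} (c : ℕ) : QB f → QB fun v => qp c (f v) := by
  rintro ⟨d, hd⟩
  exact ⟨_, fun v => (qp_mono le_rfl (hd v)).trans (qp_qp_le d c _)⟩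

/-- Gives a bound that is uniform over the whole range of a loop index, as sums require. -/
theorem QB.subst {f : α → ℕ} {g : α × ℕ → ℕ} (hg : QB g) (hf : QB f) :
    ∃ b : α → ℕ, QB b ∧ ∀ v, ∀ i ≤ f v, g (v, i) ≤ b v := by
  obtain ⟨c, hc⟩ := hg
  refine ⟨_, (QB.sz.add hf).qp c, fun v i hi => (hc (v, i)).trans (qp_mono le_rfl ?_)⟩
  rw [sz_prod]
  exact Nat.add_le_add_left hi _

theorem QB.weaken {f : α → ℕ} : QB f → QB fun v : α × ℕ => f v.1 := by
  rintro ⟨c, hc⟩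
  exact ⟨c, fun v => (hc v.1).trans (qp_mono le_rfl (by rw [sz_prod]; omega))⟩

theorem LB.const (k : ℕ) : LB fun _ : α => k :=
  ⟨k, fun _ => Nat.le_mul_of_pos_right _ (Nat.pow_pos (by omega))⟩

theorem LB.add {f g : α → ℕ} : LB f → LB g → LB fun v => f v + g v := by
  rintro ⟨c, hc⟩ ⟨d, hd⟩
  refine ⟨c + d, fun v => (add_le_add (hc v) (hd v)).trans ?_⟩
  rw [add_mul]
  exact add_le_add (mul_pow_le (by omega) (by omega)) (mul_pow_le (by omega) (by omega))

theorem LB.mul {f g : α → ℕ} : LB f → LB g → LB fun v => f v * g v := by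
  rintro ⟨c, hc⟩ ⟨d, hd⟩
  refine ⟨c * d + (c + d), fun v => (Nat.mul_le_mul (hc v) (hd v)).trans ?_⟩
  rw [mul_mul_mul_comm, ← pow_add]
  exact Nat.mul_le_mul (by omega) (Nat.pow_le_pow_right (by omega) (by omega))

theorem LB.log {f : α → ℕ} : QB f → LB fun v => Nat.log 2 (f v) := by
  rintro ⟨c, hc⟩
  exact ⟨c, fun v => (Nat.log_mono_right (hc v)).trans (log_qp _ _).le⟩

theorem LB.weaken {f : α → ℕ} : LB f → LB fun v : α × ℕ => f v.1 := by
  rintro ⟨c, hc⟩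
  refine ⟨c, fun v => (hc v.1).trans (Nat.mul_le_mul_left _ (Nat.pow_le_pow_left
    (Nat.succ_le_succ (Nat.log_mono_right ?_)) _))⟩
  rw [sz_prod]; omega

/-- The exponent multiplies the logarithm, so it has to be polylogarithmic. Later it is the
ambiguity bound `K`. -/
theorem QB.pow {f g : α → ℕ} : QB f → LB g → QB fun v => f v ^ g v := by
  rintro ⟨c, hc⟩ ⟨d, hd⟩
  refine ⟨c * d + (c + d), fun v => (Nat.pow_le_pow_left (hc v) _).trans ?_⟩
  refine (Nat.pow_le_pow_right (one_le_qp _ _) (hd v)).trans ?_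
  simp only [_root_.qp]
  rw [← pow_mul, mul_mul_mul_comm, ← pow_add]
  refine Nat.pow_le_pow_right (by norm_num) ?_
  exact Nat.mul_le_mul (by omega) (Nat.pow_le_pow_right (by omega) (by omega))

/-! ### Functions computable with quasi-polynomially bounded numbers -/

/-- `f` is the value of an expression whose evaluation needs only numbers that are bounded by a
quasi-polynomial. -/
def PL (f : α → ℕ) : Prop :=
  ∃ (e : Code (Ctx.n α)) (c : ℕ), ∀ v, e.eval (input v) (env v) = f v ∧
    e.Bdd (input v) (qp c (sz v)) (env v)

theorem PL.of_QB {f b : α → ℕ} (e : Code (Ctx.n α)) (hb : QB b)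
    (h : ∀ v, e.eval (input v) (env v) = f v ∧ e.Bdd (input v) (b v) (env v)) : PL f := by
  obtain ⟨c, hc⟩ := hb
  exact ⟨e, c, fun v => ⟨(h v).1, (h v).2.mono (hc v)⟩⟩

theorem PL.congr {f g : α → ℕ} (hf : PL f) (h : ∀ v, g v = f v) : PL g := by
  rwa [show g = f from funext h]

theorem PL.qb {f : α → ℕ} : PL f → QB f := by
  rintro ⟨e, c, h⟩
  exact ⟨c, fun v => (h v).1 ▸ (h v).2.eval_le (one_le_qp _ _)⟩

theorem PL.zero : PL fun _ : α => 0 := .of_QB .zero (QB.const 0) fun _ => ⟨rfl, trivial⟩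

theorem PL.succ {f : α → ℕ} (hf : PL f) : PL fun v => f v + 1 := by
  have hq := hf.qb
  obtain ⟨e, c, h⟩ := hf
  refine .of_QB (.succ e) ((QB.sz.qp c).add (hq.add (QB.const 1))) fun v =>
    ⟨by simp [Code.eval, h], (h v).2.mono (by omega), ?_⟩
  rw [(h v).1]; omega

theorem PL.const : ∀ k : ℕ, PL fun _ : α => k
  | 0 => .zero
  | k + 1 => (PL.const k).succ

theorem PL.length : PL fun v : α => (input v).length :=
  .of_QB .len QB.sz fun _ => ⟨rfl, Nat.le_add_right _ _⟩

theorem PL.bitAt {f : α → ℕ} (hf : PL f) : PL fun v => bitAt (input v) (f v) := by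
  obtain ⟨e, c, h⟩ := hf
  exact ⟨.bit e, c, fun v => ⟨by simp [Code.eval, h], (h v).2⟩⟩

theorem PL.rename {β : Type} [Ctx β] {f : α → ℕ} (hf : PL f) (φ : β → α)
    (ξ : Fin (Ctx.n α) → Fin (Ctx.n β)) (h : ∀ v, env (φ v) = env v ∘ ξ)
    (hi : ∀ v, input (φ v) = input v) (hs : ∀ v, sz (φ v) ≤ sz v) : PL fun v => f (φ v) := by
  obtain ⟨e, c, he⟩ := hf
  refine ⟨e.rename ξ, c, fun v => ⟨?_, ?_⟩⟩
  · rw [Code.eval_rename, ← h, ← hi, (he _).1]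
  · rw [Code.bdd_rename, ← h, ← hi]
    exact (he _).2.mono (qp_mono le_rfl (hs v))

theorem PL.weaken {f : α → ℕ} (hf : PL f) : PL fun v : α × ℕ => f v.1 :=
  hf.rename _ Fin.succ (fun v => by funext i; simp [env]) (fun _ => rfl)
    fun v => by rw [sz_prod]; omega

theorem PL.var : PL fun v : α × ℕ => v.2 :=
  .of_QB (.var (0 : Fin (Ctx.n α + 1))) QB.sz fun v => ⟨by simp [Code.eval, env],
    env_le_sz v (0 : Fin (Ctx.n α + 1))⟩

/-- The workhorse of the calculus. Recursion is unrestricted in form; the quasi-polynomial bound `b`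
on the values `F v j` with `j < f v`, proved separately each time, is what keeps the space small. -/
theorem PL.iter {f g b : α → ℕ} {h : (α × ℕ) × ℕ → ℕ} (hf : PL f) (hg : PL g) (hh : PL h)
    (hb : QB b) {F : α → ℕ → ℕ} (h0 : ∀ v, F v 0 = g v)
    (hs : ∀ v j, j < f v → F v (j + 1) = h ((v, j), F v j)) (hF : ∀ v, ∀ j < f v, F v j ≤ b v) :
    PL fun v => F v (f v) := by
  have hqf := hf.qb
  obtain ⟨e₀, c₀, he₀⟩ := hf
  obtain ⟨e₁, c₁, he₁⟩ := hg
  obtain ⟨e₂, c₂, he₂⟩ := hh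
  have key : ∀ v, ∀ j ≤ f v, (Nat.rec (e₁.eval (input v) (env v))
      (fun j a => e₂.eval (input v) (Fin.cons a (Fin.cons j (env v)))) j : ℕ) = F v j := by
    intro v j
    induction j with
    | zero => intro _; exact (he₁ v).1.trans (h0 v).symm
    | succ j ih =>
      intro hj
      rw [hs v j hj, ← (he₂ ((v, j), F v j)).1, ← ih (by omega)]
      rfl
  refine .of_QB (b := fun v => qp c₀ (sz v) + qp c₁ (sz v) + qp c₂ (sz v + f v + b v))
    (.iter e₀ e₁ e₂)
    (((QB.sz.qp c₀).add (QB.sz.qp c₁)).add (((QB.sz.add hqf).add hb).qp c₂))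
    fun v => ⟨?_, (he₀ v).2.mono (by omega), (he₁ v).2.mono (by omega), fun j hj => ?_⟩
  · simp only [Code.eval]
    rw [(he₀ v).1, key v _ le_rfl]
  · rw [(he₀ v).1] at hj
    rw [key v j hj.le]
    refine ((he₂ ((v, j), F v j)).2.mono ?_)
    refine (qp_mono le_rfl ?_).trans (Nat.le_add_left _ _)
    rw [sz_prod, sz_prod]
    have := hF v j hj
    simp only
    omega

/-- Substitution without a substitution operation on expressions: a loop runs exactly once, its
accumulator starts at `f v`, and its body applies `g` while ignoring the loop index. -/
theorem PL.bind {f : α → ℕ} {g : α × ℕ → ℕ} (hf : PL f) (hg : PL g) :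
    PL fun v => g (v, f v) := by
  have hg' : PL fun v : (α × ℕ) × ℕ => g (v.1.1, v.2) :=
    hg.rename (fun v : (α × ℕ) × ℕ => (v.1.1, v.2))
      (Fin.cons 0 fun i => i.succ.succ : Fin (Ctx.n α + 1) → Fin (Ctx.n α + 2))
      (fun v => by
        funext i
        exact Fin.cases (by simp [env]) (fun i => by simp [env]) i) (fun _ => rfl)
      fun v => by rw [sz_prod, sz_prod, sz_prod]; simp only; omega
  exact PL.iter (F := fun v j => Nat.rec (f v) (fun _ a => g (v, a)) j) (PL.const 1) hf hg' hf.qb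
    (fun _ => rfl) (fun v j hj => rfl) fun v j hj => by
      rw [Nat.lt_one_iff.1 hj]
      exact le_rfl

theorem PL.add {f g : α → ℕ} (hf : PL f) (hg : PL g) : PL fun v => f v + g v :=
  PL.iter (F := fun v j => f v + j) hg hf PL.var.succ (hf.qb.add hg.qb)
    (fun _ => rfl) (fun _ _ _ => rfl) fun _ _ h => by omega

theorem PL.mul {f g : α → ℕ} (hf : PL f) (hg : PL g) : PL fun v => f v * g v :=
  PL.iter (F := fun v j => f v * j) hg PL.zero (PL.var.add hf.weaken.weaken)
    (hf.qb.mul hg.qb) (fun _ => rfl) (fun _ _ _ => rfl) fun _ _ h => Nat.mul_le_mul_left _ h.le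

theorem PL.pred {f : α → ℕ} (hf : PL f) : PL fun v => f v - 1 :=
  PL.iter (F := fun v j => j - 1) hf PL.zero PL.var.weaken hf.qb
    (fun _ => rfl) (fun _ _ _ => rfl) fun _ _ h => by omega

theorem PL.sub {f g : α → ℕ} (hf : PL f) (hg : PL g) : PL fun v => f v - g v :=
  PL.iter (F := fun v j => f v - j) hg hf PL.var.pred hf.qb
    (fun _ => rfl) (fun _ _ _ => rfl) fun _ _ h => by omega

/-- A loop of length `c v` starts with `g v` and overwrites it by `f v` in every pass. -/
theorem PL.cond {c f g : α → ℕ} (hc : PL c) (hf : PL f) (hg : PL g) :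
    PL fun v => if c v = 0 then g v else f v := by
  refine (PL.iter (F := fun v j => if j = 0 then g v else f v) hc hg hf.weaken.weaken
    (hf.qb.add hg.qb) (fun _ => rfl) (fun _ _ _ => by simp) fun v j h => ?_)
  split_ifs <;> omega

/-- Counting and the bounded quantifiers rest on this. Partial sums stay below the number of
summands times a uniform bound on them. -/
theorem PL.sum {f : α → ℕ} {g : α → ℕ → ℕ} (hf : PL f) (hg : PL fun v : α × ℕ => g v.1 v.2) :
    PL fun v => ∑ j ∈ Finset.range (f v), g v j := by
  obtain ⟨b, hb, hgb⟩ := hg.qb.subst hf.qb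
  refine PL.iter (F := fun v j => ∑ j ∈ Finset.range j, g v j) hf PL.zero
    (PL.var.add hg.weaken) (hf.qb.mul hb) (fun _ => rfl)
    (fun v j _ => Finset.sum_range_succ _ _) fun v j hj => ?_
  refine (Finset.sum_le_card_nsmul _ _ (b v) fun i hi => hgb v i ?_).trans ?_
  · have := Finset.mem_range.1 hi; omega
  · simp only [Finset.card_range, smul_eq_mul]
    exact Nat.mul_le_mul_right _ hj.le

/-! #### Predicates -/

open Classical in
/-- Decidability with quasi-polynomially bounded numbers. -/
def PLP (P : α → Prop) : Prop := PL fun v => if P v then 1 else 0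

theorem PLP.congr {P R : α → Prop} (hP : PLP P) (h : ∀ v, R v ↔ P v) : PLP R := by
  rwa [show R = P from funext fun v => propext (h v)]

theorem PLP.ite {P : α → Prop} [DecidablePred P] {f g : α → ℕ} (hP : PLP P) (hf : PL f)
    (hg : PL g) : PL fun v => if P v then f v else g v := by
  refine (PL.cond hP hf hg).congr fun v => ?_
  by_cases h : P v <;> simp [h]

theorem PLP.indicator {P : α → Prop} [DecidablePred P] (hP : PLP P) :
    PL fun v => if P v then 1 else 0 := hP.ite (PL.const 1) PL.zero

theorem PLP.of_ite {P : α → Prop} [DecidablePred P] (h : PL fun v => if P v then 1 else 0) :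
    PLP P := h.congr fun v => by split_ifs <;> rfl

theorem PL.ne_zero {f : α → ℕ} (hf : PL f) : PLP fun v => f v ≠ 0 := by
  classical
  refine .of_ite ((PL.cond hf (PL.const 1) PL.zero).congr fun v => ?_)
  split_ifs <;> simp_all

theorem PLP.not {P : α → Prop} (hP : PLP P) : PLP fun v => ¬ P v := by
  classical
  refine .of_ite ((hP.ite PL.zero (PL.const 1)).congr fun v => ?_)
  split_ifs <;> simp_all

theorem PLP.and {P R : α → Prop} (hP : PLP P) (hR : PLP R) : PLP fun v => P v ∧ R v := by
  classical
  refine .of_ite ((hP.ite hR.indicator PL.zero).congr fun v => ?_)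
  split_ifs <;> simp_all

theorem PLP.or {P R : α → Prop} (hP : PLP P) (hR : PLP R) : PLP fun v => P v ∨ R v :=
  (hP.not.and hR.not).not.congr fun v => by tauto

theorem PLP.imp {P R : α → Prop} (hP : PLP P) (hR : PLP R) : PLP fun v => P v → R v :=
  (hP.not.or hR).congr fun v => by tauto

theorem PLP.weaken {P : α → Prop} (hP : PLP P) : PLP fun v : α × ℕ => P v.1 := PL.weaken hP

theorem PLP.exists_lt {f : α → ℕ} {P : α → ℕ → Prop} (hf : PL f)
    (hP : PLP fun v : α × ℕ => P v.1 v.2) : PLP fun v => ∃ j < f v, P v j := by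
  classical
  have := (PL.sum (g := fun v j => if P v j then 1 else 0) hf hP.indicator).ne_zero
  refine this.congr fun v => ?_
  simp

theorem PLP.forall_lt {f : α → ℕ} {P : α → ℕ → Prop} (hf : PL f)
    (hP : PLP fun v : α × ℕ => P v.1 v.2) : PLP fun v => ∀ j < f v, P v j :=
  (PLP.exists_lt (P := fun v j => ¬ P v j) hf hP.not).not.congr fun v => by push Not; rfl

theorem PL.lt {f g : α → ℕ} (hf : PL f) (hg : PL g) : PLP fun v => f v < g v :=
  (hg.sub hf).ne_zero.congr fun v => by omega

theorem PL.le {f g : α → ℕ} (hf : PL f) (hg : PL g) : PLP fun v => f v ≤ g v :=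
  (hg.lt hf).not.congr fun v => by omega

theorem PL.eq {f g : α → ℕ} (hf : PL f) (hg : PL g) : PLP fun v => f v = g v :=
  ((hf.le hg).and (hg.le hf)).congr fun v => by omega

/-! #### Arithmetic -/

/-- The quotient counts the positive multiples of `g v` up to `f v`; the condition `0 < g v` yields
the value 0 for division by zero. -/
theorem PL.div {f g : α → ℕ} (hf : PL f) (hg : PL g) : PL fun v => f v / g v := by
  classical
  have h := PL.sum (g := fun v j => if 0 < g v ∧ (j + 1) * g v ≤ f v then 1 else 0) hf
    ((PL.zero.lt hg.weaken).and ((PL.var.succ.mul hg.weaken).le hf.weaken)).indicator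
  refine h.congr fun v => ?_
  rw [← Finset.card_filter]
  rcases Nat.eq_zero_or_pos (g v) with h0 | h0
  · simp [h0]
  · have : (Finset.range (f v)).filter (fun j => 0 < g v ∧ (j + 1) * g v ≤ f v) =
        Finset.range (f v / g v) := by
      ext j
      have h1 : (j + 1) * g v ≤ f v ↔ j < f v / g v := (Nat.le_div_iff_mul_le h0).symm
      have h2 := Nat.div_le_self (f v) (g v)
      simp only [Finset.mem_filter, Finset.mem_range, h1]
      omega
    rw [this, Finset.card_range]

theorem PL.mod {f g : α → ℕ} (hf : PL f) (hg : PL g) : PL fun v => f v % g v :=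
  (hf.sub (hg.mul (hf.div hg))).congr fun v => by
    have := Nat.div_add_mod (f v) (g v); omega

/-- Used to extract digits. Repeated division never forms the power, so the exponent need not be
polylogarithmic. -/
theorem PL.div_pow {f g h : α → ℕ} (hf : PL f) (hg : PL g) (hh : PL h) :
    PL fun v => f v / g v ^ h v :=
  PL.iter (F := fun v j => f v / g v ^ j) hh hf (PL.var.div hg.weaken.weaken) hf.qb
    (fun _ => by simp) (fun v j _ => by simp only [pow_succ, Nat.div_div_eq_div_mul])
    fun _ _ _ => Nat.div_le_self _ _

theorem PL.pow {f g : α → ℕ} (hf : PL f) (hg : PL g) (hl : LB g) : PL fun v => f v ^ g v :=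
  PL.iter (F := fun v j => f v ^ j) hg (PL.const 1) (PL.var.mul hf.weaken.weaken)
    ((QB.pow hf.qb hl).add (QB.const 1)) (fun _ => by simp)
    (fun v j _ => by simp only [pow_succ]) fun v j hj => by
      -- For base 0 the value at exponent 0 is 1 and can exceed the final value; the 1 added to the
      -- bound is for this case.
      rcases Nat.eq_zero_or_pos (f v) with h | h
      · rw [h]
        exact (pow_le_one₀ le_rfl zero_le_one).trans (Nat.le_add_left _ _)
      · exact (Nat.pow_le_pow_right h hj.le).trans (Nat.le_add_right _ _)

theorem PL.log {f : α → ℕ} (hf : PL f) : PL fun v => Nat.log 2 (f v) := by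
  classical
  have h := PL.sum (g := fun v j => if f v / 2 ^ (j + 1) ≠ 0 then 1 else 0) hf
    (hf.weaken.div_pow (PL.const 2) PL.var.succ).ne_zero.indicator
  refine h.congr fun v => ?_
  rw [← Finset.card_filter]
  have : (Finset.range (f v)).filter (fun j => f v / 2 ^ (j + 1) ≠ 0) =
      Finset.range (Nat.log 2 (f v)) := by
    ext j
    have h2 := Nat.log_le_self 2 (f v)
    simp only [Finset.mem_filter, Finset.mem_range, ne_eq, Nat.div_eq_zero_iff, not_or, not_lt]
    rcases Nat.eq_zero_or_pos (f v) with h0 | h0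
    · simp [h0]
    · rw [← Nat.le_log_iff_pow_le (by norm_num) (by omega)]
      simp
      omega
  rw [this, Finset.card_range]

theorem PL.size {f : α → ℕ} (hf : PL f) : PL fun v => Nat.size (f v) := by
  classical
  refine (PLP.ite hf.ne_zero hf.log.succ PL.zero).congr fun v => ?_
  rcases Nat.eq_zero_or_pos (f v) with h0 | h0
  · simp [h0]
  · rw [if_pos h0.ne']
    refine le_antisymm ?_ ?_
    · exact Nat.size_le.2 (Nat.lt_pow_succ_log_self (by norm_num) _)
    · exact Nat.lt_size.2 (Nat.pow_log_le_self 2 h0.ne')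

/-! ### Computable outputs -/

namespace OutCode

/-- Rename the variables. -/
def rename : {n m : ℕ} → (Fin n → Fin m) → OutCode n → OutCode m
  | _, _, _, .nil => .nil
  | _, _, _, .emit o => .emit o
  | _, _, ξ, .append F G => .append (F.rename ξ) (G.rename ξ)
  | _, _, ξ, .loop e F => .loop (e.rename ξ) (F.rename (Fin.cons 0 fun i => (ξ i).succ))

theorem cons_comp_lift {n m : ℕ} (ξ : Fin n → Fin m) (ρ : Fin m → ℕ) (j : ℕ) :
    (Fin.cons j ρ : Fin (m + 1) → ℕ) ∘ (Fin.cons 0 fun i => (ξ i).succ : Fin (n + 1) → Fin (m + 1))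
      = Fin.cons j (ρ ∘ ξ) := by
  funext i
  exact Fin.cases (by simp) (fun i => by simp) i

theorem eval_rename (x : List Bool) : ∀ {n m : ℕ} (F : OutCode n) (ξ : Fin n → Fin m)
    (ρ : Fin m → ℕ), (F.rename ξ).eval x ρ = F.eval x (ρ ∘ ξ)
  | _, _, .nil, _, _ => rfl
  | _, _, .emit _, _, _ => rfl
  | _, _, .append F G, ξ, ρ => by simp [rename, eval, eval_rename x F, eval_rename x G]
  | _, _, .loop e F, ξ, ρ => by
    simp only [rename, eval, Code.eval_rename, eval_rename x F, cons_comp_lift]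

theorem bdd_rename (x : List Bool) (B : ℕ) : ∀ {n m : ℕ} (F : OutCode n) (ξ : Fin n → Fin m)
    (ρ : Fin m → ℕ), (F.rename ξ).Bdd x B ρ ↔ F.Bdd x B (ρ ∘ ξ)
  | _, _, .nil, _, _ => Iff.rfl
  | _, _, .emit _, _, _ => Iff.rfl
  | _, _, .append F G, ξ, ρ => by simp [rename, Bdd, bdd_rename x B F, bdd_rename x B G]
  | _, _, .loop e F, ξ, ρ => by
    simp only [rename, Bdd, Code.eval_rename, Code.bdd_rename, bdd_rename x B F, cons_comp_lift]

end OutCode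

/-- `F` is the value of an output expression with quasi-polynomially bounded numbers. -/
def OutPL (F : α → List (Option Bool)) : Prop :=
  ∃ (e : OutCode (Ctx.n α)) (c : ℕ), ∀ v, e.eval (input v) (env v) = F v ∧
    e.Bdd (input v) (qp c (sz v)) (env v)

theorem OutPL.congr {F G : α → List (Option Bool)} (hF : OutPL F) (h : ∀ v, G v = F v) :
    OutPL G := by
  rwa [show G = F from funext h]

theorem OutPL.emit (o : Option Bool) : OutPL fun _ : α => [o] :=
  ⟨.emit o, 0, fun _ => ⟨rfl, trivial⟩⟩

theorem OutPL.append {F G : α → List (Option Bool)} :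
    OutPL F → OutPL G → OutPL fun v => F v ++ G v := by
  rintro ⟨e, c, h⟩ ⟨e', c', h'⟩
  exact ⟨.append e e', c + c', fun v => ⟨by simp [OutCode.eval, h, h'],
    (h v).2.mono (qp_mono (by omega) le_rfl), (h' v).2.mono (qp_mono (by omega) le_rfl)⟩⟩

theorem OutPL.flatMap {f : α → ℕ} {F : α → ℕ → List (Option Bool)} (hf : PL f)
    (hF : OutPL fun v : α × ℕ => F v.1 v.2) :
    OutPL fun v => (List.range (f v)).flatMap (F v) := by
  have hq := hf.qb
  obtain ⟨e, c, h⟩ := hf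
  obtain ⟨e', c', h'⟩ := hF
  obtain ⟨d, hd⟩ := (QB.sz.qp c).add ((QB.sz.add hq).qp c')
  refine ⟨.loop e e', d, fun v => ⟨?_, ?_, fun i hi => ?_⟩⟩
  · simp only [OutCode.eval]
    rw [(h v).1]
    exact congrArg (fun g => (List.range (f v)).flatMap g) (funext fun i => (h' (v, i)).1)
  · exact (h v).2.mono ((Nat.le_add_right _ _).trans (hd v))
  · rw [(h v).1] at hi
    refine (h' (v, i)).2.mono (le_trans ?_ ((Nat.le_add_left _ _).trans (hd v)))
    refine qp_mono le_rfl ?_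
    rw [sz_prod]
    exact Nat.add_le_add_left hi.le _

theorem OutPL.weaken {F : α → List (Option Bool)} (hF : OutPL F) :
    OutPL fun v : α × ℕ => F v.1 := by
  obtain ⟨e, c, h⟩ := hF
  have he : ∀ v : α × ℕ, env v ∘ Fin.succ = env v.1 := fun v => by funext i; simp [env]
  refine ⟨e.rename Fin.succ, c, fun v => ⟨?_, ?_⟩⟩
  · rw [OutCode.eval_rename, he]
    exact (h v.1).1
  · rw [OutCode.bdd_rename, he]
    exact (h v.1).2.mono (qp_mono le_rfl (by rw [sz_prod]; omega))

/-- Numbers up to `qp c N` have at most `c * (log N + 1) ^ c + 1` bits, so the machine of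
`Prog.exists_transducer` runs in polylogarithmic space. The expression is evaluated on every string,
hence the machine halts on all inputs. -/
theorem OutPL.transducer {F : List Bool → List (Option Bool)} (hF : OutPL F) :
    ∃ T : Transducer Bool (Option Bool), T.IsPolylogSpace ∧ ∀ x, T.HaltsWith x (F x) := by
  obtain ⟨e, c, h⟩ := hF
  obtain ⟨T, hT⟩ := (e.compile Fin.elim0 0).exists_transducer
  have key : ∀ x : List Bool, T.HaltsWith x (F x) ∧
      T.UsesSpace x (c * (Nat.log 2 x.length + 1) ^ c + 1 + 2) := by
    intro x
    have hsz : sz x = x.length := by simp [sz, input, Ctx.n]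
    have hb := (h x).2
    rw [hsz] at hb
    have he := OutCode.exec_compile (one_le_qp c x.length) e Fin.elim0 0 (fun _ => 0) []
      (fun i => i.elim0) (fun _ _ => rfl) (by
        convert hb using 1
        funext i; exact i.elim0)
    have := hT x _ (c * (Nat.log 2 x.length + 1) ^ c + 1) _
      (Nat.pow_lt_pow_right (by norm_num) (Nat.lt_succ_self _)) he
    refine ⟨?_, this.2⟩
    convert this.1 using 1
    rw [← (h x).1]
    simp only [List.nil_append]
    congr 1
    funext i; exact i.elim0
  refine ⟨T, ⟨c * 2 ^ c + 3, c, fun x => ⟨⟨_, (key x).1⟩, fun d hd t =>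
    ((key x).2 d hd t).trans_le ?_⟩⟩, fun x => (key x).1⟩
  set l := Nat.log 2 x.length
  -- The required bound is in terms of `l` instead of `l + 1`; the summand 1 on the right covers `l
  -- = 0`.
  have h1 : (l + 1) ^ c ≤ 2 ^ c * (l ^ c + 1) := by
    rcases Nat.eq_zero_or_pos l with h0 | h0
    · rw [h0]
      simp only [zero_add, one_pow]
      exact Nat.one_le_iff_ne_zero.2 (by positivity)
    · calc (l + 1) ^ c ≤ (2 * l) ^ c := Nat.pow_le_pow_left (by omega) _
        _ = 2 ^ c * l ^ c := mul_pow _ _ _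
        _ ≤ _ := Nat.mul_le_mul_left _ (Nat.le_succ _)
  have h2 := Nat.mul_le_mul_left c h1
  nlinarith [Nat.zero_le (l ^ c)]

theorem bits_eq_map (m : ℕ) : m.bits = (List.range m.size).map m.testBit := by
  refine List.ext_getElem (by simp [Nat.size_eq_bits_len]) fun i h1 h2 => ?_
  rw [List.getElem_map, List.getElem_range, Nat.testBit_eq_inth, List.getI_eq_getElem _ h1]

-- A conditional output is a loop whose length is the indicator of the condition.
open Classical in
theorem OutPL.ite {P : α → Prop} {F : α → List (Option Bool)} (hP : PLP P) (hF : OutPL F) :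
    OutPL fun v => if P v then F v else [] := by
  refine (OutPL.flatMap (F := fun v _ => F v) hP hF.weaken).congr fun v => ?_
  by_cases h : P v <;> simp [h]

open Classical in
theorem OutPL.bool {P : α → Prop} (hP : PLP P) : OutPL fun v => [some (decide (P v))] := by
  refine ((OutPL.ite hP (.emit (some true))).append
    (OutPL.ite hP.not (.emit (some false)))).congr fun v => ?_
  by_cases h : P v <;> simp [h]

theorem OutPL.encodeUnary {f : α → ℕ} (hf : PL f) : OutPL fun v => encodeUnary (f v) := by
  refine ((OutPL.flatMap (F := fun _ _ => [some true]) hf (.emit _)).append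
    (.emit none)).congr fun v => ?_
  simp only [_root_.encodeUnary, List.append_cancel_right_eq]
  induction f v with
  | zero => rfl
  | succ k ih => rw [List.range_succ, List.flatMap_append, ← ih, List.replicate_succ']; rfl

theorem OutPL.encodeNat {f : α → ℕ} (hf : PL f) : OutPL fun v => encodeNat (f v) := by
  classical
  refine ((OutPL.flatMap (F := fun v j => [some (decide (f v / 2 ^ j % 2 = 1))]) hf.size
    ((OutPL.bool (((hf.weaken.div_pow (PL.const 2) PL.var).mod (PL.const 2)).eq
      (PL.const 1))).congr fun v => by congr)).append (.emit none)).congr fun v => ?_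
  simp only [_root_.encodeNat, bits_eq_map, List.map_map, List.append_cancel_right_eq]
  rw [← List.flatMap_singleton' (List.map _ _), List.flatMap_map]
  congr 1
  funext j
  simp [Nat.testBit_eq_decide_div_mod_eq]

end Computable

/-! ### Substitution -/

section

variable {α β : Type} [Ctx α] [Ctx β]

/-- `φ` selects some of the variables of a context. -/
def IsProj (φ : β → α) : Prop :=
  ∃ ξ : Fin (Ctx.n α) → Fin (Ctx.n β), (∀ v, env (φ v) = env v ∘ ξ) ∧
    (∀ v, input (φ v) = input v) ∧ ∀ v, sz (φ v) ≤ sz v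

theorem IsProj.lift {φ : β → α} : IsProj φ → IsProj fun w : β × ℕ => (φ w.1, w.2) := by
  rintro ⟨ξ, h1, h2, h3⟩
  refine ⟨(Fin.cons 0 fun i => (ξ i).succ : Fin (Ctx.n α + 1) → Fin (Ctx.n β + 1)), fun v => ?_,
    fun v => h2 v.1, fun v => ?_⟩
  · funext i
    exact Fin.cases (by simp [env]) (fun i => by simp [env, h1]) i
  · rw [sz_prod, sz_prod]
    exact Nat.add_le_add_right (h3 v.1) _

theorem isProj_input : IsProj fun v : α => (input v : List Bool) :=
  ⟨Fin.elim0, fun v => by funext i; exact i.elim0, fun _ => rfl, fun v => by simp [sz, input, Ctx.n]⟩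

theorem PL.proj {f : α → ℕ} (hf : PL f) {φ : β → α} : IsProj φ → PL fun v => f (φ v) := by
  rintro ⟨ξ, h1, h2, h3⟩
  exact hf.rename φ ξ h1 h2 h3

/-- The `comp` lemmas carry a function of the input and a few numbers, treated once in its smallest
context, to arbitrary contexts and computed arguments. -/
theorem PL.comp₀ {F : List Bool → ℕ} (hF : PL F) : PL fun v : α => F (input v) :=
  hF.proj isProj_input

theorem PL.comp₁ {F : List Bool → ℕ → ℕ} (hF : PL fun v : List Bool × ℕ => F v.1 v.2)
    {f : α → ℕ} (hf : PL f) : PL fun v => F (input v) (f v) :=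
  hf.bind (hF.proj (isProj_input (α := α)).lift)

theorem PL.comp₂ {F : List Bool → ℕ → ℕ → ℕ}
    (hF : PL fun v : (List Bool × ℕ) × ℕ => F v.1.1 v.1.2 v.2)
    {f g : α → ℕ} (hf : PL f) (hg : PL g) : PL fun v => F (input v) (f v) (g v) :=
  hf.bind (hg.weaken.bind (hF.proj (isProj_input (α := α)).lift.lift))

theorem PL.comp₃ {F : List Bool → ℕ → ℕ → ℕ → ℕ}
    (hF : PL fun v : ((List Bool × ℕ) × ℕ) × ℕ => F v.1.1.1 v.1.1.2 v.1.2 v.2)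
    {f g h : α → ℕ} (hf : PL f) (hg : PL g) (hh : PL h) :
    PL fun v => F (input v) (f v) (g v) (h v) :=
  hf.bind (hg.weaken.bind (hh.weaken.weaken.bind
    (hF.proj (isProj_input (α := α)).lift.lift.lift)))

theorem PLP.comp₁ {P : List Bool → ℕ → Prop} (hP : PLP fun v : List Bool × ℕ => P v.1 v.2)
    {f : α → ℕ} (hf : PL f) : PLP fun v => P (input v) (f v) :=
  hf.bind (hP.proj (isProj_input (α := α)).lift)

theorem PLP.comp₂ {P : List Bool → ℕ → ℕ → Prop}
    (hP : PLP fun v : (List Bool × ℕ) × ℕ => P v.1.1 v.1.2 v.2)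
    {f g : α → ℕ} (hf : PL f) (hg : PL g) : PLP fun v => P (input v) (f v) (g v) :=
  hf.bind (hg.weaken.bind (hP.proj (isProj_input (α := α)).lift.lift))

theorem PLP.comp₃ {P : List Bool → ℕ → ℕ → ℕ → Prop}
    (hP : PLP fun v : ((List Bool × ℕ) × ℕ) × ℕ => P v.1.1.1 v.1.1.2 v.1.2 v.2)
    {f g h : α → ℕ} (hf : PL f) (hg : PL g) (hh : PL h) :
    PLP fun v => P (input v) (f v) (g v) (h v) :=
  hf.bind (hg.weaken.bind (hh.weaken.weaken.bind
    (hP.proj (isProj_input (α := α)).lift.lift.lift)))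

end

/-! ### Savitch's theorem, through depth-first evaluation of a game of polylogarithmic length. -/

/-! ### Evaluation of game trees -/

namespace GameTree

/-- The player to move wins, at a position `v` with `l` moves left, where move `j` leads to the
position `h l j v`; at the end, `base` decides. -/
def Wins (M : ℕ) (h : ℕ → ℕ → ℕ → ℕ) (base : ℕ → Prop) : ℕ → ℕ → Prop
  | 0, v => base v
  | l + 1, v => ∃ j < M, ¬ Wins M h base l (h l j v)

/-- The position after `i` of the `t` moves that are the digits of `p` in base `M`. -/
def walk (M D : ℕ) (h : ℕ → ℕ → ℕ → ℕ) (v t p : ℕ) : ℕ → ℕ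
  | 0 => v
  | i + 1 => h (D - i - 1) (p / M ^ (t - 1 - i) % M) (walk M D h v t p i)

/-- A state of the depth-first evaluation, with `l` moves left and the earlier moves given by `p`:
the value is still to be computed (`m = 0`), or known to be false (`m = 1`) or true (`m = 2`). -/
def code (D l p m : ℕ) : ℕ := (p * (D + 1) + l) * 3 + m

open Classical in
/-- A step of the evaluation. -/
noncomputable def next (M D : ℕ) (h : ℕ → ℕ → ℕ → ℕ) (base : ℕ → Prop) (v c : ℕ) : ℕ :=
  if c % 3 = 0 then
    if c / 3 % (D + 1) = 0 then
      if base (walk M D h v (D - c / 3 % (D + 1)) (c / 3 / (D + 1)) (D - c / 3 % (D + 1))) then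
        c + 2 else c + 1
    else code D (c / 3 % (D + 1) - 1) (c / 3 / (D + 1) * M) 0
  else if c / 3 % (D + 1) = D then c
  else if c % 3 = 1 then code D (c / 3 % (D + 1) + 1) (c / 3 / (D + 1) / M) 2
  else if c / 3 / (D + 1) % M + 1 < M then
    code D (c / 3 % (D + 1)) (c / 3 / (D + 1) + 1) 0
  else code D (c / 3 % (D + 1) + 1) (c / 3 / (D + 1) / M) 1

variable {M D : ℕ} {h : ℕ → ℕ → ℕ → ℕ} {base : ℕ → Prop} {v : ℕ}

theorem code_mod (l p : ℕ) {m : ℕ} (hm : m < 3) : code D l p m % 3 = m := by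
  unfold code; omega

theorem code_div (l p : ℕ) {m : ℕ} (hm : m < 3) : code D l p m / 3 = p * (D + 1) + l := by
  unfold code; omega

theorem level_code {l : ℕ} (hl : l ≤ D) (p : ℕ) {m : ℕ} (hm : m < 3) :
    code D l p m / 3 % (D + 1) = l := by
  rw [code_div _ _ hm, mul_comm, Nat.mul_add_mod, Nat.mod_eq_of_lt (by omega)]

theorem path_code {l : ℕ} (hl : l ≤ D) (p : ℕ) {m : ℕ} (hm : m < 3) :
    code D l p m / 3 / (D + 1) = p := by
  rw [code_div _ _ hm, mul_comm, Nat.mul_add_div (by omega), Nat.div_eq_of_lt (by omega), add_zero]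

open Classical in
theorem next_zero (hl : 0 ≤ D) (p : ℕ) : next M D h base v (code D 0 p 0) =
    code D 0 p (if base (walk M D h v D p D) then 2 else 1) := by
  have h1 := level_code hl p (m := 0) (by norm_num)
  have h2 := path_code hl p (m := 0) (by norm_num)
  have h3 := code_mod (D := D) 0 p (m := 0) (by norm_num)
  rw [next, if_pos h3, if_pos h1, h1, h2, Nat.sub_zero]
  split_ifs <;> rfl

theorem next_down {l : ℕ} (hl : l + 1 ≤ D) (p : ℕ) :
    next M D h base v (code D (l + 1) p 0) = code D l (p * M) 0 := by
  have h1 := level_code hl p (m := 0) (by norm_num)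
  have h2 := path_code hl p (m := 0) (by norm_num)
  have h3 := code_mod (D := D) (l + 1) p (m := 0) (by norm_num)
  rw [next, if_pos h3, h1, if_neg (by omega), h2, Nat.add_sub_cancel]

theorem next_false {l : ℕ} (hl : l < D) (p : ℕ) :
    next M D h base v (code D l p 1) = code D (l + 1) (p / M) 2 := by
  have h1 := level_code hl.le p (m := 1) (by norm_num)
  have h2 := path_code hl.le p (m := 1) (by norm_num)
  have h3 := code_mod (D := D) l p (m := 1) (by norm_num)
  rw [next, if_neg (by omega), h1, if_neg (by omega), if_pos h3, h2]

theorem next_true {l : ℕ} (hl : l < D) (p : ℕ) :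
    next M D h base v (code D l p 2) =
      if p % M + 1 < M then code D l (p + 1) 0 else code D (l + 1) (p / M) 1 := by
  have h1 := level_code hl.le p (m := 2) (by norm_num)
  have h2 := path_code hl.le p (m := 2) (by norm_num)
  have h3 := code_mod (D := D) l p (m := 2) (by norm_num)
  rw [next, if_neg (by omega), h1, if_neg (by omega), if_neg (by omega), h2]

theorem next_final {p m : ℕ} (hm : m = 1 ∨ m = 2) :
    next M D h base v (code D D p m) = code D D p m := by
  have hm3 : m < 3 := by omega
  have h1 := level_code (le_refl D) p (m := m) hm3
  have h3 := code_mod (D := D) D p hm3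
  rw [next, if_neg (by omega), if_pos h1]

theorem walk_mul_add (hM : 1 ≤ M) {j : ℕ} (hj : j < M) (t p : ℕ) :
    ∀ i ≤ t, walk M D h v (t + 1) (p * M + j) i = walk M D h v t p i := by
  intro i
  induction i with
  | zero => exact fun _ => rfl
  | succ i ih =>
    intro hi
    rw [walk, walk, ih (by omega), show t + 1 - 1 - i = (t - 1 - i) + 1 by omega, pow_succ',
      ← Nat.div_div_eq_div_mul, mul_comm p M, Nat.mul_add_div hM, Nat.div_eq_of_lt hj, add_zero]

theorem walk_succ (hM : 1 ≤ M) {j : ℕ} (hj : j < M) (t p : ℕ) :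
    walk M D h v (t + 1) (p * M + j) (t + 1) = h (D - t - 1) j (walk M D h v t p t) := by
  rw [walk, walk_mul_add hM hj t p t le_rfl]
  simp [Nat.mod_eq_of_lt hj]

-- The evaluation of one subtree keeps the path `p` to its root, so the positions above can be
-- recomputed by `walk` instead of being stacked. A node costs one step down and, for each of at
-- most `M` children, the child's cost plus one step; this fits under the next power of `M + 3`.
open Classical in
theorem exists_iterate_next (hM : 1 ≤ M) : ∀ l ≤ D, ∀ p, ∃ k ≤ (M + 3) ^ (l + 1),
    (next M D h base v)^[k] (code D l p 0) =
      code D l p (if Wins M h base l (walk M D h v (D - l) p (D - l)) then 2 else 1)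
  | 0, hl, p => ⟨1, by simp, next_zero hl p⟩
  | l + 1, hl, p => by
    have ih := exists_iterate_next hM l (by omega)
    set w := walk M D h v (D - (l + 1)) p (D - (l + 1)) with hw
    have hwalk : ∀ j < M, walk M D h v (D - l) (p * M + j) (D - l) = h l j w := by
      intro j hj
      rw [show D - l = D - (l + 1) + 1 by omega, walk_succ hM hj,
        show D - (D - (l + 1)) - 1 = l by omega]
    -- Treats the siblings `j, ..., M - 1`: the first losing child makes the parent winning, and if
    -- the last one is winning too, the parent is losing.
    have inner : ∀ r, ∀ j, j < M → M - j = r + 1 → ∃ k ≤ (r + 1) * ((M + 3) ^ (l + 1) + 1),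
        (next M D h base v)^[k] (code D l (p * M + j) 0) = code D (l + 1) p
          (if ∃ i, j ≤ i ∧ i < M ∧ ¬ Wins M h base l (h l i w) then 2 else 1) := by
      intro r
      induction r with
      | zero =>
        intro j hj hr
        obtain ⟨k, hk, e⟩ := ih (p * M + j)
        rw [hwalk j hj] at e
        refine ⟨k + 1, by omega, ?_⟩
        rw [Function.iterate_succ_apply', e]
        have hdiv : (p * M + j) / M = p := by
          rw [mul_comm, Nat.mul_add_div hM, Nat.div_eq_of_lt hj, add_zero]
        have hmod : (p * M + j) % M = j := by
          rw [mul_comm, Nat.mul_add_mod, Nat.mod_eq_of_lt hj]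
        by_cases hW : Wins M h base l (h l j w)
        · rw [if_pos hW, next_true (by omega), hmod, if_neg (by omega), hdiv, if_neg]
          rintro ⟨i, h1, h2, h3⟩
          exact h3 (by rwa [show i = j by omega])
        · rw [if_neg hW, next_false (by omega), hdiv, if_pos ⟨j, le_rfl, hj, hW⟩]
      | succ r ihr =>
        intro j hj hr
        obtain ⟨k, hk, e⟩ := ih (p * M + j)
        rw [hwalk j hj] at e
        have hdiv : (p * M + j) / M = p := by
          rw [mul_comm, Nat.mul_add_div hM, Nat.div_eq_of_lt hj, add_zero]
        have hmod : (p * M + j) % M = j := by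
          rw [mul_comm, Nat.mul_add_mod, Nat.mod_eq_of_lt hj]
        by_cases hW : Wins M h base l (h l j w)
        · obtain ⟨k', hk', e'⟩ := ihr (j + 1) (by omega) (by omega)
          refine ⟨k' + (k + 1), by rw [add_mul (r + 1)]; omega, ?_⟩
          rw [Function.iterate_add_apply, Function.iterate_succ_apply', e, if_pos hW,
            next_true (by omega), hmod, if_pos (by omega), add_assoc, e']
          congr 1
          refine if_congr ⟨?_, ?_⟩ rfl rfl
          · rintro ⟨i, h1, h2⟩
            exact ⟨i, by omega, h2⟩
          · rintro ⟨i, h1, h2, h3⟩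
            rcases eq_or_lt_of_le h1 with rfl | h1
            · exact absurd hW h3
            · exact ⟨i, h1, h2, h3⟩
        · refine ⟨k + 1, (Nat.succ_le_succ hk).trans (Nat.le_mul_of_pos_left _ (by omega)), ?_⟩
          rw [Function.iterate_succ_apply', e, if_neg hW, next_false (by omega), hdiv,
            if_pos ⟨j, le_rfl, hj, hW⟩]
    obtain ⟨k, hk, e⟩ := inner (M - 1) 0 hM (by omega)
    refine ⟨k + 1, ?_, ?_⟩
    · rw [Nat.sub_add_cancel hM] at hk
      have h1 : M + 3 ≤ (M + 3) ^ (l + 1) := Nat.le_self_pow (by omega) _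
      rw [pow_succ' (M + 3) (l + 1)]
      nlinarith
    · rw [Function.iterate_succ_apply, next_down hl, ← add_zero (p * M), e]
      congr 1
      exact if_congr (by simp [Wins]) rfl rfl

/-- The invariant that bounds the states. -/
def Inv (M D c : ℕ) : Prop := ∃ l ≤ D, ∃ p < M ^ (D - l), ∃ m < 3, c = code D l p m

theorem Inv.next (hM : 1 ≤ M) {c : ℕ} : Inv M D c → Inv M D (next M D h base v c) := by
  classical
  rintro ⟨l, hl, p, hp, m, hm, rfl⟩
  have up : ∀ m < 3, l < D → Inv M D (code D (l + 1) (p / M) m) := fun m hm hl => by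
    refine ⟨l + 1, by omega, p / M, Nat.div_lt_of_lt_mul ?_, m, hm, rfl⟩
    rwa [← pow_succ', show D - (l + 1) + 1 = D - l by omega]
  interval_cases m
  · rcases l with _ | l
    · rw [next_zero hl]
      exact ⟨0, hl, p, hp, _, by split_ifs <;> norm_num, rfl⟩
    · rw [next_down hl]
      refine ⟨l, by omega, p * M, ?_, 0, hm, rfl⟩
      rw [show D - l = D - (l + 1) + 1 by omega, pow_succ]
      exact Nat.mul_lt_mul_of_pos_right hp hM
  · rcases eq_or_lt_of_le hl with rfl | hl
    · rw [next_final (Or.inl rfl)]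
      exact ⟨l, hl, p, hp, 1, hm, rfl⟩
    · rw [next_false hl]
      exact up 2 (by norm_num) hl
  · rcases eq_or_lt_of_le hl with rfl | hl
    · rw [next_final (Or.inr rfl)]
      exact ⟨l, hl, p, hp, 2, hm, rfl⟩
    · rw [next_true hl]
      split_ifs with h'
      · refine ⟨l, hl.le, p + 1, ?_, 0, by norm_num, rfl⟩
        -- The last digit is not maximal, so incrementing it causes no carry and the path keeps its
        -- `D - l` digits.
        have hq : p / M < M ^ (D - (l + 1)) := by
          refine Nat.div_lt_of_lt_mul ?_
          rwa [← pow_succ', show D - (l + 1) + 1 = D - l by omega]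
        have h1 := Nat.div_add_mod p M
        have h2 := Nat.mul_le_mul_left M hq
        rw [← pow_succ', show D - (l + 1) + 1 = D - l by omega, Nat.mul_succ] at h2
        omega
      · exact up 1 (by norm_num) hl

theorem Inv.le (hM : 1 ≤ M) {c : ℕ} : Inv M D c → c ≤ (M ^ D * (D + 1) + D) * 3 + 2 := by
  rintro ⟨l, hl, p, hp, m, hm, rfl⟩
  have h1 : p ≤ M ^ D := hp.le.trans (Nat.pow_le_pow_right hM (Nat.sub_le _ _))
  have h2 := Nat.mul_le_mul_right (D + 1) h1
  unfold code
  omega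

-- The finished states at level `D` are fixed points of `next`, so the step count may be rounded up
-- to one that does not depend on the game.
open Classical in
theorem iterate_next (hM : 1 ≤ M) : (next M D h base v)^[(M + 3) ^ (D + 1)] (code D D 0 0) =
    code D D 0 (if Wins M h base D v then 2 else 1) := by
  obtain ⟨k, hk, e⟩ := exists_iterate_next (h := h) (base := base) (v := v) hM D le_rfl 0
  obtain ⟨r, hr⟩ := Nat.exists_eq_add_of_le' hk
  rw [hr, Function.iterate_add_apply, e, Nat.sub_self, walk]
  refine Function.iterate_fixed (next_final ?_) r
  split_ifs <;> simp

end GameTree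

-- Bounded quantifiers can be nested only to a fixed depth, whereas here the number of alternations
-- grows with the input. The evaluation is therefore one long loop whose state is a number of order
-- `M ^ D`, quasi-polynomial because `D` is polylogarithmic.
open GameTree in
theorem PLP.wins {M D b : List Bool → ℕ} {h : List Bool → ℕ → ℕ → ℕ → ℕ}
    {base : List Bool → ℕ → Prop} (hM : PL M) (hD : PL D) (hDl : LB D)
    (hh : PL fun v : ((List Bool × ℕ) × ℕ) × ℕ => h v.1.1.1 v.1.1.2 v.1.2 v.2)
    (hbase : PLP fun v : List Bool × ℕ => base v.1 v.2) (hb : QB b)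
    (hhb : ∀ x l j a, h x l j a ≤ b x) (hM1 : ∀ x, 1 ≤ M x) :
    PLP fun v : List Bool × ℕ => Wins (M v.1) (h v.1) (base v.1) (D v.1) v.2 := by
  classical
  have hwalk : PL fun v : ((List Bool × ℕ) × ℕ) × ℕ =>
      walk (M v.1.1.1) (D v.1.1.1) (h v.1.1.1) v.1.1.2 v.1.2 v.2 v.1.2 := by
    refine PL.iter (α := ((List Bool × ℕ) × ℕ) × ℕ)
      (F := fun v i => walk (M v.1.1.1) (D v.1.1.1) (h v.1.1.1) v.1.1.2 v.1.2 v.2 i)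
      (b := fun v => v.1.1.2 + b v.1.1.1)
      (h := fun w => h w.1.1.1.1.1 (D w.1.1.1.1.1 - w.1.2 - 1)
        (w.1.1.2 / M w.1.1.1.1.1 ^ (w.1.1.1.2 - 1 - w.1.2) % M w.1.1.1.1.1) w.2)
      PL.var.weaken PL.var.weaken.weaken ?_
      (PL.var.weaken.weaken.qb.add hb.weaken.weaken.weaken) (fun _ => rfl) (fun _ _ _ => rfl) ?_
    · exact PL.comp₃ (α := ((((List Bool × ℕ) × ℕ) × ℕ) × ℕ) × ℕ) hh
        ((hD.comp₀.sub PL.var.weaken).sub (.const 1))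
        ((PL.div_pow PL.var.weaken.weaken hM.comp₀
          ((PL.var.weaken.weaken.weaken.sub (.const 1)).sub PL.var.weaken)).mod hM.comp₀) PL.var
    · rintro v (_ | j) _
      · exact Nat.le_add_right _ _
      · exact (hhb _ _ _ _).trans (Nat.le_add_left _ _)
  set next' : List Bool → ℕ → ℕ → ℕ := fun x v c => next (M x) (D x) (h x) (base x) v c with hn
  have hnext : PL fun v : (List Bool × ℕ) × ℕ => next' v.1.1 v.1.2 v.2 := by
    have hc : PL fun v : (List Bool × ℕ) × ℕ => v.2 := PL.var
    have hMc : PL fun v : (List Bool × ℕ) × ℕ => M v.1.1 := hM.weaken.weaken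
    have hDc : PL fun v : (List Bool × ℕ) × ℕ => D v.1.1 := hD.weaken.weaken
    have hm : PL fun v : (List Bool × ℕ) × ℕ => v.2 % 3 := hc.mod (.const 3)
    have hl : PL fun v : (List Bool × ℕ) × ℕ => v.2 / 3 % (D v.1.1 + 1) :=
      (hc.div (.const 3)).mod hDc.succ
    have hp : PL fun v : (List Bool × ℕ) × ℕ => v.2 / 3 / (D v.1.1 + 1) :=
      (hc.div (.const 3)).div hDc.succ
    have hcode : ∀ {l p m : (List Bool × ℕ) × ℕ → ℕ}, PL l → PL p → PL m →
        PL fun v => code (D v.1.1) (l v) (p v) (m v) := fun hl hp hm =>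
      (((hp.mul hDc.succ).add hl).mul (.const 3)).add hm
    have hw : PL fun v : (List Bool × ℕ) × ℕ => walk (M v.1.1) (D v.1.1) (h v.1.1) v.1.2
        (D v.1.1 - v.2 / 3 % (D v.1.1 + 1)) (v.2 / 3 / (D v.1.1 + 1))
        (D v.1.1 - v.2 / 3 % (D v.1.1 + 1)) :=
      PL.comp₃ (F := fun x a t p => walk (M x) (D x) (h x) a t p t) hwalk PL.var.weaken
        (hDc.sub hl) hp
    have hbw : PLP fun v : (List Bool × ℕ) × ℕ => base v.1.1 (walk (M v.1.1) (D v.1.1) (h v.1.1)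
        v.1.2 (D v.1.1 - v.2 / 3 % (D v.1.1 + 1)) (v.2 / 3 / (D v.1.1 + 1))
        (D v.1.1 - v.2 / 3 % (D v.1.1 + 1))) := PLP.comp₁ hbase hw
    exact PLP.ite (hm.eq .zero)
      (PLP.ite (hl.eq .zero) (hbw.ite (hc.add (.const 2)) hc.succ)
        (hcode (hl.sub (.const 1)) (hp.mul hMc) .zero))
      (PLP.ite (hl.eq hDc) hc (PLP.ite (hm.eq (.const 1))
        (hcode hl.succ (hp.div hMc) (.const 2))
        (PLP.ite ((hp.mod hMc).succ.lt hMc) (hcode hl hp.succ .zero)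
          (hcode hl.succ (hp.div hMc) (.const 1)))))
  have hcount : PL fun x : List Bool => (M x + 3) ^ (D x + 1) :=
    (hM.add (.const 3)).pow hD.succ (hDl.add (LB.const 1))
  have hstart : PL fun x : List Bool => code (D x) (D x) 0 0 :=
    ((((PL.const 0).mul hD.succ).add hD).mul (.const 3)).add (.const 0)
  have hiter : PL fun v : List Bool × ℕ =>
      (next' v.1 v.2)^[(M v.1 + 3) ^ (D v.1 + 1)] (code (D v.1) (D v.1) 0 0) := by
    refine PL.iter (α := List Bool × ℕ)
      (F := fun v j => (next' v.1 v.2)^[j] (code (D v.1) (D v.1) 0 0))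
      (b := fun v => (M v.1 ^ D v.1 * (D v.1 + 1) + D v.1) * 3 + 2)
      (h := fun w => next' w.1.1.1 w.1.1.2 w.2)
      hcount.weaken hstart.weaken
      (PL.comp₂ (α := ((List Bool × ℕ) × ℕ) × ℕ) hnext PL.var.weaken.weaken PL.var)
      ((((hM.pow hD hDl).mul hD.succ).add hD).mul (.const 3) |>.add (.const 2)).weaken.qb
      (fun _ => rfl) (fun v j _ => Function.iterate_succ_apply' _ _ _) ?_
    intro v j _
    refine Inv.le (hM1 _) ?_
    induction j with
    | zero => exact ⟨D v.1, le_rfl, 0, Nat.pow_pos (hM1 _), 0, by norm_num, rfl⟩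
    | succ j ih => rw [Function.iterate_succ_apply']; exact (ih (by omega)).next (hM1 _)
  refine ((hiter.mod (.const 3)).eq (.const 2)).congr fun v => ?_
  rw [iterate_next (hM1 _), code_mod _ _ (by split_ifs <;> norm_num)]
  split_ifs with h <;> simp [h]

/-! ### Reachability -/

/-- There is a path of length at most `2 ^ i` from `u` to `w` among the numbers below `N`. -/
def ReachIn (N : ℕ) (E : ℕ → ℕ → Prop) : ℕ → ℕ → ℕ → Prop
  | 0, u, w => u = w ∨ E u w
  | i + 1, u, w => ∃ m < N, ReachIn N E i u m ∧ ReachIn N E i m w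

theorem exists_path_of_reflTransGen {V : Type*} {E : V → V → Prop} {u w : V}
    (h : Relation.ReflTransGen E u w) :
    ∃ (n : ℕ) (f : ℕ → V), f 0 = u ∧ f n = w ∧ ∀ i < n, E (f i) (f (i + 1)) := by
  induction h with
  | refl => exact ⟨0, fun _ => u, rfl, rfl, fun i hi => absurd hi (Nat.not_lt_zero i)⟩
  | @tail b c _ hE ih =>
    obtain ⟨n, f, h0, hn, hf⟩ := ih
    refine ⟨n + 1, fun i => if i ≤ n then f i else c, by simpa using h0, by simp, fun i hi => ?_⟩
    rcases eq_or_lt_of_le (Nat.lt_succ_iff.1 hi) with rfl | hi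
    · simpa [hn] using hE
    · simpa [hi.le, Nat.succ_le_iff.2 hi] using hf i hi

/-- A shortest path repeats no vertex, so it has fewer than `N ≤ 2 ^ d` edges and can be halved `d`
times. -/
theorem reachIn_iff {N d : ℕ} {E : ℕ → ℕ → Prop} (hE : ∀ u w, E u w → u < N ∧ w < N)
    (hd : N ≤ 2 ^ d) {u w : ℕ} (hu : u < N) :
    ReachIn N E d u w ↔ Relation.ReflTransGen E u w := by
  classical
  constructor
  · clear hd hu
    induction d generalizing u w with
    | zero =>
      rintro (rfl | h)
      · exact .refl
      · exact .single h
    | succ i ih =>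
      rintro ⟨m, -, h1, h2⟩
      exact (ih h1).trans (ih h2)
  · intro h
    have hex := exists_path_of_reflTransGen h
    obtain ⟨f, h0, hn, hf⟩ := Nat.find_spec hex
    set n := Nat.find hex with hn'
    have hlt : ∀ i ≤ n, f i < N := by
      rintro (_ | i) hi
      · rwa [h0]
      · exact (hE _ _ (hf i (by omega))).2
    -- Cutting out the segment between two equal vertices would give a path of length `n - (j - i)`,
    -- against minimality.
    have hinj : ∀ i j, i < j → j ≤ n → f i ≠ f j := by
      intro i j hij hj e
      refine Nat.find_min hex (m := n - (j - i)) (by omega)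
        ⟨fun k => if k ≤ i then f k else f (k + (j - i)), by simpa using h0, ?_, fun k hk => ?_⟩
      · dsimp only
        split_ifs with hk
        · rw [← hn, show n - (j - i) = i by omega, e]
          congr 1; omega
        · rw [show n - (j - i) + (j - i) = n by omega, hn]
      · dsimp only
        rcases lt_trichotomy k i with h | rfl | h
        · rw [if_pos h.le, if_pos (Nat.succ_le_of_lt h)]
          exact hf k (by omega)
        · rw [if_pos le_rfl, if_neg (by omega), e, show k + 1 + (j - k) = j + 1 by omega]
          exact hf j (by omega)
        · rw [if_neg (by omega), if_neg (by omega), show k + 1 + (j - i) = k + (j - i) + 1 by omega]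
          exact hf _ (by omega)
    have hcard : n + 1 ≤ N := by
      have := Finset.card_le_card_of_injOn (s := Finset.range (n + 1)) (t := Finset.range N) f
        (fun i hi => by
          simp only [Finset.coe_range, Set.mem_Iio] at hi ⊢
          exact hlt i (by omega))
        (fun i hi j hj e => by
          simp only [Finset.coe_range, Set.mem_Iio] at hi hj
          by_contra hne
          rcases lt_or_gt_of_ne hne with h | h
          · exact hinj i j h (by omega) e
          · exact hinj j i h (by omega) e.symm)
      simpa using this
    -- Segments may be shorter than `2 ^ i`, so the midpoint is truncated at `e`; the second half
    -- may then be trivial.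
    have key : ∀ i s e, s ≤ e → e ≤ n → e - s ≤ 2 ^ i → ReachIn N E i (f s) (f e) := by
      intro i
      induction i with
      | zero =>
        intro s e h1 h2 h3
        rcases eq_or_lt_of_le h1 with rfl | h1
        · exact Or.inl rfl
        · rw [show e = s + 1 by simp at h3; omega]
          exact Or.inr (hf s (by omega))
      | succ i ih =>
        intro s e h1 h2 h3
        rw [pow_succ] at h3
        exact ⟨f (min e (s + 2 ^ i)), hlt _ (by omega), ih _ _ (by omega) (by omega) (by omega),
          ih _ _ (by omega) (by omega) (by omega)⟩
    rw [← h0, ← hn]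
    exact key d 0 n (by omega) le_rfl (by omega)

/-- The moves of the game in which the first player names a vertex `m` between `u` and `w` and the
second player chooses a half, at positions `(u, m, w)` in base `N`. -/
def savitchMove (N l j a : ℕ) : ℕ :=
  if l % 2 = 1 then (a / N / N % N * N + j % N) * N + a % N
  else if j = 0 then a / N / N % N * N * N + a / N % N else a / N % N * N * N + a % N

theorem savitchMove_le {N : ℕ} (hN : 1 ≤ N) (l j a : ℕ) : savitchMove N l j a ≤ N * N * N := by
  have key : ∀ p q r, p < N → q < N → r < N → (p * N + q) * N + r ≤ N * N * N := by
    intro p q r hp hq hr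
    have h1 : (p * N + q) + 1 ≤ N * N := by nlinarith
    nlinarith
  have h := fun b : ℕ => Nat.mod_lt b hN
  unfold savitchMove
  split_ifs
  · exact key _ _ _ (h _) (h _) (h _)
  · simpa using key (a / N / N % N) 0 _ (h _) hN (h (a / N))
  · simpa using key (a / N % N) 0 _ (h _) hN (h a)

/-- Each halving takes two moves: a midpoint is claimed, then the opponent picks the half to be
verified. The condition `2 ≤ N` gives the opponent both choices, and `m` is arbitrary because the
first of the two moves overwrites it. -/
theorem wins_savitch {N : ℕ} (hN : 2 ≤ N) (E : ℕ → ℕ → Prop) : ∀ i u w, u < N → w < N → ∀ m < N,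
    (GameTree.Wins N (savitchMove N) (fun a => a / N / N % N = a % N ∨ E (a / N / N % N) (a % N))
      (2 * i) ((u * N + m) * N + w) ↔ ReachIn N E i u w) := by
  have hp : 0 < N := by omega
  have e1 : ∀ {u m w : ℕ}, u < N → m < N → w < N → ((u * N + m) * N + w) / N / N % N = u := by
    intro u m w hu hm hw
    rw [mul_comm _ N, Nat.mul_add_div hp, Nat.div_eq_of_lt hw, add_zero, mul_comm _ N,
      Nat.mul_add_div hp, Nat.div_eq_of_lt hm, add_zero, Nat.mod_eq_of_lt hu]
  have e2 : ∀ {u m w : ℕ}, m < N → w < N → ((u * N + m) * N + w) / N % N = m := by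
    intro u m w hm hw
    rw [mul_comm _ N, Nat.mul_add_div hp, Nat.div_eq_of_lt hw, add_zero, mul_comm _ N,
      Nat.mul_add_mod, Nat.mod_eq_of_lt hm]
  have e3 : ∀ {u m w : ℕ}, w < N → ((u * N + m) * N + w) % N = w := by
    intro u m w hw
    rw [mul_comm _ N, Nat.mul_add_mod, Nat.mod_eq_of_lt hw]
  intro i
  induction i with
  | zero =>
    intro u w hu hw m hm
    simp only [GameTree.Wins, ReachIn, e1 hu hm hw, e3 hw]
  | succ i ih =>
    intro u w hu hw m hm
    rw [show 2 * (i + 1) = 2 * i + 1 + 1 by ring]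
    simp only [GameTree.Wins, ReachIn]
    refine exists_congr fun m' => and_congr_right fun hm' => ?_
    have s1 : savitchMove N (2 * i + 1) m' ((u * N + m) * N + w) = (u * N + m') * N + w := by
      rw [savitchMove, if_pos (by omega), e1 hu hm hw, e3 hw, Nat.mod_eq_of_lt hm']
    have s2 : savitchMove N (2 * i) 0 ((u * N + m') * N + w) = (u * N + 0) * N + m' := by
      rw [savitchMove, if_neg (by omega), if_pos rfl, e1 hu hm' hw, e2 hm' hw, add_zero]
    have s3 : ∀ j ≠ 0, savitchMove N (2 * i) j ((u * N + m') * N + w) = (m' * N + 0) * N + w := by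
      intro j hj
      rw [savitchMove, if_neg (by omega), if_neg hj, e2 hm' hw, e3 hw, add_zero]
    rw [s1, ← ih u m' hu hm' 0 hp, ← ih m' w hm' hw 0 hp]
    constructor
    · intro h
      push Not at h
      constructor
      · rw [← s2]; exact h 0 hp
      · rw [← s3 1 one_ne_zero]; exact h 1 hN
    · rintro ⟨h1, h2⟩ ⟨j, hj, h⟩
      rcases eq_or_ne j 0 with rfl | h0
      · rw [s2] at h; exact h h1
      · rw [s3 j h0] at h; exact h h2

theorem PLP.reachIn {N d : List Bool → ℕ} {E : List Bool → ℕ → ℕ → Prop} (hN : PL N) (hd : PL d)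
    (hdl : LB d) (hE : PLP fun v : (List Bool × ℕ) × ℕ => E v.1.1 v.1.2 v.2)
    (hN2 : ∀ x, 2 ≤ N x) : PLP fun v : (List Bool × ℕ) × ℕ =>
      v.1.2 < N v.1.1 ∧ v.2 < N v.1.1 ∧ ReachIn (N v.1.1) (E v.1.1) (d v.1.1) v.1.2 v.2 := by
  have hmove : PL fun v : ((List Bool × ℕ) × ℕ) × ℕ =>
      savitchMove (N v.1.1.1) v.1.1.2 v.1.2 v.2 := by
    have hN' : PL fun v : ((List Bool × ℕ) × ℕ) × ℕ => N v.1.1.1 := hN.weaken.weaken.weaken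
    have hw : PL fun v : ((List Bool × ℕ) × ℕ) × ℕ => v.2 % N v.1.1.1 := PL.var.mod hN'
    have hm : PL fun v : ((List Bool × ℕ) × ℕ) × ℕ => v.2 / N v.1.1.1 % N v.1.1.1 :=
      (PL.var.div hN').mod hN'
    have hu : PL fun v : ((List Bool × ℕ) × ℕ) × ℕ => v.2 / N v.1.1.1 / N v.1.1.1 % N v.1.1.1 :=
      ((PL.var.div hN').div hN').mod hN'
    exact PLP.ite ((PL.var.weaken.weaken.mod (.const 2)).eq (.const 1))
      ((((hu.mul hN').add (PL.var.weaken.mod hN')).mul hN').add hw)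
      (PLP.ite (PL.var.weaken.eq .zero) (((hu.mul hN').mul hN').add hm)
        (((hm.mul hN').mul hN').add hw))
  have hbase : PLP fun v : List Bool × ℕ => v.2 / N v.1 / N v.1 % N v.1 = v.2 % N v.1 ∨
      E v.1 (v.2 / N v.1 / N v.1 % N v.1) (v.2 % N v.1) := by
    have hN' : PL fun v : List Bool × ℕ => N v.1 := hN.weaken
    have hu : PL fun v : List Bool × ℕ => v.2 / N v.1 / N v.1 % N v.1 :=
      ((PL.var.div hN').div hN').mod hN'
    have hw : PL fun v : List Bool × ℕ => v.2 % N v.1 := PL.var.mod hN'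
    exact (hu.eq hw).or (PLP.comp₂ hE hu hw)
  have h := PLP.wins (D := fun x => 2 * d x) (b := fun x => N x * N x * N x) hN
    ((PL.const 2).mul hd) ((LB.const 2).mul hdl) hmove (base := fun x a =>
      a / N x / N x % N x = a % N x ∨ E x (a / N x / N x % N x) (a % N x)) hbase
    ((hN.mul hN).mul hN).qb (fun x => savitchMove_le (by have := hN2 x; omega))
    (fun x => by have := hN2 x; omega)
  have hN' : PL fun v : (List Bool × ℕ) × ℕ => N v.1.1 := hN.weaken.weaken
  have h' := PLP.comp₁ (α := (List Bool × ℕ) × ℕ) (P := fun x a => GameTree.Wins (N x)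
    (savitchMove (N x)) (fun a => a / N x / N x % N x = a % N x ∨
      E x (a / N x / N x % N x) (a % N x)) (2 * d x) a) h
    (((PL.var.weaken.mul hN').mul hN').add PL.var)
  refine ((PL.var.weaken.lt hN').and ((PL.var.lt hN').and h')).congr fun v => ?_
  refine and_congr_right fun h1 => and_congr_right fun h2 => ?_
  have := wins_savitch (hN2 v.1.1) (E v.1.1) (d v.1.1) v.1.2 v.2 h1 h2 0
    (by have := hN2 v.1.1; omega)
  rw [add_zero] at this
  exact this.symm

/-! ### Lassos: transfer between graphs, and unfolding into infinite sequences. -/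

/-! ### Paths -/

section Paths

variable {V W : Type*}

/-- `v` lies on a path from `I` to a loop through `F`. -/
def OnLasso (E : V → V → Prop) (I F : V → Prop) (v : V) : Prop :=
  (∃ p, I p ∧ Relation.ReflTransGen E p v) ∧
    ∃ f, F f ∧ Relation.ReflTransGen E v f ∧ Relation.TransGen E f f

/-- Only vertices between the two ends of a path need a representative, which is all that is
available for lassos. -/
theorem reflTransGen_lift {E : V → V → Prop} {E' : W → W → Prop} {φ : W → V} {N : W → Prop}
    (hφ : Set.InjOn φ {w | N w}) (hE : ∀ w w', E' w w' ↔ N w ∧ N w' ∧ E (φ w) (φ w'))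
    {b : W} (hb : N b) {x : V} (h : Relation.ReflTransGen E x (φ b))
    (hx : ∀ z, Relation.ReflTransGen E x z → Relation.ReflTransGen E z (φ b) →
      ∃ w, N w ∧ φ w = z) : ∀ a, N a → φ a = x → Relation.ReflTransGen E' a b := by
  induction h using Relation.ReflTransGen.head_induction_on with
  | refl => exact fun a ha e => (hφ ha hb e) ▸ .refl
  | @head x c hxc hc ih =>
    intro a ha e
    obtain ⟨w, hw, rfl⟩ := hx c (.single hxc) hc
    refine .head ((hE a w).2 ⟨ha, hw, e ▸ hxc⟩) (ih (fun z h1 h2 => hx z (.head hxc h1) h2) w hw rfl)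

/-- Every vertex of a lasso is itself on a lasso. A full subgraph that represents all lasso vertices
thus contains the witnessing lassos entirely, and trimming gives the same result there. This is
applied both to vectors with capped entries and to numerical codes. -/
theorem onLasso_iff {E : V → V → Prop} {I F : V → Prop} {E' : W → W → Prop} {I' F' : W → Prop}
    {φ : W → V} {N : W → Prop} (hφ : Set.InjOn φ {w | N w})
    (hE : ∀ w w', E' w w' ↔ N w ∧ N w' ∧ E (φ w) (φ w')) (hI : ∀ w, I' w ↔ N w ∧ I (φ w))
    (hF : ∀ w, F' w ↔ N w ∧ F (φ w)) (hr : ∀ v, OnLasso E I F v → ∃ w, N w ∧ φ w = v) (w : W) :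
    OnLasso E' I' F' w ↔ N w ∧ OnLasso E I F (φ w) := by
  have hmap : ∀ {a b}, Relation.ReflTransGen E' a b → Relation.ReflTransGen E (φ a) (φ b) :=
    fun h => h.lift φ fun a b h => ((hE a b).1 h).2.2
  constructor
  · rintro ⟨⟨p, hp, hpw⟩, f, hf, hwf, hff⟩
    refine ⟨?_, ⟨φ p, ((hI p).1 hp).2, hmap hpw⟩, φ f, ((hF f).1 hf).2, hmap hwf,
      hff.lift φ fun a b h => ((hE a b).1 h).2.2⟩
    rcases hpw.cases_tail with rfl | ⟨c, -, hc⟩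
    · exact ((hI _).1 hp).1
    · exact ((hE _ _).1 hc).2.1
  · rintro ⟨hw, ⟨p, hp, hpw⟩, f, hf, hwf, hff⟩
    obtain ⟨p', hp', rfl⟩ := hr p ⟨⟨p, hp, .refl⟩, f, hf, hpw.trans hwf, hff⟩
    obtain ⟨f', hf', rfl⟩ := hr f ⟨⟨φ p', hp, hpw.trans hwf⟩, f, hf, .refl, hff⟩
    refine ⟨⟨p', (hI _).2 ⟨hp', hp⟩, reflTransGen_lift hφ hE hw hpw (fun z h1 h2 => hr z
      ⟨⟨_, hp, h1⟩, _, hf, h2.trans hwf, hff⟩) p' hp' rfl⟩, f', (hF _).2 ⟨hf', hf⟩,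
      reflTransGen_lift hφ hE hf' hwf (fun z h1 h2 => hr z
        ⟨⟨_, hp, hpw.trans h1⟩, _, hf, h2, hff⟩) w hw rfl, ?_⟩
    obtain ⟨g, hg, hgf⟩ := Relation.TransGen.head'_iff.1 hff
    have hloop : ∀ z, Relation.ReflTransGen E g z → Relation.ReflTransGen E z (φ f') →
        ∃ w, N w ∧ φ w = z := fun z h1 h2 => hr z
      ⟨⟨_, hp, (hpw.trans hwf).trans (.head hg h1)⟩, _, hf, h2, hff⟩
    obtain ⟨g', hg', rfl⟩ := hloop g .refl hgf
    exact .head' ((hE _ _).2 ⟨hf', hg', hg⟩) (reflTransGen_lift hφ hE hf' hgf hloop g' hg' rfl)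

/-- The loop is traversed periodically: the index is taken modulo its length. -/
theorem exists_seq_of_transGen {E : V → V → Prop} {f : V} (h : Relation.TransGen E f f) :
    ∃ τ : ℕ → V, τ 0 = f ∧ (∀ i, E (τ i) (τ (i + 1))) ∧ ∀ n, ∃ i ≥ n, τ i = f := by
  obtain ⟨g, hg, hgf⟩ := Relation.TransGen.head'_iff.1 h
  obtain ⟨n, γ, h0, hn, hγ⟩ := exists_path_of_reflTransGen hgf
  set σ : ℕ → V := fun i => Nat.casesOn i f γ with hσ
  have hE : ∀ i ≤ n, E (σ i) (σ (i + 1)) := by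
    rintro (_ | i) hi
    · simpa [hσ, h0] using hg
    · exact hγ i hi
  refine ⟨fun i => σ (i % (n + 1)), by simp [hσ], fun i => ?_, fun m => ⟨(n + 1) * m, ?_, ?_⟩⟩
  · have hlt : i % (n + 1) < n + 1 := Nat.mod_lt i (Nat.succ_pos n)
    have e : (i + 1) % (n + 1) = (i % (n + 1) + 1) % (n + 1) := (Nat.mod_add_mod i (n + 1) 1).symm
    change E (σ (i % (n + 1))) (σ ((i + 1) % (n + 1)))
    rw [e]
    rcases Nat.lt_or_ge (i % (n + 1) + 1) (n + 1) with h | h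
    · rw [Nat.mod_eq_of_lt h]
      exact hE _ (by omega)
    · rw [show i % (n + 1) = n by omega, Nat.mod_self]
      have := hE n le_rfl
      simpa [hσ, hn] using this
  · exact Nat.le_mul_of_pos_left _ (Nat.succ_pos n)
  · simp [hσ]

theorem exists_seq_prepend {E : V → V → Prop} {x y : V} (h : Relation.ReflTransGen E x y)
    {τ : ℕ → V} (h0 : τ 0 = y) (hτ : ∀ i, E (τ i) (τ (i + 1))) :
    ∃ (ρ : ℕ → V) (n : ℕ), ρ 0 = x ∧ (∀ i, E (ρ i) (ρ (i + 1))) ∧ ∀ i, ρ (i + n) = τ i := by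
  induction h using Relation.ReflTransGen.head_induction_on with
  | refl => exact ⟨τ, 0, h0, hτ, fun _ => rfl⟩
  | @head x c hxc _ ih =>
    obtain ⟨ρ, n, h1, h2, h3⟩ := ih
    refine ⟨fun i => Nat.casesOn i x ρ, n + 1, rfl, ?_, h3⟩
    rintro (_ | i)
    · simpa [h1] using hxc
    · exact h2 i

theorem OnLasso.exists_seq {E : V → V → Prop} {I F : V → Prop} {v : V} (h : OnLasso E I F v) :
    ∃ (ρ : ℕ → V) (t : ℕ), I (ρ 0) ∧ ρ t = v ∧ (∀ i, E (ρ i) (ρ (i + 1))) ∧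
      ∀ n, ∃ i ≥ n, F (ρ i) := by
  obtain ⟨⟨p, hp, hpv⟩, f, hf, hvf, hff⟩ := h
  obtain ⟨τ, h0, h1, h2⟩ := exists_seq_of_transGen hff
  obtain ⟨τ', n, h0', h1', h2'⟩ := exists_seq_prepend hvf h0 h1
  obtain ⟨ρ, t, h0'', h1'', h2''⟩ := exists_seq_prepend hpv h0' h1'
  refine ⟨ρ, t, h0'' ▸ hp, by simpa [h0'] using h2'' 0, h1'', fun m => ?_⟩
  obtain ⟨i, hi, e⟩ := h2 m
  exact ⟨i + n + t, by omega, by rw [h2'', h2', e]; exact hf⟩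

end Paths

namespace NBA

variable {Q S : Type*}

/-! ### Successor counts depend only on the last states and the bits of the prefixes. -/

/-! ### Labels -/

open Classical in
/-- The number of indices with each label. -/
noncomputable def labVec {J : Type*} [Fintype J] (lab : J → Option (Q × Bool)) : Q × Bool → ℕ :=
  fun y => (Finset.univ.filter fun i => lab i = some y).card

/-- The vector is viewed as a multiset of labels and distributed over `K` slots; the slots left over
carry `none`. -/
theorem exists_labVec [Fintype Q] {K : ℕ} (r : Q × Bool → ℕ) (hr : ∑ y, r y ≤ K) :
    ∃ lab : Fin K → Option (Q × Bool), labVec lab = r := by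
  classical
  have hc : Fintype.card (Σ y, Fin (r y)) = ∑ y, r y := by simp
  let e := Fintype.equivFinOfCardEq hc
  refine ⟨fun i => if h : (i : ℕ) < ∑ y, r y then some (e.symm ⟨i, h⟩).1 else none, ?_⟩
  funext y
  have : (Finset.univ.filter fun i : Fin K =>
      (if h : (i : ℕ) < ∑ y, r y then some (e.symm ⟨i, h⟩).1 else none) = some y) =
      Finset.univ.image fun a : Fin (r y) => Fin.castLE hr (e ⟨y, a⟩) := by
    ext i
    simp only [Finset.mem_filter, Finset.mem_univ, true_and, Finset.mem_image]
    constructor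
    · intro h
      split_ifs at h with hi
      rw [Option.some.injEq] at h
      obtain ⟨⟨y', a⟩, ha⟩ : ∃ z, z = e.symm ⟨i, hi⟩ := ⟨_, rfl⟩
      rw [← ha] at h
      dsimp only at h
      subst h
      exact ⟨a, by rw [ha]; simp⟩
    · rintro ⟨a, rfl⟩
      simp
  rw [labVec, this, Finset.card_image_of_injective, Finset.card_univ, Fintype.card_fin]
  intro a b h
  simpa using h

/-! ### The successors of a set of prefixes -/

/-- The elements of `P` are the prefixes `s i` with bits such that `lab i` is the last state of the
prefix and the bit. -/
structure Presents {J : Type*} (P : Finset (List Q × Bool)) (lab : J → Option (Q × Bool))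
    (s : J → List Q) : Prop where
  last : ∀ i y, lab i = some y → (s i).getLast? = some y.1
  inj : ∀ i j y z, lab i = some y → lab j = some z → s i = s j → i = j
  mem : ∀ y, y ∈ P ↔ ∃ i z, lab i = some z ∧ y = (s i, z.2)

section

variable {J : Type*} [Fintype J] {P : Finset (List Q × Bool)} {lab : J → Option (Q × Bool)}
  {s : J → List Q}

/-- For each label there are as many slots as elements of `P`, so a bijection can be chosen label by
label. -/
theorem exists_presents (hP : IsPrefixSet P) (h : πlast P = labVec lab) :
    ∃ s, Presents P lab s := by
  classical
  have hbij : ∀ y : Q × Bool, ∃ f : J → List Q × Bool, Set.BijOn f {i | lab i = some y}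
      {x | x ∈ P ∧ x.1.getLast? = some y.1 ∧ x.2 = y.2} := by
    intro y
    have h1 := congrFun h y
    simp only [πlast, labVec] at h1
    obtain ⟨f, hf⟩ := Set.Finite.exists_bijOn_of_encard_eq (α := J) (β := List Q × Bool)
      (s := {i | lab i = some y}) (t := {x | x ∈ P ∧ x.1.getLast? = some y.1 ∧ x.2 = y.2})
      (Set.toFinite _) (by
        have e1 : {i | lab i = some y} = ((Finset.univ.filter fun i => lab i = some y : Finset J) :
          Set J) := by ext; simp
        have e2 : {x | x ∈ P ∧ x.1.getLast? = some y.1 ∧ x.2 = y.2} =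
          ((P.filter fun x => x.1.getLast? = some y.1 ∧ x.2 = y.2 : Finset (List Q × Bool)) :
            Set (List Q × Bool)) := by ext; simp
        rw [e1, e2, Set.encard_coe_eq_coe_finsetCard, Set.encard_coe_eq_coe_finsetCard]
        exact_mod_cast h1.symm)
    exact ⟨f, hf⟩
  choose f hf using hbij
  have hs : ∀ i y, lab i = some y → f y i ∈ P ∧ (f y i).1.getLast? = some y.1 ∧ (f y i).2 = y.2 :=
    fun i y hi => (hf y).mapsTo hi
  refine ⟨fun i => match lab i with
    | some y => (f y i).1
    | none => [], fun i y hi => ?_, fun i j y z hi hj hij => ?_, fun y => ⟨fun hy => ?_, ?_⟩⟩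
  · simp only [hi]
    exact (hs i y hi).2.1
  · simp only [hi, hj] at hij
    have e := hP.2.2 (hs i y hi).1 (hs j z hj).1 hij
    have e' : y = z := by
      refine Prod.ext ?_ ?_
      · have := (hs i y hi).2.1
        rw [e, (hs j z hj).2.1] at this
        exact (Option.some.inj this).symm
      · rw [← (hs i y hi).2.2, e, (hs j z hj).2.2]
    subst e'
    exact (hf y).injOn hi hj e
  · obtain ⟨q, hq⟩ : ∃ q, y.1.getLast? = some q := by
      rcases e : y.1.getLast? with _ | q
      · exact absurd (List.getLast?_eq_none_iff.1 e) (hP.2.1 y hy)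
      · exact ⟨q, rfl⟩
    obtain ⟨i, hi, e⟩ := (hf (q, y.2)).surjOn ⟨hy, hq, rfl⟩
    have hi' : lab i = some _ := hi
    refine ⟨i, _, hi', ?_⟩
    simp only [hi']
    exact Prod.ext (by rw [e]) rfl
  · rintro ⟨i, z, hi, rfl⟩
    simp only [hi]
    rw [← (hs i z hi).2.2]
    exact (hs i z hi).1

theorem Presents.πlast_eq (h : Presents P lab s) : πlast P = labVec lab := by
  classical
  funext y
  have : (P.filter fun x => x.1.getLast? = some y.1 ∧ x.2 = y.2) =
      (Finset.univ.filter fun i => lab i = some y).image fun i => (s i, y.2) := by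
    ext x
    simp only [Finset.mem_filter, Finset.mem_image, Finset.mem_univ, true_and, h.mem]
    constructor
    · rintro ⟨⟨i, z, hi, rfl⟩, h1, h2⟩
      have h3 := h.last i z hi
      dsimp only at h1 h2
      rw [h1, Option.some.injEq] at h3
      have : z = y := Prod.ext h3.symm h2
      subst this
      exact ⟨i, hi, rfl⟩
    · rintro ⟨i, hi, rfl⟩
      exact ⟨⟨i, y, hi, rfl⟩, h.last i y hi, rfl⟩
  rw [πlast, labVec]
  rw [this, Finset.card_image_of_injOn]
  intro i hi j hj e
  simp only [Finset.coe_filter, Finset.mem_univ, true_and, Set.mem_ofPred_eq] at hi hj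
  exact h.inj i j y y hi hj (Prod.ext_iff.1 e).1

theorem IsPrefixSet.πlast_ne_zero (hP : IsPrefixSet P) : πlast P ≠ 0 := by
  classical
  obtain ⟨y, hy⟩ := hP.1
  intro h
  rcases e : y.1.getLast? with _ | q
  · exact hP.2.1 y hy (List.getLast?_eq_none_iff.1 e)
  · have := congrFun h (q, y.2)
    simp only [πlast, Pi.zero_apply, Finset.card_eq_zero] at this
    exact Finset.notMem_empty y (this ▸ Finset.mem_filter.2 ⟨hy, e, rfl⟩)

/-- Slots get constant words of pairwise different lengths, which makes the prefixes distinct. Hence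
`succCount` is not the default 0 for want of a set `P`. -/
theorem exists_isPrefixSet (hl : labVec lab ≠ 0) :
    ∃ P, IsPrefixSet P ∧ πlast P = labVec lab := by
  classical
  let e := Fintype.equivFin J
  let s : J → List Q := fun i => match lab i with
    | some y => List.replicate (e i + 1) y.1
    | none => []
  let P : Finset (List Q × Bool) := Finset.univ.biUnion fun i => match lab i with
    | some y => {(s i, y.2)}
    | none => ∅
  have hmem : ∀ y, y ∈ P ↔ ∃ i z, lab i = some z ∧ y = (s i, z.2) := by
    intro y
    simp only [P, Finset.mem_biUnion, Finset.mem_univ, true_and]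
    refine exists_congr fun i => ?_
    rcases lab i with _ | z <;> simp
  have hs : ∀ i y, lab i = some y → s i = List.replicate (e i + 1) y.1 := by
    intro i y hi
    simp [s, hi]
  have hinj : ∀ i j y z, lab i = some y → lab j = some z → s i = s j → i = j := by
    intro i j y z hi hj h
    have := congrArg List.length h
    rw [hs i y hi, hs j z hj, List.length_replicate, List.length_replicate] at this
    exact e.injective (Fin.ext (by omega))
  have hP : Presents P lab s :=
    ⟨fun i y hi => by rw [hs i y hi, List.getLast?_replicate]; simp, hinj, hmem⟩
  refine ⟨P, ⟨?_, ?_, ?_⟩, hP.πlast_eq⟩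
  · obtain ⟨y, hy⟩ := Function.ne_iff.1 hl
    obtain ⟨i, hi⟩ := Finset.card_pos.1 (Nat.pos_of_ne_zero hy)
    exact ⟨_, (hmem _).2 ⟨i, y, (Finset.mem_filter.1 hi).2, rfl⟩⟩
  · intro x hx
    obtain ⟨i, z, hi, rfl⟩ := (hmem x).1 hx
    simp [hs i z hi]
  · intro x hx y hy h
    obtain ⟨i, z, hi, rfl⟩ := (hmem x).1 hx
    obtain ⟨j, z', hj, rfl⟩ := (hmem y).1 hy
    have := hinj i j z z' hi hj h
    subst this
    rw [hi] at hj
    rw [Option.some.inj hj]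

open Classical in
/-- The bit of the extensions of prefix `i`. -/
noncomputable def newBit (A : NBA Q S) (lab : J → Option (Q × Bool)) (i : J) : Bool :=
  decide ((∃ p b, lab i = some (p, b) ∧ (p ∈ A.final ∨ b = true)) ∧ ∃ j p, lab j = some (p, false))

open Classical in
/-- The set `E` of pairs of a prefix and a state describes an `a`-successor with image `r'`. -/
def IsStep (A : NBA Q S) (a : S) (lab : J → Option (Q × Bool)) (r' : Q × Bool → ℕ)
    (E : Finset (J × Q)) : Prop :=
  (∀ i q, (i, q) ∈ E → ∃ p b, lab i = some (p, b) ∧ q ∈ A.δ p a) ∧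
  (∀ i, lab i ≠ none → ∃ q, (i, q) ∈ E) ∧
  ∀ q b, (Finset.univ.filter fun i => (i, q) ∈ E ∧ A.newBit lab i = b).card = r' (q, b)

theorem Presents.extends_iff (h : Presents P lab s) (A : NBA Q S) (a : S) {i : J} {z : Q × Bool}
    (hi : lab i = some z) (y : List Q × Bool) :
    A.Extends a P (s i, z.2) y ↔ ∃ q ∈ A.δ z.1 a, y = (s i ++ [q], A.newBit lab i) := by
  classical
  have hall : (¬ ∀ x ∈ P, x.2 = true) ↔ ∃ j p, lab j = some (p, false) := by
    constructor
    · intro h'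
      push Not at h'
      obtain ⟨x, hx, hb⟩ := h'
      obtain ⟨j, ⟨p, b⟩, hj, rfl⟩ := (h.mem x).1 hx
      simp only [ne_eq, Bool.not_eq_true] at hb
      subst hb
      exact ⟨j, p, hj⟩
    · rintro ⟨j, p, hj⟩ h'
      have := h' _ ((h.mem _).2 ⟨j, _, hj, rfl⟩)
      simp at this
  have hbit : (decide ((z.1 ∈ A.final ∨ z.2 = true) ∧ ¬ ∀ x ∈ P, x.2 = true)) =
      A.newBit lab i := by
    rw [newBit]
    refine decide_eq_decide.2 (and_congr ?_ hall)
    constructor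
    · exact fun h => ⟨z.1, z.2, hi, h⟩
    · rintro ⟨p, b, hpb, h⟩
      rw [hi, Option.some.injEq] at hpb
      subst hpb
      exact h
  constructor
  · rintro ⟨p, q, hp, hq, rfl⟩
    have := h.last i z hi
    rw [hp, Option.some.injEq] at this
    subst this
    exact ⟨q, hq, by rw [← hbit]⟩
  · rintro ⟨q, hq, rfl⟩
    exact ⟨z.1, q, h.last i z hi, hq, by rw [← hbit]⟩

/-- Sending a set of pairs (slot, next state) to the set of extended prefixes is a bijection onto
the successors. The right-hand side mentions only `lab`, which is why the count does not depend on
`P`. -/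
theorem Presents.ncard_succ [Fintype Q] (h : Presents P lab s) (A : NBA Q S) (a : S)
    (r' : Q × Bool → ℕ) :
    {P' | A.IsSucc a P P' ∧ πlast P' = r'}.ncard = {E | A.IsStep a lab r' E}.ncard := by
  classical
  set ext : J × Q → List Q × Bool := fun y => (s y.1 ++ [y.2], A.newBit lab y.1) with hext
  have hinj : ∀ {i j : J} {p q : Q}, lab i ≠ none → lab j ≠ none → ext (i, p) = ext (j, q) →
      i = j ∧ p = q := by
    intro i j p q hi hj e
    obtain ⟨y, hy⟩ := Option.ne_none_iff_exists'.1 hi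
    obtain ⟨z, hz⟩ := Option.ne_none_iff_exists'.1 hj
    obtain ⟨e1, e2⟩ := List.append_inj' (Prod.ext_iff.1 e).1 rfl
    exact ⟨h.inj i j y z hy hz e1, by simpa using e2⟩
  set T := {E : Finset (J × Q) | A.IsStep a lab r' E} with hT
  have hsome : ∀ E ∈ T, ∀ y ∈ E, lab y.1 ≠ none := by
    intro E hE y hy e
    obtain ⟨p, b, h1, -⟩ := hE.1 y.1 y.2 hy
    rw [e] at h1
    cases h1
  have hmem : ∀ E ∈ T, ∀ y, lab y.1 ≠ none → (ext y ∈ E.image ext ↔ y ∈ E) := by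
    intro E hE y hy
    refine ⟨fun h' => ?_, fun h' => Finset.mem_image_of_mem _ h'⟩
    obtain ⟨z, hz, e⟩ := Finset.mem_image.1 h'
    obtain ⟨e1, e2⟩ := hinj (i := z.1) (j := y.1) (p := z.2) (q := y.2) (hsome E hE z hz) hy e
    have : z = y := Prod.ext e1 e2
    rwa [← this]
  have hcount : ∀ E : Finset (J × Q), (∀ y ∈ E, lab y.1 ≠ none) → ∀ q b,
      πlast (E.image ext) (q, b) =
        (Finset.univ.filter fun i => (i, q) ∈ E ∧ A.newBit lab i = b).card := by
    intro E hE q b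
    have : ((E.image ext).filter fun x => x.1.getLast? = some q ∧ x.2 = b) =
        (Finset.univ.filter fun i => (i, q) ∈ E ∧ A.newBit lab i = b).image
          fun i => ext (i, q) := by
      ext x
      simp only [Finset.mem_filter, Finset.mem_image, Finset.mem_univ, true_and, Prod.exists]
      constructor
      · rintro ⟨⟨i, q', hi, rfl⟩, h1, h2⟩
        simp only [hext, List.getLast?_concat, Option.some.injEq] at h1 h2
        subst h1
        exact ⟨i, ⟨hi, h2⟩, rfl⟩
      · rintro ⟨i, ⟨hi, h2⟩, rfl⟩
        exact ⟨⟨i, q, hi, rfl⟩, by simp [hext], h2⟩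
    rw [πlast, this, Finset.card_image_of_injOn]
    intro i hi j hj e
    simp only [Finset.coe_filter, Finset.mem_univ, true_and, Set.mem_ofPred_eq] at hi hj
    exact (hinj (hE _ hi.1) (hE _ hj.1) e).1
  have himage : {P' | A.IsSucc a P P' ∧ πlast P' = r'} = (fun E => E.image ext) '' T := by
    ext P'
    constructor
    · rintro ⟨⟨h1, h2⟩, h3⟩
      -- A successor is decoded into the pairs whose extension belongs to it.
      set E : Finset (J × Q) :=
        Finset.univ.filter fun y => lab y.1 ≠ none ∧ ext y ∈ P' with hE
      have himg : E.image ext = P' := by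
        ext y
        simp only [Finset.mem_image, hE, Finset.mem_filter, Finset.mem_univ, true_and]
        constructor
        · rintro ⟨z, ⟨-, hz⟩, rfl⟩
          exact hz
        · intro hy
          obtain ⟨x, hx, hxy⟩ := h2 y hy
          obtain ⟨i, z, hi, rfl⟩ := (h.mem x).1 hx
          obtain ⟨q, hq, rfl⟩ := (h.extends_iff A a hi y).1 hxy
          exact ⟨(i, q), ⟨by simp [hi], hy⟩, rfl⟩
      have hEs : ∀ y ∈ E, lab y.1 ≠ none := fun y hy => (Finset.mem_filter.1 hy).2.1
      refine ⟨E, ⟨?_, ?_, ?_⟩, himg⟩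
      · intro i q hiq
        obtain ⟨hl, hP'⟩ := (Finset.mem_filter.1 hiq).2
        obtain ⟨x, hx, hxy⟩ := h2 _ hP'
        obtain ⟨j, z, hj, rfl⟩ := (h.mem x).1 hx
        obtain ⟨q', hq', e⟩ := (h.extends_iff A a hj _).1 hxy
        obtain ⟨rfl, rfl⟩ := hinj (i := i) (j := j) (p := q) (q := q') hl (by simp [hj]) e
        exact ⟨z.1, z.2, hj, hq'⟩
      · intro i hi
        obtain ⟨z, hz⟩ := Option.ne_none_iff_exists'.1 hi
        obtain ⟨y, hy, hxy⟩ := h1 _ ((h.mem _).2 ⟨i, z, hz, rfl⟩)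
        obtain ⟨q, hq, rfl⟩ := (h.extends_iff A a hz y).1 hxy
        exact ⟨q, Finset.mem_filter.2 ⟨Finset.mem_univ _, hi, hy⟩⟩
      · intro q b
        rw [← hcount E hEs, himg, h3]
    · rintro ⟨E, hE, rfl⟩
      refine ⟨⟨?_, ?_⟩, ?_⟩
      · intro x hx
        obtain ⟨i, z, hi, rfl⟩ := (h.mem x).1 hx
        obtain ⟨q, hq⟩ := hE.2.1 i (by simp [hi])
        obtain ⟨p, b, hpb, hδ⟩ := hE.1 i q hq
        refine ⟨ext (i, q), Finset.mem_image_of_mem _ hq, (h.extends_iff A a hi _).2 ⟨q, ?_, rfl⟩⟩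
        rw [hi, Option.some.injEq] at hpb
        subst hpb
        exact hδ
      · intro y hy
        obtain ⟨⟨i, q⟩, hq, rfl⟩ := Finset.mem_image.1 hy
        obtain ⟨p, b, hpb, hδ⟩ := hE.1 i q hq
        exact ⟨(s i, b), (h.mem _).2 ⟨i, (p, b), hpb, rfl⟩,
          (h.extends_iff A a hpb _).2 ⟨q, hδ, rfl⟩⟩
      · funext y
        rw [hcount E (hsome E hE) y.1 y.2, hE.2.2]
  rw [himage, Set.InjOn.ncard_image]
  intro E hE E' hE' e
  ext y
  dsimp only at e
  constructor
  · intro hy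
    have := (hmem E hE y (hsome E hE y hy)).2 hy
    rw [e] at this
    exact (hmem E' hE' y (hsome E hE y hy)).1 this
  · intro hy
    have := (hmem E' hE' y (hsome E' hE' y hy)).2 hy
    rw [← e] at this
    exact (hmem E hE y (hsome E' hE' y hy)).1 this

theorem succCount_eq_ncard [Fintype Q] (A : NBA Q S) (a : S) (hl : labVec lab ≠ 0)
    (r' : Q × Bool → ℕ) :
    A.succCount a (labVec lab) r' = {E | A.IsStep a lab r' E}.ncard := by
  classical
  have hex := exists_isPrefixSet hl
  rw [succCount, dif_pos hex]
  obtain ⟨h1, h2⟩ := hex.choose_spec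
  obtain ⟨s, hs⟩ := exists_presents h1 h2
  exact hs.ncard_succ A a r'

end

/-- Frees the count from the set selected by choice in `succCount`: any presentation of the same
vector gives the same number. -/
theorem succCount_eq_of_πlast [Fintype Q] (A : NBA Q S) (a : S) {P : Finset (List Q × Bool)}
    (hP : IsPrefixSet P) (r' : Q × Bool → ℕ) :
    A.succCount a (πlast P) r' = {P' | A.IsSucc a P P' ∧ πlast P' = r'}.ncard := by
  obtain ⟨lab, hl⟩ := exists_labVec (πlast P) le_rfl
  obtain ⟨s, hs⟩ := exists_presents hP hl.symm
  rw [hs.ncard_succ, ← succCount_eq_ncard A a (by rw [hl]; exact hP.πlast_ne_zero), hl]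

theorem IsSucc.isPrefixSet {A : NBA Q S} {a : S} {P P' : Finset (List Q × Bool)}
    (hP : IsPrefixSet P) (h : A.IsSucc a P P') : IsPrefixSet P' := by
  obtain ⟨x, hx⟩ := hP.1
  obtain ⟨y, hy, -⟩ := h.1 x hx
  refine ⟨⟨y, hy⟩, fun y hy => ?_, fun y hy z hz e => ?_⟩
  · obtain ⟨x, -, p, q, -, -, rfl⟩ := h.2 y hy
    simp
  · obtain ⟨x, hx, p, q, hp, -, rfl⟩ := h.2 y hy
    obtain ⟨x', hx', p', q', hp', -, rfl⟩ := h.2 z hz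
    obtain ⟨e1, e2⟩ := List.append_inj' e rfl
    obtain rfl := hP.2.2 hx hx' e1
    rw [hp, Option.some.injEq] at hp'
    subst hp'
    simp at e2
    rw [e2]

theorem sum_πlast [Fintype Q] {P : Finset (List Q × Bool)} (hP : IsPrefixSet P) :
    ∑ y, πlast P y = P.card := by
  obtain ⟨lab, hl⟩ := exists_labVec (πlast P) le_rfl
  classical
  have : ∀ x ∈ P, ((fun x : List Q × Bool => x.1.getLast?.map fun q => (q, x.2)) x) ∈
      (Finset.univ : Finset (Q × Bool)).image some := by
    intro x hx
    rcases e : x.1.getLast? with _ | q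
    · exact absurd (List.getLast?_eq_none_iff.1 e) (hP.2.1 x hx)
    · simp [e]
  rw [Finset.card_eq_sum_card_fiberwise this,
    Finset.sum_image fun _ _ _ _ h => Option.some.inj h]
  refine Finset.sum_congr rfl fun y _ => ?_
  rw [πlast]
  congr 1
  ext x
  simp only [Finset.mem_filter, Option.map_eq_some_iff, and_congr_right_iff]
  intro _
  constructor
  · rintro ⟨h1, h2⟩
    exact ⟨y.1, h1, by rw [h2]⟩
  · rintro ⟨q, h1, rfl⟩
    exact ⟨h1, rfl⟩

end NBA

namespace NBA

variable {Q S : Type*}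

/-! ### Vectors on lassos have size at most the ambiguity; the number of states. -/

/-! ### The graph of all vectors -/

/-- An edge of the disambiguation, between vectors with arbitrary entries. -/
def VecEdge (A : NBA Q S) (r r' : Q × Bool → ℕ) : Prop := ∃ a, A.succCount a r r' ≠ 0

/-- An initial vector. -/
def VecInit (A : NBA Q S) (r : Q × Bool → ℕ) : Prop :=
  r ≠ 0 ∧ ∀ q b, (q ∉ A.init ∨ b = true → r (q, b) = 0) ∧ r (q, b) ≤ 1

/-- A final vector. -/
def VecFinal (r : Q × Bool → ℕ) : Prop := r ≠ 0 ∧ ∀ q, r (q, false) = 0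

theorem exists_dep_seq {X : Type*} {G : ℕ → X → Prop} {R : ℕ → X → X → Prop} {x : X} (hx : G 0 x)
    (h : ∀ i y, G i y → ∃ z, G (i + 1) z ∧ R i y z) :
    ∃ f : ℕ → X, f 0 = x ∧ (∀ i, G i (f i)) ∧ ∀ i, R i (f i) (f (i + 1)) := by
  choose! g hg using h
  have hG : ∀ i, G i (Nat.rec x g i : X) := by
    intro i
    induction i with
    | zero => exact hx
    | succ i ih => exact (hg i _ ih).1
  exact ⟨fun i => Nat.rec x g i, rfl, hG, fun i => (hg i _ (hG i)).2⟩

/-- The prefix `s` is a nonempty prefix, of length `i + 1`, of a path over `w`. -/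
def IsPathPrefix (A : NBA Q S) (w : ℕ → S) (i : ℕ) (s : List Q) : Prop :=
  s.length = i + 1 ∧ (∀ q, s[0]? = some q → q ∈ A.init) ∧
    ∀ j p q, s[j]? = some p → s[j + 1]? = some q → q ∈ A.δ p (w j)

theorem IsPathPrefix.append {A : NBA Q S} {w : ℕ → S} {i : ℕ} {s : List Q}
    (h : A.IsPathPrefix w i s) {p q : Q} (hp : s.getLast? = some p) (hq : q ∈ A.δ p (w i)) :
    A.IsPathPrefix w (i + 1) (s ++ [q]) := by
  obtain ⟨h1, h2, h3⟩ := h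
  refine ⟨by simp [h1], fun q' hq' => h2 q' ?_, fun j p' q' hp' hq' => ?_⟩
  · rwa [List.getElem?_append_left (by omega)] at hq'
  · have hj : j + 1 < i + 2 := by
      have := (List.getElem?_eq_some_iff.1 hq').1
      simpa [h1] using this
    rw [List.getElem?_append_left (by omega)] at hp'
    rcases Nat.lt_or_ge (j + 1) (i + 1) with h | h
    · rw [List.getElem?_append_left (by omega)] at hq'
      exact h3 j p' q' hp' hq'
    · have : j = i := by omega
      subst this
      rw [List.getElem?_append_right (by omega), h1] at hq'
      simp at hq'
      rw [List.getLast?_eq_getElem?, h1, Nat.add_sub_cancel, hp', Option.some.injEq] at hp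
      subst hp
      subst hq'
      exact hq

theorem exists_initial_set [Fintype Q] (A : NBA Q S) (w : ℕ → S) {r : Q × Bool → ℕ}
    (h : A.VecInit r) : ∃ P, IsPrefixSet P ∧ πlast P = r ∧ ∀ x ∈ P, A.IsPathPrefix w 0 x.1 := by
  classical
  obtain ⟨h0, h⟩ := h
  let lab : Q → Option (Q × Bool) := fun q => if r (q, false) = 0 then none else some (q, false)
  let P : Finset (List Q × Bool) := (Finset.univ.filter fun q => r (q, false) ≠ 0).image
    fun q => ([q], false)
  have hmem : ∀ x, x ∈ P ↔ ∃ q, r (q, false) ≠ 0 ∧ x = ([q], false) := by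
    intro x
    simp [P, eq_comm]
  have hlab : ∀ q y, lab q = some y ↔ r (q, false) ≠ 0 ∧ y = (q, false) := by
    intro q y
    simp only [lab]
    split_ifs with hq <;> simp [hq, eq_comm]
  have hP : Presents P lab fun q => [q] := by
    refine ⟨fun q y hq => ?_, fun p q y z _ _ e => by simpa using e, fun x => ?_⟩
    · obtain ⟨-, rfl⟩ := (hlab q y).1 hq
      rfl
    · rw [hmem]
      constructor
      · rintro ⟨q, hq, rfl⟩
        exact ⟨q, (q, false), (hlab q (q, false)).2 ⟨hq, rfl⟩, rfl⟩
      · rintro ⟨q, z, hq, rfl⟩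
        obtain ⟨h1, rfl⟩ := (hlab q z).1 hq
        exact ⟨q, h1, rfl⟩
  have hr : labVec lab = r := by
    funext ⟨q, b⟩
    have e : (Finset.univ.filter fun p => lab p = some (q, b)) =
        if r (q, b) = 0 then ∅ else {q} := by
      ext p
      simp only [Finset.mem_filter, Finset.mem_univ, true_and, hlab, Prod.mk.injEq]
      rcases b with _ | _
      · split_ifs with h1
        · simp only [Finset.notMem_empty, iff_false]
          rintro ⟨h2, rfl, -⟩
          exact h2 h1
        · simp only [Finset.mem_singleton]
          constructor
          · rintro ⟨-, rfl, -⟩; rfl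
          · rintro rfl; exact ⟨h1, rfl, trivial⟩
      · simp [(h q true).1 (Or.inr rfl)]
    rw [labVec, e]
    have := (h q b).2
    split_ifs with h1
    · simp [h1]
    · simp; omega
  refine ⟨P, ⟨?_, ?_, ?_⟩, hP.πlast_eq.trans hr, ?_⟩
  · obtain ⟨⟨q, b⟩, hq⟩ := Function.ne_iff.1 h0
    rcases b with _ | _
    · exact ⟨_, (hmem _).2 ⟨q, hq, rfl⟩⟩
    · exact absurd ((h q true).1 (Or.inr rfl)) hq
  · intro x hx
    obtain ⟨q, -, rfl⟩ := (hmem x).1 hx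
    simp
  · intro x hx y hy e
    obtain ⟨q, -, rfl⟩ := (hmem x).1 hx
    obtain ⟨p, -, rfl⟩ := (hmem y).1 hy
    dsimp only at e
    rw [e]
  · intro x hx
    obtain ⟨q, hq, rfl⟩ := (hmem x).1 hx
    refine ⟨rfl, fun p hp => ?_, fun j p p' _ h' => by simp at h'⟩
    simp at hp
    subst hp
    by_contra hn
    exact hq ((h q false).1 (Or.inl hn))

/-- The central estimate. The vector is the image of a set of prefixes over a word spelled by the
lasso, each prefix continues to a final path, and ambiguity bounds the number of these paths. -/
theorem sum_le_of_onLasso [Fintype Q] {A : NBA Q S} {k : ℕ} (hA : A.IsAmbiguous k)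
    {r : Q × Bool → ℕ} (hr : OnLasso A.VecEdge A.VecInit VecFinal r) : ∑ y, r y ≤ k := by
  classical
  obtain ⟨ρ, t, h0, rfl, hE, hF⟩ := hr.exists_seq
  choose w hw using hE
  obtain ⟨P₀, hP₀, hP₀', hpre⟩ := A.exists_initial_set w h0
  -- An edge has a nonzero count for every set with the given vector, so the vector sequence lifts
  -- step by step to sets of path prefixes.
  obtain ⟨P, -, hG, hS⟩ := exists_dep_seq
    (G := fun i P => IsPrefixSet P ∧ πlast P = ρ i ∧ ∀ x ∈ P, A.IsPathPrefix w i x.1)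
    (R := fun i P P' => A.IsSucc (w i) P P') ⟨hP₀, hP₀', hpre⟩ (by
      rintro i P ⟨h1, h2, h3⟩
      have := hw i
      rw [← h2, A.succCount_eq_of_πlast _ h1] at this
      obtain ⟨P', h4, h5⟩ := Set.nonempty_of_ncard_ne_zero this
      refine ⟨P', ⟨h4.isPrefixSet h1, h5, fun y hy => ?_⟩, h4⟩
      obtain ⟨x, hx, p, q, hp, hq, rfl⟩ := h4.2 y hy
      exact (h3 x hx).append hp hq)
  -- A successor contains an extension of every element, so no element dies out.
  have hthread : ∀ x ∈ P t, ∃ y : ℕ → List Q × Bool, y 0 = x ∧ (∀ i, y i ∈ P (t + i)) ∧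
      ∀ i, A.Extends (w (t + i)) (P (t + i)) (y i) (y (i + 1)) := fun x hx =>
    exists_dep_seq (G := fun i y => y ∈ P (t + i)) hx fun i y hy => (hS (t + i)).1 y hy
  have hpath : ∀ x ∈ P t, ∃ π ∈ A.finalPaths w, ∀ j ≤ t, x.1[j]? = some (π j) := by
    intro x hx
    obtain ⟨y, rfl, hy, hyE⟩ := hthread x hx
    have hpp : ∀ i, A.IsPathPrefix w (t + i) (y i).1 := fun i => (hG (t + i)).2.2 _ (hy i)
    have hmono : ∀ i j, i ≤ j → (y i).1 <+: (y j).1 := by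
      intro i j hij
      induction j, hij using Nat.le_induction with
      | base => exact List.prefix_rfl
      | succ j _ ih =>
        obtain ⟨p, q, -, -, e⟩ := hyE j
        rw [e]
        exact ih.trans (List.prefix_append _ _)
    have hget : ∀ j, ∃ q, (y j).1[j]? = some q := fun j =>
      ⟨_, List.getElem?_eq_getElem (by rw [(hpp j).1]; omega)⟩
    choose π hπ using hget
    have hπ' : ∀ i j, j ≤ t + i → (y i).1[j]? = some (π j) := by
      intro i j hj
      rcases le_total i j with h | h
      · rw [← hπ j]
        obtain ⟨u, hu⟩ := hmono i j h
        rw [← hu, List.getElem?_append_left (by rw [(hpp i).1]; omega)]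
      · obtain ⟨u, hu⟩ := hmono j i h
        rw [← hu, List.getElem?_append_left (by rw [(hpp j).1]; omega), hπ j]
    have hlast : ∀ i, (y i).1.getLast? = some (π (t + i)) := fun i => by
      rw [List.getLast?_eq_getElem?, (hpp i).1, Nat.add_sub_cancel, hπ' i _ le_rfl]
    refine ⟨π, ⟨⟨?_, fun i => ?_⟩, ?_⟩, fun j hj => hπ' 0 j (by omega)⟩
    · exact (hpp 0).2.1 _ (hπ' 0 0 (by omega))
    · exact (hpp (i + 1)).2.2 i _ _ (hπ' (i + 1) i (by omega)) (hπ' (i + 1) (i + 1) (by omega))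
    · have hbits : ∀ i, VecFinal (ρ (t + i)) → ∀ z ∈ P (t + i), z.2 = true := by
        intro i hi z hz
        by_contra hb
        obtain ⟨q, hq⟩ : ∃ q, z.1.getLast? = some q := by
          rcases e : z.1.getLast? with _ | q
          · exact absurd (List.getLast?_eq_none_iff.1 e) ((hG _).1.2.1 z hz)
          · exact ⟨q, rfl⟩
        have h1 := hi.2 q
        rw [← (hG (t + i)).2.1, πlast, Finset.card_eq_zero] at h1
        exact Finset.notMem_empty z (h1 ▸ Finset.mem_filter.2 ⟨hz, hq, by simpa using hb⟩)
      have hfin : ∀ n, ∃ i ≥ n, VecFinal (ρ (t + i)) := by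
        intro n
        obtain ⟨i, hi, h⟩ := hF (t + n)
        exact ⟨i - t, by omega, by rwa [show t + (i - t) = i by omega]⟩
      have hfreq : ∃ᶠ i in atTop, ∃ q ∈ A.final, π i = q := by
        rw [Filter.frequently_atTop]
        intro N
        by_contra hcon
        push Not at hcon
        obtain ⟨i, hi, h1⟩ := hfin N
        -- At the final vector of index `i` all bits are ⊤, so the next bits are ⊥; without a visit
        -- to `A.final` the bit of the thread stays ⊥, contradicting the next final vector.
        have hfalse : ∀ j, i + 1 ≤ j → (y j).2 = false := by
          intro j hj
          induction j, hj using Nat.le_induction with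
          | base =>
            obtain ⟨p, q, -, -, e⟩ := hyE i
            rw [e]
            simp only [decide_eq_false_iff_not, not_and, not_not]
            exact fun _ => hbits i h1
          | succ j hj ih =>
            obtain ⟨p, q, hp, -, e⟩ := hyE j
            rw [e]
            simp only [decide_eq_false_iff_not, not_and]
            intro h
            rw [hlast j, Option.some.injEq] at hp
            subst hp
            rcases h with h | h
            · exact absurd rfl (hcon (t + j) (by omega) _ h)
            · rw [ih] at h; cases h
        obtain ⟨j, hj, h2⟩ := hfin (i + 1)
        have := hbits j h2 _ (hy j)
        rw [hfalse j hj] at this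
        cases this
      by_contra hcon
      push Not at hcon
      refine hfreq ?_
      -- Finiteness of `Q` enters here: if each final state occurs only finitely often, so does the
      -- set of final states.
      have : ∀ᶠ i in atTop, ∀ q, q ∈ A.final → π i ≠ q :=
        Filter.eventually_all.2 fun q => by
          by_cases hq : q ∈ A.final
          · filter_upwards [hcon q hq] with i hi _ using hi
          · exact Filter.Eventually.of_forall fun i h => absurd h hq
      filter_upwards [this] with i hi
      rintro ⟨q, hq, e⟩
      exact hi q hq e
  rcases (hG t).1.1 with ⟨x₀, hx₀⟩
  have : Nonempty (ℕ → Q) := ⟨(hpath x₀ hx₀).choose⟩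
  choose! g hg using hpath
  rw [← (hG t).2.1, sum_πlast (hG t).1]
  -- Elements of `P t` are initial segments of the same length, so equal paths have equal prefixes;
  -- the bit is then determined by the prefix.
  have hcard : ((P t : Set (List Q × Bool))).encard ≤ (A.finalPaths w).encard := by
    refine Set.encard_le_encard_of_injOn (f := g) (fun x hx => (hg x hx).1) ?_
    intro x hx z hz e
    refine (hG t).1.2.2 hx hz (List.ext_getElem? fun j => ?_)
    rcases Nat.lt_or_ge t j with h | h
    · rw [List.getElem?_eq_none (by rw [((hG t).2.2 x hx).1]; omega),
        List.getElem?_eq_none (by rw [((hG t).2.2 z hz).1]; omega)]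
    · rw [(hg x hx).2 j h, (hg z hz).2 j h, e]
  have := hcard.trans (hA w)
  rw [Set.encard_coe_eq_coe_finsetCard] at this
  exact_mod_cast this

/-! ### The states of the disambiguation -/

theorem VecEdge.ne_zero [Fintype Q] {A : NBA Q S} {r r' : Q × Bool → ℕ} (h : A.VecEdge r r') :
    r ≠ 0 ∧ r' ≠ 0 := by
  obtain ⟨a, h⟩ := h
  have hex : ∃ P : Finset (List Q × Bool), IsPrefixSet P ∧ πlast P = r := by
    by_contra hn
    rw [succCount, dif_neg hn] at h
    exact h rfl
  obtain ⟨P, hP, rfl⟩ := hex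
  rw [succCount_eq_of_πlast A a hP] at h
  obtain ⟨P', h1, rfl⟩ := Set.nonempty_of_ncard_ne_zero h
  exact ⟨hP.πlast_ne_zero, (h1.isPrefixSet hP).πlast_ne_zero⟩

theorem vec_ne_zero_of_onLasso [Fintype Q] {A : NBA Q S} {r : Q × Bool → ℕ}
    (h : OnLasso A.VecEdge A.VecInit VecFinal r) : r ≠ 0 := by
  obtain ⟨⟨p, hp, hpr⟩, -⟩ := h
  rcases hpr.cases_tail with rfl | ⟨c, -, hc⟩
  · exact hp.1
  · exact hc.ne_zero.2

theorem KVec.toNat_ne_zero {k : ℕ} (r : KVec k Q) : r.toNat ≠ 0 := by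
  intro h
  refine r.2 (funext fun y => Fin.ext ?_)
  exact congrFun h y

theorem KVec.toNat_injective {k : ℕ} : Function.Injective (KVec.toNat (k := k) (Q := Q)) := by
  intro r r' h
  exact Subtype.ext (funext fun y => Fin.ext (congrFun h y))

theorem exists_toNat_eq {k : ℕ} {r : Q × Bool → ℕ} (h0 : r ≠ 0) (h : ∀ y, r y ≤ k) :
    ∃ v : KVec k Q, v.toNat = r := by
  refine ⟨⟨fun y => ⟨r y, Nat.lt_succ_of_le (h y)⟩, fun h' => h0 (funext fun y => ?_)⟩, rfl⟩
  exact congrArg Fin.val (congrFun h' y)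

/-- The right-hand side does not involve `k`: lasso vectors have entries at most `k` anyway. This is
what allows the machine to work with a larger bound without knowing `k`. -/
theorem mem_trimStates_iff [Fintype Q] {A : NBA Q S} {k : ℕ} (hA : A.IsAmbiguous k)
    (r : KVec k Q) :
    r ∈ (A.kdis' k).trimStates ↔ OnLasso A.VecEdge A.VecInit VecFinal r.toNat := by
  have := onLasso_iff (E := A.VecEdge) (I := A.VecInit) (F := VecFinal)
    (E' := (A.kdis' k).Edge) (I' := fun r => (A.kdis' k).α r ≠ 0)
    (F' := fun r => r ∈ (A.kdis' k).final) (φ := KVec.toNat) (N := fun _ => True)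
    (KVec.toNat_injective.injOn) ?_ ?_ ?_ ?_ r
  · rw [true_and] at this
    exact this
  · intro r r'
    simp only [WBA.Edge, VecEdge, kdis', true_and, Matrix.of_apply]
    refine exists_congr fun a => ?_
    rw [mul_ne_zero_iff, Nat.cast_ne_zero]
    exact and_iff_right (zpow_ne_zero _ (by norm_num))
  · intro r
    simp only [kdis', VecInit, true_and, r.toNat_ne_zero, ne_eq, not_false_iff]
    split_ifs with h
    · exact iff_of_true (pow_ne_zero _ (by norm_num)) h
    · exact iff_of_false (by simp) h
  · intro r
    have := r.toNat_ne_zero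
    simp only [kdis', VecFinal, true_and, this, ne_eq, not_false_iff]
    rfl
  · intro r hr
    have hs := sum_le_of_onLasso hA hr
    obtain ⟨v, hv⟩ := exists_toNat_eq (k := k) (vec_ne_zero_of_onLasso hr) fun y =>
      (Finset.single_le_sum (fun _ _ => Nat.zero_le _) (Finset.mem_univ y)).trans hs
    exact ⟨v, trivial, hv⟩

/-- A state is determined by a labelling of `k` slots with `2n` labels or none. -/
theorem card_kdisState_le [Fintype Q] {A : NBA Q S} {k : ℕ} (hA : A.IsAmbiguous k) :
    Nat.card (A.KdisState k) ≤ (2 * Fintype.card Q + 1) ^ k := by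
  classical
  have h : ∀ r : A.KdisState k, ∃ lab : Fin k → Option (Q × Bool), labVec lab = r.1.toNat :=
    fun r => exists_labVec _ (sum_le_of_onLasso hA ((mem_trimStates_iff hA r.1).1 r.2))
  choose f hf using h
  have hinj : Function.Injective f := fun r r' e =>
    Subtype.ext (KVec.toNat_injective (by rw [← hf, ← hf, e]))
  refine (Nat.card_le_card_of_injective f hinj).trans ?_
  rw [Nat.card_eq_fintype_card]
  simp [mul_comm]

end NBA

theorem exists_card_kdisState_le (κ : ℕ → ℕ)
    (hκ : (fun n : ℕ => (κ n : ℝ)) =O[atTop] fun n : ℕ => Real.log n) :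
    ∃ g : ℕ → ℝ, (g =O[atTop] fun n : ℕ => Real.log n) ∧
      ∀ (Q S : Type*) [Fintype Q] (A : NBA Q S) (k : ℕ),
        k ≤ κ (Fintype.card Q) → A.IsAmbiguous k →
        (Nat.card (A.KdisState k) : ℝ) ≤
          (2 * (Fintype.card Q : ℝ)) ^ g (Fintype.card Q) := by
  refine ⟨fun n => 2 * (κ n : ℝ), hκ.const_mul_left 2, fun Q S _ A k hk hA => ?_⟩
  set n := Fintype.card Q with hn
  rcases Nat.eq_zero_or_pos n with h0 | h0
  · have : IsEmpty Q := Fintype.card_eq_zero_iff.1 (hn ▸ h0)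
    have : IsEmpty (A.KdisState k) := ⟨fun r => r.1.2 (Subsingleton.elim _ _)⟩
    rw [Nat.card_of_isEmpty]
    exact_mod_cast Real.rpow_nonneg (by positivity) _
  · have h1 : (2 * n + 1) ^ k ≤ (2 * n) ^ (2 * κ n) := by
      calc (2 * n + 1) ^ k ≤ ((2 * n) ^ 2) ^ k := Nat.pow_le_pow_left (by nlinarith) k
        _ = (2 * n) ^ (2 * k) := (pow_mul _ _ _).symm
        _ ≤ _ := Nat.pow_le_pow_right (by omega) (by omega)
    have h2 : (Nat.card (A.KdisState k) : ℝ) ≤ ((2 * n : ℕ) : ℝ) ^ (2 * κ n) := by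
      exact_mod_cast (NBA.card_kdisState_le hA).trans h1
    refine h2.trans_eq ?_
    rw [← Real.rpow_natCast]
    push_cast
    rfl

/-! ### Numerical codes for vectors and successor sets. -/

/-! ### Digits -/

theorem exists_digits {b K : ℕ} (f : Fin K → ℕ) (hf : ∀ i, f i < b) :
    ∃ c < b ^ K, ∀ i : Fin K, c / b ^ (i : ℕ) % b = f i := by
  let g : Fin K → Fin b := fun i => ⟨f i, hf i⟩
  refine ⟨finFunctionFinEquiv g, (finFunctionFinEquiv g).2, fun i => ?_⟩
  exact congrArg Fin.val (congrFun (finFunctionFinEquiv.symm_apply_apply g) i)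

/-- The decoding is not injective, so each element is counted at its least code only. -/
theorem ncard_eq_sum_least {X : Type*} (dec : ℕ → X) {N : ℕ} {T : Set X}
    (hT : ∀ y ∈ T, ∃ c < N, dec c = y) {P : ℕ → Prop} [DecidablePred P]
    (hP : ∀ c, P c ↔ dec c ∈ T ∧ ∀ c' < c, dec c' ≠ dec c) :
    T.ncard = ∑ c ∈ Finset.range N, if P c then 1 else 0 := by
  classical
  rw [← Finset.card_filter]
  have : T = dec '' ((Finset.range N).filter P : Finset ℕ) := by
    ext y
    simp only [Finset.coe_filter, Finset.mem_range, Set.mem_image, Set.mem_ofPred_eq, hP]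
    constructor
    · intro hy
      have hex : ∃ c, c < N ∧ dec c = y := hT y hy
      obtain ⟨h1, h2⟩ := Nat.find_spec hex
      refine ⟨Nat.find hex, ⟨h1, h2.symm ▸ hy, fun c' hc' e => ?_⟩, h2⟩
      exact Nat.find_min hex hc' ⟨hc'.trans h1, e.trans h2⟩
    · rintro ⟨c, ⟨-, h, -⟩, rfl⟩
      exact h
  rw [this, Set.InjOn.ncard_image, Set.ncard_coe_finset]
  intro c hc c' hc' e
  simp only [Finset.coe_filter, Finset.mem_range, Set.mem_ofPred_eq, hP] at hc hc'
  rcases lt_trichotomy c c' with h | h | h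
  · exact absurd e (hc'.2.2 c h)
  · exact h
  · exact absurd e.symm (hc.2.2 c' h)

/-! ### The disambiguation on codes -/

theorem NBA.labVec_ne_zero_iff {Q J : Type*} [Fintype J] {lab : J → Option (Q × Bool)}
    {y : Q × Bool} : labVec lab y ≠ 0 ↔ ∃ i, lab i = some y := by
  classical
  rw [labVec, Finset.card_ne_zero]
  simp [Finset.Nonempty]

theorem NBA.newBit_iff {Q S J : Type*} [Fintype J] (A : NBA Q S) {lab : J → Option (Q × Bool)} {i : J} :
    A.newBit lab i = true ↔ (∃ p b, lab i = some (p, b) ∧ (p ∈ A.final ∨ b = true)) ∧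
      ∃ j p, lab j = some (p, false) := by
  classical
  exact decide_eq_true_iff

/-- A Büchi automaton whose states and letters are numbers, with a bound `K` on the ambiguity. -/
structure AutData where
  /-- the number of states -/
  n : ℕ
  /-- the number of letters -/
  s : ℕ
  /-- the bound on the ambiguity -/
  K : ℕ
  /-- the initial states -/
  ini : ℕ → Prop
  /-- the final states -/
  fin : ℕ → Prop
  /-- the transitions from a state to a state under a letter -/
  tr : ℕ → ℕ → ℕ → Prop

namespace AutData

variable (p : AutData)

/-- The label `i` of the code `c`: `0` for no label, and `2 * q + b + 1` for the pair `(q, b)`. -/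
def lab (c i : ℕ) : ℕ := c / (2 * p.n + 1) ^ i % (2 * p.n + 1)

/-- The bit of the extensions of the prefix `i`. -/
def NewBit (c i : ℕ) : Prop :=
  (∃ j < 2 * p.n, p.lab c i = j + 1 ∧ (p.fin (j / 2) ∨ j % 2 = 1)) ∧
    ∃ i' < p.K, ∃ j < 2 * p.n, p.lab c i' = j + 1 ∧ j % 2 = 0

/-- Entry `t` of the code `e` of a set of pairs. -/
def pair (e t : ℕ) : ℕ := e / (p.K * p.n + 1) ^ t % (p.K * p.n + 1)

/-- The pair of the prefix `i` and the state `q` is in the set with code `e`. -/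
def Mem (e i q : ℕ) : Prop := ∃ t < p.K, p.pair e t = i * p.n + q + 1

open Classical in
/-- The entries of the vector with code `c`. -/
noncomputable def vec (c j : ℕ) : ℕ :=
  ∑ i ∈ Finset.range p.K, if p.lab c i = j + 1 then 1 else 0

open Classical in
/-- The set with code `e` describes a successor of `c` with vector `c'`. -/
def Step (a c c' e : ℕ) : Prop :=
  (∀ i < p.K, ∀ q < p.n, p.Mem e i q → ∃ j < 2 * p.n, p.lab c i = j + 1 ∧ p.tr a (j / 2) q) ∧
  (∀ i < p.K, p.lab c i ≠ 0 → ∃ q < p.n, p.Mem e i q) ∧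
  ∀ j < 2 * p.n, (∑ i ∈ Finset.range p.K,
    if p.Mem e i (j / 2) ∧ (p.NewBit c i ∧ j % 2 = 1 ∨ ¬ p.NewBit c i ∧ j % 2 = 0) then 1 else 0) =
      p.vec c' j

/-- `e` is the least code of its set. -/
def LeastSet (e : ℕ) : Prop :=
  ∀ e' < e, ¬ ∀ i < p.K, ∀ q < p.n,
    (p.Mem e' i q → p.Mem e i q) ∧ (p.Mem e i q → p.Mem e' i q)

open Classical in
/-- The number of successors of `c` with vector `c'`. -/
noncomputable def weight (a c c' : ℕ) : ℕ :=
  ∑ e ∈ Finset.range ((p.K * p.n + 1) ^ p.K), if p.Step a c c' e ∧ p.LeastSet e then 1 else 0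

/-- The number of codes of vectors. -/
def codes : ℕ := (2 * p.n + 1) ^ p.K

/-- `c` is the least code of a nonzero vector. -/
def Node (c : ℕ) : Prop :=
  c < p.codes ∧ (∃ i < p.K, p.lab c i ≠ 0) ∧ ∀ c' < c, ¬ ∀ j < 2 * p.n, p.vec c' j = p.vec c j

/-- The edges between codes. -/
def Edge (c c' : ℕ) : Prop := p.Node c ∧ p.Node c' ∧ ∃ a < p.s, p.weight a c c' ≠ 0

/-- The codes of initial vectors. -/
def Init (c : ℕ) : Prop :=
  p.Node c ∧ ∀ j < 2 * p.n, (¬ p.ini (j / 2) ∨ j % 2 = 1 → p.vec c j = 0) ∧ p.vec c j ≤ 1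

/-- The codes of final vectors. -/
def Final (c : ℕ) : Prop := p.Node c ∧ ∀ q < p.n, p.vec c (2 * q) = 0

/-- The codes of the states that are left after trimming. -/
def Kept (c : ℕ) : Prop := OnLasso p.Edge p.Init p.Final c

/-- The sum of the entries. -/
noncomputable def size (c : ℕ) : ℕ := ∑ j ∈ Finset.range (2 * p.n), p.vec c j

/-! #### Their meaning -/

/-- The number of a pair. -/
def idx {n : ℕ} (y : Fin n × Bool) : ℕ := 2 * y.1 + y.2.toNat

theorem idx_lt {n : ℕ} (y : Fin n × Bool) : idx y < 2 * n := by
  obtain ⟨⟨q, hq⟩, b⟩ := y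
  cases b <;> simp [idx] <;> omega

theorem idx_div {n : ℕ} (y : Fin n × Bool) : idx y / 2 = y.1 := by
  have := y.2.toNat_lt
  unfold idx
  omega

theorem idx_mod {n : ℕ} (y : Fin n × Bool) : idx y % 2 = y.2.toNat := by
  have := y.2.toNat_lt
  unfold idx
  omega

theorem idx_injective {n : ℕ} : Function.Injective (idx (n := n)) := by
  intro y z h
  have h1 : (y.1 : ℕ) = z.1 := by rw [← idx_div, ← idx_div, h]
  have h2 : y.2.toNat = z.2.toNat := by rw [← idx_mod, ← idx_mod, h]
  exact Prod.ext (Fin.ext h1) (by revert h2; cases y.2 <;> cases z.2 <;> simp)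

theorem exists_idx {n j : ℕ} (hj : j < 2 * n) : ∃ y : Fin n × Bool, idx y = j := by
  refine ⟨(⟨j / 2, by omega⟩, decide (j % 2 = 1)), ?_⟩
  rcases Nat.mod_two_eq_zero_or_one j with h | h <;> simp only [idx, h] <;> simp <;> omega

theorem exists_lt_iff {n : ℕ} {P : ℕ → Prop} :
    (∃ j < 2 * n, P j) ↔ ∃ y : Fin n × Bool, P (idx y) :=
  ⟨fun ⟨_, hj, h⟩ => let ⟨y, e⟩ := exists_idx hj; ⟨y, e.symm ▸ h⟩,
    fun ⟨y, h⟩ => ⟨_, idx_lt y, h⟩⟩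

theorem forall_lt_iff {n : ℕ} {P : ℕ → Prop} :
    (∀ j < 2 * n, P j) ↔ ∀ y : Fin n × Bool, P (idx y) :=
  ⟨fun h y => h _ (idx_lt y), fun h _ hj => let ⟨y, e⟩ := exists_idx hj; e ▸ h y⟩

theorem sum_range_eq {n : ℕ} (f : ℕ → ℕ) :
    ∑ j ∈ Finset.range (2 * n), f j = ∑ y : Fin n × Bool, f (idx y) := by
  symm
  refine Finset.sum_bij (fun y _ => idx y) (fun y _ => Finset.mem_range.2 (idx_lt y))
    (fun _ _ _ _ h => idx_injective h) (fun j hj => ?_) fun _ _ => rfl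
  obtain ⟨y, hy⟩ := exists_idx (Finset.mem_range.1 hj)
  exact ⟨y, Finset.mem_univ _, hy⟩

theorem card_filter_fin {n : ℕ} {P : ℕ → Prop} {_ : DecidablePred P} {R : Fin n → Prop}
    {_ : DecidablePred R} (h : ∀ i : Fin n, R i ↔ P i) :
    (Finset.univ.filter R).card = ∑ i ∈ Finset.range n, if P i then 1 else 0 := by
  rw [Finset.sum_range, Finset.card_filter]
  exact Finset.sum_congr rfl fun i _ => if_congr (h i) rfl rfl

open Classical in
/-- The labels with code `c`. -/
noncomputable def labOf (c : ℕ) (i : Fin p.K) : Option (Fin p.n × Bool) :=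
  if h : ∃ y : Fin p.n × Bool, p.lab c i = idx y + 1 then some h.choose else none

theorem labOf_eq_some {c : ℕ} {i : Fin p.K} {y : Fin p.n × Bool} :
    p.labOf c i = some y ↔ p.lab c i = idx y + 1 := by
  unfold labOf
  split_ifs with h
  · have := h.choose_spec
    rw [Option.some.injEq]
    constructor
    · rintro rfl; exact this
    · intro e
      exact (idx_injective (Nat.succ_injective (e.symm.trans this))).symm
  · simp only [false_iff]
    exact fun e => h ⟨y, e⟩

theorem labOf_ne_none {c : ℕ} {i : Fin p.K} : p.labOf c i ≠ none ↔ p.lab c i ≠ 0 := by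
  constructor
  · intro h
    obtain ⟨y, hy⟩ := Option.ne_none_iff_exists'.1 h
    rw [p.labOf_eq_some.1 hy]
    omega
  · intro h
    have hlt : p.lab c i < 2 * p.n + 1 := Nat.mod_lt _ (Nat.succ_pos _)
    obtain ⟨y, hy⟩ := exists_idx (n := p.n) (j := p.lab c i - 1) (by omega)
    have : p.labOf c i = some y := p.labOf_eq_some.2 (by omega)
    simp [this]

/-- The vector with code `c`. -/
noncomputable def vecOf (c : ℕ) : Fin p.n × Bool → ℕ := NBA.labVec (p.labOf c)

theorem vecOf_apply (c : ℕ) (y : Fin p.n × Bool) : p.vecOf c y = p.vec c (idx y) := by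
  classical
  exact card_filter_fin fun i => p.labOf_eq_some

theorem vecOf_eq_iff {c c' : ℕ} :
    p.vecOf c = p.vecOf c' ↔ ∀ j < 2 * p.n, p.vec c j = p.vec c' j := by
  rw [forall_lt_iff (P := fun j => p.vec c j = p.vec c' j), funext_iff]
  simp only [vecOf_apply]

theorem vecOf_ne_zero {c : ℕ} : p.vecOf c ≠ 0 ↔ ∃ i < p.K, p.lab c i ≠ 0 := by
  classical
  constructor
  · intro h
    obtain ⟨y, hy⟩ := Function.ne_iff.1 h
    obtain ⟨i, hi'⟩ := NBA.labVec_ne_zero_iff.1 hy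
    exact ⟨i, i.2, p.labOf_ne_none.1 (by simp [hi'])⟩
  · rintro ⟨i, hi, h⟩ h0
    obtain ⟨y, hy⟩ := Option.ne_none_iff_exists'.1 ((p.labOf_ne_none (i := ⟨i, hi⟩)).2 h)
    exact NBA.labVec_ne_zero_iff.2 ⟨_, hy⟩ (congrFun h0 y)

theorem node_iff {c : ℕ} :
    p.Node c ↔ c < p.codes ∧ p.vecOf c ≠ 0 ∧ ∀ c' < c, p.vecOf c' ≠ p.vecOf c := by
  simp only [Node, vecOf_ne_zero, ne_eq, vecOf_eq_iff]

theorem vecOf_injOn : Set.InjOn p.vecOf {c | p.Node c} := by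
  intro c hc c' hc' e
  rcases lt_trichotomy c c' with h | h | h
  · exact absurd e ((p.node_iff.1 hc').2.2 c h)
  · exact h
  · exact absurd e.symm ((p.node_iff.1 hc).2.2 c' h)

/-- The code consists of the labels of `K` slots as digits in base `2n + 1`. Coding all entries of
the vector separately would take exponentially large numbers. -/
theorem exists_node {r : Fin p.n × Bool → ℕ} (h0 : r ≠ 0) (hr : ∑ y, r y ≤ p.K) :
    ∃ c, p.Node c ∧ p.vecOf c = r := by
  classical
  obtain ⟨lab, rfl⟩ := NBA.exists_labVec r hr
  obtain ⟨c, hc, hl⟩ := exists_digits (b := 2 * p.n + 1) (K := p.K)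
    (fun i => (lab i).elim 0 fun y => idx y + 1) fun i => by
      rcases lab i with _ | y
      · exact Nat.succ_pos _
      · exact Nat.succ_lt_succ (idx_lt y)
  have hex : ∃ c, c < p.codes ∧ p.vecOf c = NBA.labVec lab := by
    refine ⟨c, hc, congrArg NBA.labVec (funext fun i => ?_)⟩
    have hi : p.lab c i = (lab i).elim 0 fun y => idx y + 1 := hl i
    rcases e : lab i with _ | y
    · rw [e] at hi
      by_contra h
      exact p.labOf_ne_none.1 h hi
    · rw [e] at hi
      exact p.labOf_eq_some.2 hi
  obtain ⟨h1, h2⟩ := Nat.find_spec hex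
  refine ⟨Nat.find hex, p.node_iff.2 ⟨h1, by rwa [h2], fun c' hc' e => ?_⟩, h2⟩
  exact Nat.find_min hex hc' ⟨hc'.trans h1, e.trans h2⟩

theorem sum_vecOf_le (c : ℕ) : ∑ y, p.vecOf c y ≤ p.K := by
  classical
  have := Finset.card_biUnion (s := (Finset.univ : Finset (Fin p.n × Bool)))
    (t := fun y => Finset.univ.filter fun i => p.labOf c i = some y) (by
      intro y _ z _ hyz
      refine Finset.disjoint_left.2 fun i hi hi' => hyz ?_
      rw [Finset.mem_filter] at hi hi'
      exact Option.some.inj (hi.2.symm.trans hi'.2))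
  have h2 : ∑ y, p.vecOf c y = ∑ y : Fin p.n × Bool,
      (Finset.univ.filter fun i => p.labOf c i = some y).card :=
    Finset.sum_congr rfl fun y _ => by
      rw [vecOf, NBA.labVec]
      congr
  rw [h2, ← this]
  exact (Finset.card_le_univ _).trans (by simp)

open Classical in
/-- The set of pairs with code `e`. -/
noncomputable def setOf (e : ℕ) : Finset (Fin p.K × Fin p.n) :=
  Finset.univ.filter fun y => p.Mem e y.1 y.2

theorem mem_setOf {e : ℕ} {i : Fin p.K} {q : Fin p.n} : (i, q) ∈ p.setOf e ↔ p.Mem e i q := by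
  simp [setOf]

theorem setOf_eq_iff {e e' : ℕ} : p.setOf e = p.setOf e' ↔ ∀ i < p.K, ∀ q < p.n,
    (p.Mem e i q → p.Mem e' i q) ∧ (p.Mem e' i q → p.Mem e i q) := by
  constructor
  · intro h i hi q hq
    have := (p.mem_setOf (e := e) (i := ⟨i, hi⟩) (q := ⟨q, hq⟩)).symm.trans
      (h ▸ p.mem_setOf (e := e'))
    exact ⟨this.1, this.2⟩
  · intro h
    ext ⟨i, q⟩
    rw [mem_setOf, mem_setOf]
    exact ⟨(h i i.2 q q.2).1, (h i i.2 q q.2).2⟩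

/-- The pairs are listed as `K` digits, with 0 for an unused entry. The restriction to `K` pairs
keeps codes below `(Kn + 1)^K`, whereas characteristic vectors would need `2^(Kn)`. -/
theorem exists_setOf (E : Finset (Fin p.K × Fin p.n)) (hE : E.card ≤ p.K) :
    ∃ e < (p.K * p.n + 1) ^ p.K, p.setOf e = E := by
  classical
  have hlt : ∀ y : Fin p.K × Fin p.n, (y.1 : ℕ) * p.n + y.2 < p.K * p.n := by
    rintro ⟨⟨i, hi⟩, ⟨q, hq⟩⟩
    calc i * p.n + q < (i + 1) * p.n := by rw [add_mul]; omega
      _ ≤ _ := Nat.mul_le_mul_right _ hi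
  have hinj : ∀ y z : Fin p.K × Fin p.n,
      (y.1 : ℕ) * p.n + y.2 = (z.1 : ℕ) * p.n + z.2 → y = z := by
    rintro ⟨i, q⟩ ⟨j, r⟩ h
    have hn : 0 < p.n := q.pos
    have h1 := congrArg (· / p.n) h
    have h2 := congrArg (· % p.n) h
    simp only [mul_comm _ p.n, Nat.mul_add_div hn, Nat.div_eq_of_lt q.2, Nat.div_eq_of_lt r.2,
      add_zero, Nat.mul_add_mod, Nat.mod_eq_of_lt q.2, Nat.mod_eq_of_lt r.2] at h1 h2
    exact Prod.ext (Fin.ext h1) (Fin.ext h2)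
  let f := E.equivFin
  obtain ⟨e, he, hd⟩ := exists_digits (b := p.K * p.n + 1) (K := p.K)
    (fun t => if h : (t : ℕ) < E.card then
      ((f.symm ⟨t, h⟩).1.1 : ℕ) * p.n + (f.symm ⟨t, h⟩).1.2 + 1 else 0) fun t => by
      split_ifs with h
      · exact Nat.succ_lt_succ (hlt _)
      · exact Nat.succ_pos _
  refine ⟨e, he, ?_⟩
  ext ⟨i, q⟩
  rw [mem_setOf]
  constructor
  · rintro ⟨t, ht, h⟩
    have h1 := hd ⟨t, ht⟩
    rw [← pair, h] at h1
    split_ifs at h1 with h2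
    rw [hinj (i, q) _ (Nat.succ_injective h1)]
    exact (f.symm ⟨t, h2⟩).2
  · intro h
    refine ⟨f ⟨(i, q), h⟩, (f ⟨(i, q), h⟩).2.trans_le hE, ?_⟩
    have h1 := hd ⟨f ⟨(i, q), h⟩, (f ⟨(i, q), h⟩).2.trans_le hE⟩
    rw [pair, h1]
    simp

/-- The numbers describe the automaton `A`. -/
structure Describes (A : NBA (Fin p.n) (Fin p.s)) : Prop where
  ini : ∀ q : Fin p.n, p.ini q ↔ q ∈ A.init
  fin : ∀ q : Fin p.n, p.fin q ↔ q ∈ A.final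
  tr : ∀ (a : Fin p.s) (q q' : Fin p.n), p.tr a q q' ↔ q' ∈ A.δ q a

variable {p} {A : NBA (Fin p.n) (Fin p.s)}

theorem Describes.newBit (h : p.Describes A) (c : ℕ) (i : Fin p.K) :
    A.newBit (p.labOf c) i = true ↔ p.NewBit c i := by
  rw [NBA.newBit_iff, NewBit, exists_lt_iff
    (P := fun j => p.lab c i = j + 1 ∧ (p.fin (j / 2) ∨ j % 2 = 1))]
  refine and_congr ?_ ?_
  · rw [Prod.exists]
    refine exists_congr fun q => exists_congr fun b => ?_
    rw [labOf_eq_some, idx_div, idx_mod, h.fin]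
    cases b <;> simp
  · constructor
    · rintro ⟨j, q, hj⟩
      exact ⟨j, j.2, _, idx_lt (q, false), p.labOf_eq_some.1 hj, idx_mod _⟩
    · rintro ⟨i', hi', j, hj, h1, h2⟩
      obtain ⟨⟨q, b⟩, rfl⟩ := exists_idx hj
      rw [idx_mod] at h2
      cases b
      · exact ⟨⟨i', hi'⟩, q, p.labOf_eq_some.2 h1⟩
      · simp at h2

theorem Describes.isStep_iff (h : p.Describes A) (a : Fin p.s) (c c' e : ℕ) :
    A.IsStep a (p.labOf c) (p.vecOf c') (p.setOf e) ↔ p.Step a c c' e := by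
  classical
  refine and_congr ?_ (and_congr ?_ ?_)
  · constructor
    · intro h1 i hi q hq hm
      obtain ⟨r, b, h2, h3⟩ := h1 ⟨i, hi⟩ ⟨q, hq⟩ (p.mem_setOf.2 hm)
      refine ⟨_, idx_lt (r, b), p.labOf_eq_some.1 h2, ?_⟩
      rw [idx_div]
      exact (h.tr a r ⟨q, hq⟩).2 h3
    · intro h1 i q hm
      obtain ⟨j, hj, h2, h3⟩ := h1 i i.2 q q.2 (p.mem_setOf.1 hm)
      obtain ⟨⟨r, b⟩, rfl⟩ := exists_idx hj
      rw [idx_div] at h3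
      exact ⟨r, b, p.labOf_eq_some.2 h2, (h.tr a r q).1 h3⟩
  · constructor
    · intro h1 i hi hl
      obtain ⟨q, hq⟩ := h1 ⟨i, hi⟩ (p.labOf_ne_none.2 hl)
      exact ⟨q, q.2, p.mem_setOf.1 hq⟩
    · intro h1 i hi
      obtain ⟨q, hq, hm⟩ := h1 i i.2 (p.labOf_ne_none.1 hi)
      exact ⟨⟨q, hq⟩, p.mem_setOf.2 hm⟩
  · rw [forall_lt_iff (P := fun j => (∑ i ∈ Finset.range p.K, if p.Mem e i (j / 2) ∧
      (p.NewBit c i ∧ j % 2 = 1 ∨ ¬ p.NewBit c i ∧ j % 2 = 0) then 1 else 0) = p.vec c' j),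
      Prod.forall]
    refine forall_congr' fun q => forall_congr' fun b => ?_
    rw [vecOf_apply]
    refine Eq.congr_left (card_filter_fin fun i => ?_)
    rw [mem_setOf, idx_div, idx_mod, ← h.newBit]
    cases b <;> cases A.newBit (p.labOf c) i <;> simp

/-- Each pair contributes 1 to exactly one entry of the successor vector, whose total is at most
`K`. So every set counted by `weight` has a code. -/
theorem card_le_of_isStep {a : Fin p.s} {c c' : ℕ} {E : Finset (Fin p.K × Fin p.n)}
    (h : A.IsStep a (p.labOf c) (p.vecOf c') E) : E.card ≤ p.K := by
  classical
  refine le_of_eq_of_le ?_ (p.sum_vecOf_le c')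
  rw [Finset.card_eq_sum_card_fiberwise (f := fun y => (y.2, A.newBit (p.labOf c) y.1))
    (t := Finset.univ) fun _ _ => Finset.mem_coe.2 (Finset.mem_univ _)]
  refine Finset.sum_congr rfl fun ⟨q, b⟩ _ => ?_
  rw [← h.2.2 q b]
  refine Finset.card_bij (fun y _ => y.1) ?_ ?_ ?_
  · rintro ⟨i, q'⟩ hy
    simp only [Finset.mem_filter, Prod.mk.injEq] at hy
    obtain ⟨h1, rfl, h2⟩ := hy
    simp [h1, h2]
  · rintro ⟨i, q'⟩ hy ⟨j, r⟩ hz e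
    simp only [Finset.mem_filter, Prod.mk.injEq] at hy hz
    exact Prod.ext e (hy.2.1.trans hz.2.1.symm)
  · intro i hi
    simp only [Finset.mem_filter, Finset.mem_univ, true_and] at hi
    exact ⟨(i, q), by simp [hi], rfl⟩

theorem Describes.weight_eq (h : p.Describes A) (a : Fin p.s) {c : ℕ} (hc : p.Node c) (c' : ℕ) :
    A.succCount a (p.vecOf c) (p.vecOf c') = p.weight a c c' := by
  classical
  rw [vecOf, NBA.succCount_eq_ncard A a (p.node_iff.1 hc).2.1]
  refine ncard_eq_sum_least p.setOf (fun E hE => p.exists_setOf E (card_le_of_isStep hE))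
    fun e => ?_
  refine and_congr (h.isStep_iff a c c' e).symm ?_
  simp only [LeastSet, ne_eq, setOf_eq_iff]

theorem Describes.edge_iff (h : p.Describes A) (c c' : ℕ) :
    p.Edge c c' ↔ p.Node c ∧ p.Node c' ∧ A.VecEdge (p.vecOf c) (p.vecOf c') := by
  refine and_congr_right fun hc => and_congr_right fun hc' => ?_
  constructor
  · rintro ⟨a, ha, h1⟩
    exact ⟨⟨a, ha⟩, by rwa [h.weight_eq _ hc]⟩
  · rintro ⟨a, h1⟩
    exact ⟨a, a.2, by rwa [← h.weight_eq _ hc]⟩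

theorem Describes.init_iff (h : p.Describes A) (c : ℕ) :
    p.Init c ↔ p.Node c ∧ A.VecInit (p.vecOf c) := by
  refine and_congr_right fun hc => ?_
  rw [NBA.VecInit, and_iff_right (p.node_iff.1 hc).2.1, forall_lt_iff
    (P := fun j => (¬ p.ini (j / 2) ∨ j % 2 = 1 → p.vec c j = 0) ∧ p.vec c j ≤ 1), Prod.forall]
  refine forall_congr' fun q => forall_congr' fun b => ?_
  rw [vecOf_apply, idx_div, idx_mod, h.ini]
  cases b <;> simp

theorem final_iff (c : ℕ) : p.Final c ↔ p.Node c ∧ NBA.VecFinal (p.vecOf c) := by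
  refine and_congr_right fun hc => ?_
  rw [NBA.VecFinal, and_iff_right (p.node_iff.1 hc).2.1]
  simp only [vecOf_apply, idx, Bool.toNat_false, add_zero]
  exact ⟨fun h q => h q q.2, fun h q hq => h ⟨q, hq⟩⟩

/-- Lasso vectors have size at most `k ≤ K`, hence they all have codes and `onLasso_iff` applies. -/
theorem Describes.kept_iff (h : p.Describes A) {k : ℕ} (hA : A.IsAmbiguous k) (hk : k ≤ p.K)
    (c : ℕ) : p.Kept c ↔ p.Node c ∧ OnLasso A.VecEdge A.VecInit NBA.VecFinal (p.vecOf c) :=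
  onLasso_iff p.vecOf_injOn h.edge_iff h.init_iff final_iff (fun _ hv =>
    p.exists_node (NBA.vec_ne_zero_of_onLasso hv) ((NBA.sum_le_of_onLasso hA hv).trans hk)) c

end AutData

/-! ### The output string in terms of codes. -/

/-! ### The output -/

open Classical in
/-- The encoding of `-w` or of `w`; the sign is that of a negative number iff `P`. -/
noncomputable def encodeSigned (P : Prop) (w : ℕ) : List (Option Bool) :=
  [some (decide P)] ++ encodeNat w ++ encodeNat 1

/-- All weights are signed naturals, so the denominator is 1 and the sign is a parity test. -/
theorem encodeRat_neg_one_zpow_mul (z : ℤ) (w : ℕ) {P : Prop} (hP : P ↔ w ≠ 0 ∧ Odd z) :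
    encodeRat ((-1) ^ z * w) = encodeSigned P w := by
  have key : ∀ r : ℚ, (r < 0 ↔ P) → r.num.natAbs = w → r.den = 1 →
      encodeRat r = encodeSigned P w := by
    intro r h1 h2 h3
    have : decide (r < 0) = @decide P (Classical.propDecidable P) := decide_eq_decide.2 h1
    rw [encodeRat, encodeSigned, h2, h3, this]
  rcases Int.even_or_odd z with h | h
  · rw [h.neg_one_zpow, one_mul]
    refine key _ ?_ (by simp) (by simp)
    rw [hP]
    have : ¬ Odd z := Int.not_odd_iff_even.2 h
    simp [this]
  · rw [h.neg_one_zpow, neg_one_mul]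
    refine key _ ?_ (by simp) (by simp)
    rw [hP]
    simp [h, Nat.pos_iff_ne_zero]

theorem flatMap_finRange {X : Type*} {n : ℕ} (g : ℕ → List X) :
    (List.finRange n).flatMap (fun i : Fin n => g i) = (List.range n).flatMap g := by
  rw [← List.map_coe_finRange_eq_range, List.flatMap_map]

namespace AutData

open Classical in
/-- The concatenation of lists for the states that are left after trimming. -/
noncomputable def forKept (p : AutData) (f : ℕ → List (Option Bool)) : List (Option Bool) :=
  (List.range p.codes).flatMap fun c => if p.Kept c then f c else []

open Classical in
/-- The encoding of the disambiguation. -/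
noncomputable def out (p : AutData) : List (Option Bool) :=
  encodeUnary p.n ++ (p.forKept (fun _ => [some true]) ++ [none] ++ encodeUnary p.s ++
    p.forKept (fun c => encodeSigned (p.Init c ∧ p.size c % 2 = 0) (if p.Init c then 1 else 0)) ++
    p.forKept (fun c => [some (decide (p.Final c))]) ++
    (List.range p.s).flatMap fun a => p.forKept fun c => p.forKept fun c' =>
      encodeSigned (p.weight a c c' ≠ 0 ∧ (p.size c + p.size c') % 2 = 1) (p.weight a c c')) ++
  p.forKept fun c => (List.range p.n).flatMap fun q =>
    encodeNat (p.vec c (2 * q)) ++ encodeNat (p.vec c (2 * q + 1))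

variable {p : AutData} {A : NBA (Fin p.n) (Fin p.s)} {k : ℕ}

/-- The states are enumerated in increasing order of their codes; a loop over all codes that skips
the others then produces the lists of the encoding. -/
theorem Describes.exists_equiv (h : p.Describes A) (hA : A.IsAmbiguous k) (hk : k ≤ p.K) :
    ∃ (m : ℕ) (e : Fin m ≃ A.KdisState k) (γ : Fin m → ℕ), (∀ i, p.Kept (γ i)) ∧
      (∀ i, (e i).1.toNat = p.vecOf (γ i)) ∧
      ∀ f, p.forKept f = (List.finRange m).flatMap fun i => f (γ i) := by
  classical
  set l := (List.range p.codes).filter fun c => p.Kept c with hl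
  have hmem : ∀ c, c ∈ l ↔ p.Kept c := by
    intro c
    rw [hl, List.mem_filter, List.mem_range, decide_eq_true_iff, and_iff_right_iff_imp]
    exact fun hc => ((h.kept_iff hA hk c).1 hc).1.1
  have hnd : l.Nodup := List.nodup_range.filter _
  have hex : ∀ i : Fin l.length, ∃ v : A.KdisState k, v.1.toNat = p.vecOf l[i] := by
    intro i
    have hi := ((h.kept_iff hA hk _).1 ((hmem _).1 (List.getElem_mem i.2)))
    have hs := NBA.sum_le_of_onLasso hA hi.2
    obtain ⟨v, hv⟩ := NBA.exists_toNat_eq (k := k) (NBA.vec_ne_zero_of_onLasso hi.2) fun y =>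
      (Finset.single_le_sum (fun _ _ => Nat.zero_le _) (Finset.mem_univ y)).trans hs
    exact ⟨⟨v, (NBA.mem_trimStates_iff hA v).2 (hv ▸ hi.2)⟩, hv⟩
  choose g hg using hex
  have hbij : Function.Bijective g := by
    constructor
    · intro i j hij
      have h1 : p.vecOf l[i] = p.vecOf l[j] := by rw [← hg, ← hg, hij]
      have hi := ((h.kept_iff hA hk _).1 ((hmem _).1 (List.getElem_mem i.2))).1
      have hj := ((h.kept_iff hA hk _).1 ((hmem _).1 (List.getElem_mem j.2))).1
      exact Fin.ext ((hnd.getElem_inj_iff).1 (p.vecOf_injOn hi hj h1))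
    · intro v
      have hv := (NBA.mem_trimStates_iff hA v.1).1 v.2
      obtain ⟨c, hc, hcv⟩ := p.exists_node (NBA.vec_ne_zero_of_onLasso hv)
        ((NBA.sum_le_of_onLasso hA hv).trans hk)
      have hck : c ∈ l := (hmem c).2 ((h.kept_iff hA hk c).2 ⟨hc, hcv.symm ▸ hv⟩)
      obtain ⟨i, hi, rfl⟩ := List.getElem_of_mem hck
      refine ⟨⟨i, hi⟩, Subtype.ext (NBA.KVec.toNat_injective ?_)⟩
      rw [hg, ← hcv]
      rfl
  refine ⟨l.length, Equiv.ofBijective g hbij, fun i => l[i], fun i =>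
    (hmem _).1 (List.getElem_mem i.2), hg, fun f => ?_⟩
  have h1 : l = (List.finRange l.length).map fun i => l[i] :=
    (List.map_getElem_finRange l).symm
  rw [← List.flatMap_map (fun i : Fin l.length => l[i]) f, ← h1, forKept, hl]
  induction List.range p.codes with
  | nil => rfl
  | cons c t ih =>
    rw [List.flatMap_cons, ih, List.filter_cons]
    by_cases hc : p.Kept c <;> simp [hc]

theorem Describes.exists_encodeKdis (h : p.Describes A) (hA : A.IsAmbiguous k) (hk : k ≤ p.K) :
    ∃ (m : ℕ) (e : Fin m ≃ A.KdisState k), A.encodeKdis k e = p.out := by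
  classical
  obtain ⟨m, e, γ, hγ, hv, hf⟩ := h.exists_equiv hA hk
  have hnode : ∀ i, p.Node (γ i) := fun i => ((h.kept_iff hA hk _).1 (hγ i)).1
  have hne : ∀ i, (e i).1.toNat ≠ 0 := fun i => NBA.KVec.toNat_ne_zero _
  have hsize : ∀ i, (e i).1.size = p.size (γ i) := by
    intro i
    rw [NBA.KVec.size, size, sum_range_eq, hv]
    exact Finset.sum_congr rfl fun y _ => p.vecOf_apply _ y
  -- The initial weight has the exponent `r.size - 1` with truncated subtraction; positivity
  -- identifies it with the integer difference.
  have hpos : ∀ i, 0 < p.size (γ i) := by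
    intro i
    obtain ⟨y, hy⟩ := Function.ne_iff.1 (hne i)
    rw [← hsize]
    exact (Nat.pos_of_ne_zero hy).trans_le
      (Finset.single_le_sum (f := (e i).1.toNat) (fun _ _ => Nat.zero_le _) (Finset.mem_univ y))
  have hα : ∀ i, encodeRat (((A.kdis k).comap e).α i) = encodeSigned
      (p.Init (γ i) ∧ p.size (γ i) % 2 = 0) (if p.Init (γ i) then 1 else 0) := by
    intro i
    have h1 : ((A.kdis k).comap e).α i =
        (-1) ^ ((p.size (γ i) : ℤ) - 1) * ((if p.Init (γ i) then 1 else 0 : ℕ) : ℚ) := by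
      change (A.kdis' k).α (e i).1 = _
      have h2 := h.init_iff (γ i)
      rw [NBA.VecInit, ← hv i, and_iff_right (hne i), and_iff_right (hnode i)] at h2
      simp only [NBA.kdis', h2, hsize]
      split_ifs
      · rw [Nat.cast_one, mul_one, ← zpow_natCast, Nat.cast_sub (hpos i), Nat.cast_one]
      · simp
    rw [h1]
    refine encodeRat_neg_one_zpow_mul _ _ ?_
    have := hpos i
    rw [Int.odd_iff]
    split_ifs with h3
    · simp only [h3, true_and, ne_eq, one_ne_zero, not_false_iff]
      omega
    · simp [h3]
  have hM : ∀ a i j, encodeRat (((A.kdis k).comap e).M a i j) = encodeSigned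
      (p.weight a (γ i) (γ j) ≠ 0 ∧ (p.size (γ i) + p.size (γ j)) % 2 = 1)
      (p.weight a (γ i) (γ j)) := by
    intro a i j
    have h1 : ((A.kdis k).comap e).M a i j = (-1) ^ ((p.size (γ j) : ℤ) - p.size (γ i)) *
        (p.weight a (γ i) (γ j) : ℚ) := by
      change (A.kdis' k).M a (e i).1 (e j).1 = _
      simp only [NBA.kdis', Matrix.of_apply]
      rw [hsize, hsize, hv, hv, h.weight_eq a (hnode i)]
    rw [h1]
    -- The difference of the sizes has the parity of their sum, so the machine needs no negative
    -- numbers.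
    refine encodeRat_neg_one_zpow_mul _ _ (and_congr_right fun _ => ?_)
    rw [Int.odd_iff]
    omega
  have hF : ∀ i, i ∈ ((A.kdis k).comap e).final ↔ p.Final (γ i) := by
    intro i
    change (∀ q, (e i).1.toNat (q, false) = 0) ↔ _
    rw [final_iff, and_iff_right (hnode i), NBA.VecFinal, ← hv, and_iff_right (hne i)]
  refine ⟨m, e, ?_⟩
  rw [NBA.encodeKdis, WBA.encode, out]
  simp only [hf]
  congr 1
  · congr 1
    congr 1
    · congr 1
      · congr 1
        · congr 1
          simp [encodeUnary, ← List.map_eq_flatMap]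
        · exact congrArg (fun g => List.flatMap g (List.finRange m)) (funext hα)
      · rw [List.map_eq_flatMap]
        simp only [hF]
    · rw [← flatMap_finRange]
      simp only [hM]
  · refine congrArg (fun g => List.flatMap g (List.finRange m)) (funext fun i => ?_)
    rw [← flatMap_finRange]
    simp only [hv, vecOf_apply, idx, Bool.toNat_false, Bool.toNat_true, add_zero]

end AutData

/-! ### Computability of the codes, the weights and the trimming. -/

/-! ### Its computation -/

/-- The numbers that describe an automaton are computable from the input. -/
structure AutData.IsPL (D : List Bool → AutData) : Prop where
  n : PL fun x => (D x).n
  s : PL fun x => (D x).s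
  K : PL fun x => (D x).K
  lbK : LB fun x => (D x).K
  ini : PLP fun v : List Bool × ℕ => (D v.1).ini v.2
  fin : PLP fun v : List Bool × ℕ => (D v.1).fin v.2
  tr : PLP fun v : ((List Bool × ℕ) × ℕ) × ℕ => (D v.1.1.1).tr v.1.1.2 v.1.2 v.2

namespace AutData.IsPL

variable {D : List Bool → AutData} {α : Type} [Ctx α]

theorem base (h : IsPL D) : PL fun v : α => 2 * (D (input v)).n + 1 :=
  ((PL.const 2).mul h.n.comp₀).succ

theorem pairBase (h : IsPL D) : PL fun v : α => (D (input v)).K * (D (input v)).n + 1 :=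
  (h.K.comp₀.mul h.n.comp₀).succ

theorem lab (h : IsPL D) : PL fun v : (List Bool × ℕ) × ℕ => (D v.1.1).lab v.1.2 v.2 :=
  (PL.div_pow PL.var.weaken (h.base (α := (List Bool × ℕ) × ℕ)) PL.var).mod
    (h.base (α := (List Bool × ℕ) × ℕ))

theorem pair (h : IsPL D) : PL fun v : (List Bool × ℕ) × ℕ => (D v.1.1).pair v.1.2 v.2 :=
  (PL.div_pow PL.var.weaken (h.pairBase (α := (List Bool × ℕ) × ℕ)) PL.var).mod
    (h.pairBase (α := (List Bool × ℕ) × ℕ))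

theorem mem (h : IsPL D) :
    PLP fun v : ((List Bool × ℕ) × ℕ) × ℕ => (D v.1.1.1).Mem v.1.1.2 v.1.2 v.2 :=
  PLP.exists_lt (α := ((List Bool × ℕ) × ℕ) × ℕ)
    (P := fun v t => (D v.1.1.1).pair v.1.1.2 t = v.1.2 * (D v.1.1.1).n + v.2 + 1) h.K.comp₀
    ((PL.comp₂ (F := fun x => (D x).pair) h.pair PL.var.weaken.weaken.weaken PL.var).eq
      (((PL.var.weaken.weaken.mul h.n.comp₀).add PL.var.weaken).succ))

theorem newBit (h : IsPL D) :
    PLP fun v : (List Bool × ℕ) × ℕ => (D v.1.1).NewBit v.1.2 v.2 := by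
  refine PLP.and ?_ ?_
  · refine PLP.exists_lt (α := (List Bool × ℕ) × ℕ) (P := fun v j =>
      (D v.1.1).lab v.1.2 v.2 = j + 1 ∧ ((D v.1.1).fin (j / 2) ∨ j % 2 = 1))
      ((PL.const 2).mul h.n.comp₀) ?_
    exact (h.lab.weaken.eq PL.var.succ).and
      ((PLP.comp₁ (P := fun x => (D x).fin) h.fin (PL.var.div (.const 2))).or
        ((PL.var.mod (.const 2)).eq (.const 1)))
  · refine PLP.exists_lt (α := (List Bool × ℕ) × ℕ) (P := fun v i => ∃ j < 2 * (D v.1.1).n,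
      (D v.1.1).lab v.1.2 i = j + 1 ∧ j % 2 = 0) h.K.comp₀ ?_
    refine PLP.exists_lt (α := ((List Bool × ℕ) × ℕ) × ℕ) (P := fun v j =>
      (D v.1.1.1).lab v.1.1.2 v.2 = j + 1 ∧ j % 2 = 0) ((PL.const 2).mul h.n.comp₀) ?_
    exact ((PL.comp₂ (F := fun x => (D x).lab) h.lab PL.var.weaken.weaken.weaken
      PL.var.weaken).eq PL.var.succ).and ((PL.var.mod (.const 2)).eq .zero)

theorem vec (h : IsPL D) : PL fun v : (List Bool × ℕ) × ℕ => (D v.1.1).vec v.1.2 v.2 := by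
  classical
  refine PL.sum (α := (List Bool × ℕ) × ℕ) (g := fun v i =>
    if (D v.1.1).lab v.1.2 i = v.2 + 1 then 1 else 0) h.K.comp₀ ?_
  exact PLP.indicator ((PL.comp₂ (F := fun x => (D x).lab) h.lab PL.var.weaken.weaken PL.var).eq
    PL.var.weaken.succ)

/-- Four numbers and the input. -/
abbrev Ctx₄ : Type := (((List Bool × ℕ) × ℕ) × ℕ) × ℕ

theorem step (h : IsPL D) : PLP fun v : Ctx₄ =>
    (D v.1.1.1.1).Step v.1.1.1.2 v.1.1.2 v.1.2 v.2 := by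
  classical
  refine PLP.and ?_ (PLP.and ?_ ?_)
  · refine PLP.forall_lt (α := Ctx₄) (P := fun v i => ∀ q < (D v.1.1.1.1).n,
      (D v.1.1.1.1).Mem v.2 i q → ∃ j < 2 * (D v.1.1.1.1).n,
        (D v.1.1.1.1).lab v.1.1.2 i = j + 1 ∧ (D v.1.1.1.1).tr v.1.1.1.2 (j / 2) q) h.K.comp₀ ?_
    refine PLP.forall_lt (α := Ctx₄ × ℕ) (P := fun v q =>
      (D v.1.1.1.1.1).Mem v.1.2 v.2 q → ∃ j < 2 * (D v.1.1.1.1.1).n,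
        (D v.1.1.1.1.1).lab v.1.1.1.2 v.2 = j + 1 ∧
          (D v.1.1.1.1.1).tr v.1.1.1.1.2 (j / 2) q) h.n.comp₀ ?_
    refine PLP.imp ?_ ?_
    · exact PLP.comp₃ (α := (Ctx₄ × ℕ) × ℕ) (P := fun x => (D x).Mem) h.mem PL.var.weaken.weaken
        PL.var.weaken PL.var
    refine PLP.exists_lt (α := (Ctx₄ × ℕ) × ℕ) (P := fun v j =>
      (D v.1.1.1.1.1.1).lab v.1.1.1.1.2 v.1.2 = j + 1 ∧
        (D v.1.1.1.1.1.1).tr v.1.1.1.1.1.2 (j / 2) v.2) ((PL.const 2).mul h.n.comp₀) ?_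
    exact ((PL.comp₂ (α := ((Ctx₄ × ℕ) × ℕ) × ℕ) (F := fun x => (D x).lab) h.lab
      PL.var.weaken.weaken.weaken.weaken.weaken PL.var.weaken.weaken).eq PL.var.succ).and
      (PLP.comp₃ (α := ((Ctx₄ × ℕ) × ℕ) × ℕ) (P := fun x => (D x).tr) h.tr
        PL.var.weaken.weaken.weaken.weaken.weaken.weaken (PL.var.div (.const 2)) PL.var.weaken)
  · refine PLP.forall_lt (α := Ctx₄) (P := fun v i => (D v.1.1.1.1).lab v.1.1.2 i ≠ 0 →
      ∃ q < (D v.1.1.1.1).n, (D v.1.1.1.1).Mem v.2 i q) h.K.comp₀ ?_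
    refine PLP.imp (PL.comp₂ (α := Ctx₄ × ℕ) (F := fun x => (D x).lab) h.lab
      PL.var.weaken.weaken.weaken PL.var).ne_zero ?_
    refine PLP.exists_lt (α := Ctx₄ × ℕ) (P := fun v q => (D v.1.1.1.1.1).Mem v.1.2 v.2 q)
      h.n.comp₀ ?_
    exact PLP.comp₃ (α := (Ctx₄ × ℕ) × ℕ) (P := fun x => (D x).Mem) h.mem PL.var.weaken.weaken
      PL.var.weaken PL.var
  · refine PLP.forall_lt (α := Ctx₄) (P := fun v j => (∑ i ∈ Finset.range (D v.1.1.1.1).K,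
      if (D v.1.1.1.1).Mem v.2 i (j / 2) ∧ ((D v.1.1.1.1).NewBit v.1.1.2 i ∧ j % 2 = 1 ∨
        ¬ (D v.1.1.1.1).NewBit v.1.1.2 i ∧ j % 2 = 0) then 1 else 0) = (D v.1.1.1.1).vec v.1.2 j)
      ((PL.const 2).mul h.n.comp₀) ?_
    refine PL.eq ?_ (PL.comp₂ (α := Ctx₄ × ℕ) (F := fun x => (D x).vec) h.vec
      PL.var.weaken.weaken PL.var)
    refine PL.sum (α := Ctx₄ × ℕ) (g := fun v i =>
      if (D v.1.1.1.1.1).Mem v.1.2 i (v.2 / 2) ∧ ((D v.1.1.1.1.1).NewBit v.1.1.1.2 i ∧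
        v.2 % 2 = 1 ∨ ¬ (D v.1.1.1.1.1).NewBit v.1.1.1.2 i ∧ v.2 % 2 = 0) then 1 else 0)
      h.K.comp₀ ?_
    have hnb := PLP.comp₂ (α := (Ctx₄ × ℕ) × ℕ) (P := fun x => (D x).NewBit) h.newBit
      PL.var.weaken.weaken.weaken.weaken PL.var
    exact PLP.indicator ((PLP.comp₃ (α := (Ctx₄ × ℕ) × ℕ) (P := fun x => (D x).Mem) h.mem
      PL.var.weaken.weaken PL.var (PL.var.weaken.div (.const 2))).and
      ((hnb.and ((PL.var.weaken.mod (.const 2)).eq (.const 1))).or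
        (hnb.not.and ((PL.var.weaken.mod (.const 2)).eq .zero))))

theorem leastSet (h : IsPL D) : PLP fun v : List Bool × ℕ => (D v.1).LeastSet v.2 := by
  refine PLP.forall_lt (α := List Bool × ℕ) (P := fun v e' => ¬ ∀ i < (D v.1).K, ∀ q < (D v.1).n,
    ((D v.1).Mem e' i q → (D v.1).Mem v.2 i q) ∧ ((D v.1).Mem v.2 i q → (D v.1).Mem e' i q))
    PL.var (PLP.not ?_)
  refine PLP.forall_lt (α := (List Bool × ℕ) × ℕ) (P := fun v i => ∀ q < (D v.1.1).n,
    ((D v.1.1).Mem v.2 i q → (D v.1.1).Mem v.1.2 i q) ∧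
      ((D v.1.1).Mem v.1.2 i q → (D v.1.1).Mem v.2 i q)) h.K.comp₀ ?_
  refine PLP.forall_lt (α := ((List Bool × ℕ) × ℕ) × ℕ) (P := fun v q =>
    ((D v.1.1.1).Mem v.1.2 v.2 q → (D v.1.1.1).Mem v.1.1.2 v.2 q) ∧
      ((D v.1.1.1).Mem v.1.1.2 v.2 q → (D v.1.1.1).Mem v.1.2 v.2 q)) h.n.comp₀ ?_
  have h1 := PLP.comp₃ (α := Ctx₄) (P := fun x => (D x).Mem) h.mem PL.var.weaken.weaken
    PL.var.weaken PL.var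
  have h2 := PLP.comp₃ (α := Ctx₄) (P := fun x => (D x).Mem) h.mem PL.var.weaken.weaken.weaken
    PL.var.weaken PL.var
  exact (h1.imp h2).and (h2.imp h1)

/-- The range of summation is quasi-polynomial because `K` is polylogarithmic. -/
theorem weight (h : IsPL D) :
    PL fun v : ((List Bool × ℕ) × ℕ) × ℕ => (D v.1.1.1).weight v.1.1.2 v.1.2 v.2 := by
  classical
  refine PL.sum (α := ((List Bool × ℕ) × ℕ) × ℕ) (g := fun v e =>
    if (D v.1.1.1).Step v.1.1.2 v.1.2 v.2 e ∧ (D v.1.1.1).LeastSet e then 1 else 0)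
    (PL.pow h.pairBase h.K.comp₀ h.lbK.weaken.weaken.weaken) ?_
  exact PLP.indicator (h.step.and (PLP.comp₁ (α := Ctx₄) (P := fun x => (D x).LeastSet)
    h.leastSet PL.var))

theorem codes (h : IsPL D) : PL fun x => (D x).codes :=
  PL.pow (h.base (α := List Bool)) h.K h.lbK

theorem node (h : IsPL D) : PLP fun v : List Bool × ℕ => (D v.1).Node v.2 := by
  refine PLP.and (PL.var.lt h.codes.comp₀) (PLP.and ?_ ?_)
  · exact PLP.exists_lt (α := List Bool × ℕ) (P := fun v i => (D v.1).lab v.2 i ≠ 0) h.K.comp₀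
      h.lab.ne_zero
  · refine PLP.forall_lt (α := List Bool × ℕ) (P := fun v c' => ¬ ∀ j < 2 * (D v.1).n,
      (D v.1).vec c' j = (D v.1).vec v.2 j) PL.var (PLP.not ?_)
    refine PLP.forall_lt (α := (List Bool × ℕ) × ℕ) (P := fun v j =>
      (D v.1.1).vec v.2 j = (D v.1.1).vec v.1.2 j) ((PL.const 2).mul h.n.comp₀) ?_
    exact (PL.comp₂ (F := fun x => (D x).vec) h.vec PL.var.weaken PL.var).eq
      (PL.comp₂ (F := fun x => (D x).vec) h.vec PL.var.weaken.weaken PL.var)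

theorem edge (h : IsPL D) : PLP fun v : (List Bool × ℕ) × ℕ => (D v.1.1).Edge v.1.2 v.2 := by
  refine PLP.and h.node.weaken (PLP.and
    (PLP.comp₁ (P := fun x => (D x).Node) h.node PL.var) ?_)
  refine PLP.exists_lt (α := (List Bool × ℕ) × ℕ) (P := fun v a =>
    (D v.1.1).weight a v.1.2 v.2 ≠ 0) h.s.comp₀ ?_
  exact (PL.comp₃ (F := fun x => (D x).weight) h.weight PL.var PL.var.weaken.weaken
    PL.var.weaken).ne_zero

theorem init (h : IsPL D) : PLP fun v : List Bool × ℕ => (D v.1).Init v.2 := by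
  refine PLP.and h.node ?_
  refine PLP.forall_lt (α := List Bool × ℕ) (P := fun v j =>
    (¬ (D v.1).ini (j / 2) ∨ j % 2 = 1 → (D v.1).vec v.2 j = 0) ∧ (D v.1).vec v.2 j ≤ 1)
    ((PL.const 2).mul h.n.comp₀) ?_
  exact (((PLP.comp₁ (P := fun x => (D x).ini) h.ini (PL.var.div (.const 2))).not.or
    ((PL.var.mod (.const 2)).eq (.const 1))).imp (h.vec.eq .zero)).and (h.vec.le (.const 1))

theorem final (h : IsPL D) : PLP fun v : List Bool × ℕ => (D v.1).Final v.2 := by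
  refine PLP.and h.node ?_
  refine PLP.forall_lt (α := List Bool × ℕ) (P := fun v q => (D v.1).vec v.2 (2 * q) = 0)
    h.n.comp₀ ?_
  exact (PL.comp₂ (F := fun x => (D x).vec) h.vec PL.var.weaken ((PL.const 2).mul PL.var)).eq .zero

theorem size (h : IsPL D) : PL fun v : List Bool × ℕ => (D v.1).size v.2 :=
  PL.sum (α := List Bool × ℕ) (g := fun v j => (D v.1).vec v.2 j) ((PL.const 2).mul h.n.comp₀) h.vec

/-- The logarithm of the number of codes, hence the depth of Savitch's recursion, is
polylogarithmic. -/
theorem reach (h : IsPL D) : PLP fun v : (List Bool × ℕ) × ℕ => v.1.2 < (D v.1.1).codes ∧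
    v.2 < (D v.1.1).codes ∧ Relation.ReflTransGen (D v.1.1).Edge v.1.2 v.2 := by
  set d : List Bool → ℕ := fun x => (D x).K * (Nat.log 2 (2 * (D x).n + 1) + 1) + 1
  have hb := h.base (α := List Bool)
  have hd : PL d := (h.K.mul (hb.log.succ)).succ
  have hdl : LB d := (h.lbK.mul ((LB.log hb.qb).add (.const 1))).add (.const 1)
  have hpos : ∀ x, 1 ≤ (D x).codes := fun x => Nat.one_le_pow _ _ (Nat.succ_pos _)
  have hle : ∀ x, (D x).codes + 1 ≤ 2 ^ d x := by
    intro x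
    have h1 : (D x).codes ≤ 2 ^ ((D x).K * (Nat.log 2 (2 * (D x).n + 1) + 1)) := by
      rw [mul_comm, pow_mul]
      exact Nat.pow_le_pow_left (Nat.lt_pow_succ_log_self one_lt_two _).le _
    have := hpos x
    simp only [d, pow_succ 2]
    omega
  -- One vertex more than there are codes, since the game needs at least two and `codes` can be 1.
  have hr := PLP.reachIn (N := fun x => (D x).codes + 1) (E := fun x => (D x).Edge) h.codes.succ hd
    hdl h.edge
    (fun x => Nat.succ_le_succ (hpos x))
  refine ((PL.var.weaken.lt h.codes.comp₀).and ((PL.var.lt h.codes.comp₀).and hr)).congr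
    fun v => ?_
  refine and_congr_right fun h1 => and_congr_right fun h2 => ?_
  change _ < (D v.1.1).codes at h1 h2
  rw [reachIn_iff (fun u w huw => ⟨huw.1.1.trans (Nat.lt_succ_self _),
    huw.2.1.1.trans (Nat.lt_succ_self _)⟩) (hle v.1.1) (h1.trans (Nat.lt_succ_self _)),
    and_iff_right (h1.trans (Nat.lt_succ_self _)), and_iff_right (h2.trans (Nat.lt_succ_self _))]

/-- All vertices involved are codes, so the quantifiers are bounded; a nonempty loop is an edge
followed by a possibly empty path back. -/
theorem kept (h : IsPL D) : PLP fun v : List Bool × ℕ => (D v.1).Kept v.2 := by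
  have hR : ∀ {α : Type} [Ctx α] {f g : α → ℕ}, PL f → PL g → PLP fun v : α =>
      f v < (D (input v)).codes ∧ g v < (D (input v)).codes ∧
        Relation.ReflTransGen (D (input v)).Edge (f v) (g v) := fun hf hg =>
    PLP.comp₂ (P := fun x u w => u < (D x).codes ∧ w < (D x).codes ∧
      Relation.ReflTransGen (D x).Edge u w) h.reach hf hg
  have h1 : PLP fun v : List Bool × ℕ => ∃ u < (D v.1).codes, (D v.1).Init u ∧
      u < (D v.1).codes ∧ v.2 < (D v.1).codes ∧ Relation.ReflTransGen (D v.1).Edge u v.2 :=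
    PLP.exists_lt (α := List Bool × ℕ) h.codes.comp₀
      ((PLP.comp₁ (P := fun x => (D x).Init) h.init PL.var).and (hR PL.var PL.var.weaken))
  have h2 : PLP fun v : (List Bool × ℕ) × ℕ => ∃ g < (D v.1.1).codes, (D v.1.1).Edge v.2 g ∧
      g < (D v.1.1).codes ∧ v.2 < (D v.1.1).codes ∧ Relation.ReflTransGen (D v.1.1).Edge g v.2 :=
    PLP.exists_lt (α := (List Bool × ℕ) × ℕ) h.codes.comp₀
      ((PLP.comp₂ (P := fun x => (D x).Edge) h.edge PL.var.weaken PL.var).and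
        (hR PL.var PL.var.weaken))
  have h3 : PLP fun v : List Bool × ℕ => ∃ f < (D v.1).codes, (D v.1).Final f ∧
      (v.2 < (D v.1).codes ∧ f < (D v.1).codes ∧ Relation.ReflTransGen (D v.1).Edge v.2 f) ∧
        ∃ g < (D v.1).codes, (D v.1).Edge f g ∧ g < (D v.1).codes ∧ f < (D v.1).codes ∧
          Relation.ReflTransGen (D v.1).Edge g f :=
    PLP.exists_lt (α := List Bool × ℕ) h.codes.comp₀
      ((PLP.comp₁ (P := fun x => (D x).Final) h.final PL.var).and
        ((hR PL.var.weaken PL.var).and h2))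
  refine (h1.and h3).congr fun v => ?_
  constructor
  · rintro ⟨⟨u, hu, huv⟩, f, hf, hvf, hff⟩
    obtain ⟨g, hg, hgf⟩ := Relation.TransGen.head'_iff.1 hff
    have hv : v.2 < (D v.1).codes := by
      rcases hvf.cases_head with e | ⟨c, hc, -⟩
      · exact e ▸ hf.1.1
      · exact hc.1.1
    exact ⟨⟨u, hu.1.1, hu, hu.1.1, hv, huv⟩, f, hf.1.1, hf, ⟨hv, hf.1.1, hvf⟩, g, hg.2.1.1, hg,
      hg.2.1.1, hf.1.1, hgf⟩
  · rintro ⟨⟨u, -, hu, -, -, huv⟩, f, -, hf, ⟨-, -, hvf⟩, g, -, hg, -, -, hgf⟩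
    exact ⟨⟨u, hu, huv⟩, f, hf, hvf, .head' hg hgf⟩

theorem forKept (h : IsPL D) {f : α → ℕ → List (Option Bool)}
    (hf : OutPL fun v : α × ℕ => f v.1 v.2) : OutPL fun v => (D (input v)).forKept (f v) :=
  OutPL.flatMap h.codes.comp₀
    (OutPL.ite (PLP.comp₁ (P := fun x => (D x).Kept) h.kept PL.var) hf)

theorem _root_.OutPL.encodeSigned {P : α → Prop} {f : α → ℕ} (hP : PLP P) (hf : PL f) :
    OutPL fun v => encodeSigned (P v) (f v) :=
  ((OutPL.bool hP).append (OutPL.encodeNat hf)).append (OutPL.encodeNat (.const 1))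

theorem out (h : IsPL D) : OutPL fun x => (D x).out := by
  classical
  refine OutPL.append (OutPL.append (OutPL.encodeUnary h.n) (OutPL.append (OutPL.append
    (OutPL.append (OutPL.append (OutPL.append (h.forKept (.emit _)) (.emit _))
    (OutPL.encodeUnary h.s)) (h.forKept ?_)) (h.forKept (OutPL.bool h.final)))
    (OutPL.flatMap h.s ?_))) (h.forKept (OutPL.flatMap h.n.comp₀ (OutPL.append
      (OutPL.encodeNat ?_) (OutPL.encodeNat ?_))))
  · exact OutPL.encodeSigned (h.init.and ((h.size.mod (.const 2)).eq .zero)) h.init.indicator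
  · refine h.forKept (α := List Bool × ℕ) (f := fun v c => (D v.1).forKept fun c' =>
      _root_.encodeSigned ((D v.1).weight v.2 c c' ≠ 0 ∧
        ((D v.1).size c + (D v.1).size c') % 2 = 1) ((D v.1).weight v.2 c c')) ?_
    refine h.forKept (α := (List Bool × ℕ) × ℕ) (f := fun v c' =>
      _root_.encodeSigned ((D v.1.1).weight v.1.2 v.2 c' ≠ 0 ∧
        ((D v.1.1).size v.2 + (D v.1.1).size c') % 2 = 1) ((D v.1.1).weight v.1.2 v.2 c')) ?_
    have hs : ∀ {f : ((List Bool × ℕ) × ℕ) × ℕ → ℕ}, PL f → PL fun v => (D v.1.1.1).size (f v) :=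
      fun hf => PL.comp₁ (F := fun x => (D x).size) h.size hf
    exact OutPL.encodeSigned (h.weight.ne_zero.and
      ((((hs PL.var.weaken).add (hs PL.var)).mod (.const 2)).eq (.const 1))) h.weight
  · exact PL.comp₂ (F := fun x => (D x).vec) h.vec PL.var.weaken ((PL.const 2).mul PL.var)
  · exact PL.comp₂ (F := fun x => (D x).vec) h.vec PL.var.weaken ((PL.const 2).mul PL.var).succ

end AutData.IsPL

/-! ### Decoding the input string, and the conclusion. -/

/-! ### Reading the input -/

theorem bitAt_append_left {l l' : List Bool} {i : ℕ} (h : i < l.length) :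
    bitAt (l ++ l') i = bitAt l i := by
  rw [bitAt, bitAt, List.getElem?_append_left h]

theorem bitAt_append_right {l l' : List Bool} {m : ℕ} (h : l.length = m) (i : ℕ) :
    bitAt (l ++ l') (m + i) = bitAt l' i := by
  rw [bitAt, bitAt, List.getElem?_append_right (by omega), h, Nat.add_sub_cancel_left]

theorem bitAt_map_finRange {n : ℕ} {P : Fin n → Prop} {_ : DecidablePred P} (i : Fin n) :
    bitAt ((List.finRange n).map fun i => decide (P i)) i = 1 ↔ P i := by
  simp [bitAt]

theorem bitAt_flatMap {X : Type*} {L : ℕ} {g : X → List Bool} (hg : ∀ y, (g y).length = L)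
    (l : List X) {a i : ℕ} (hi : i < L) (ha : a < l.length) :
    bitAt (l.flatMap g) (a * L + i) = bitAt (g l[a]) i := by
  induction l generalizing a with
  | nil => exact absurd ha (Nat.not_lt_zero _)
  | cons y l ih =>
    rw [List.flatMap_cons]
    rcases a with _ | a
    · rw [zero_mul, zero_add, bitAt_append_left (by rwa [hg])]
      rfl
    · rw [show (a + 1) * L + i = L + (a * L + i) by ring, bitAt_append_right (hg y),
        ih (by simpa using ha)]
      rfl

/-- The number of consecutive bits `1` from position `o` on. -/
def run (x : List Bool) (o : ℕ) : ℕ :=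
  ∑ i ∈ Finset.range x.length, if ∀ j < i + 1, bitAt x (o + j) = 1 then 1 else 0

theorem run_eq {x : List Bool} {o m : ℕ} (hm : m ≤ x.length) (h : ∀ j < m, bitAt x (o + j) = 1)
    (h' : bitAt x (o + m) ≠ 1) : run x o = m := by
  rw [run, ← Finset.card_filter]
  have : (Finset.range x.length).filter (fun i => ∀ j < i + 1, bitAt x (o + j) = 1) =
      Finset.range m := by
    ext i
    simp only [Finset.mem_filter, Finset.mem_range]
    constructor
    · rintro ⟨-, hi⟩
      by_contra hn
      exact h' (hi m (by omega))
    · exact fun hi => ⟨by omega, fun j hj => h j (by omega)⟩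
  rw [this, Finset.card_range]

theorem PL.run {α : Type} [Ctx α] {f : α → ℕ} (hf : PL f) : PL fun v => run (input v) (f v) := by
  refine PL.sum (g := fun v i => if ∀ j < i + 1, _root_.bitAt (input v) (f v + j) = 1 then 1 else 0)
    PL.length ?_
  refine PLP.indicator (PLP.forall_lt (α := α × ℕ)
    (P := fun v j => _root_.bitAt (input v.1) (f v.1 + j) = 1) PL.var.succ ?_)
  exact (PL.bitAt (α := (α × ℕ) × ℕ) (hf.weaken.weaken.add PL.var)).eq (.const 1)

namespace AutData

/-- The automaton with encoding `x`. -/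
def ofInput (C : ℕ) (x : List Bool) : AutData where
  n := run x 0
  s := run x (run x 0 + 1)
  K := C * Nat.log 2 (run x 0) + C
  ini q := bitAt x (run x 0 + 1 + (run x (run x 0 + 1) + 1 + q)) = 1
  fin q := bitAt x (run x 0 + 1 + (run x (run x 0 + 1) + 1 + (run x 0 + q))) = 1
  tr a q q' := bitAt x (run x 0 + 1 + (run x (run x 0 + 1) + 1 + (run x 0 + (run x 0 +
    (a * (run x 0 * run x 0) + (q * run x 0 + q')))))) = 1

/-- This concerns all strings, including those that encode no automaton; there too `K` is
logarithmic in the input length, so time and space stay under control. -/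
theorem isPL_ofInput (C : ℕ) : IsPL (ofInput C) := by
  have hn : ∀ {α : Type} [Ctx α], PL fun v : α => run (input v) 0 := PL.zero.run
  have hs : ∀ {α : Type} [Ctx α], PL fun v : α => run (input v) (run (input v) 0 + 1) :=
    hn.succ.run
  have hb : ∀ {α : Type} [Ctx α] {f : α → ℕ}, PL f → PLP fun v => bitAt (input v)
      (run (input v) 0 + 1 + (run (input v) (run (input v) 0 + 1) + 1 + f v)) = 1 := fun hf =>
    (hn.succ.add (hs.succ.add hf)).bitAt.eq (.const 1)
  refine ⟨hn (α := List Bool), hs (α := List Bool), ((PL.const C).mul hn.log).add (.const C),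
    ((LB.const C).mul (LB.log (hn (α := List Bool)).qb)).add (.const C), hb PL.var,
    hb (hn.add PL.var), hb (hn.add (hn.add ((PL.var.weaken.weaken.mul (hn.mul hn)).add
      ((PL.var.weaken.mul hn).add PL.var))))⟩

/-- The data are rewritten as a structure with literal fields `n` and `s`, so that `Describes` can
speak of `A` without casts between types `Fin`. -/
theorem describes_ofInput {n s : ℕ} (A : NBA (Fin n) (Fin s)) (C : ℕ) :
    ∃ (ini fin : ℕ → Prop) (tr : ℕ → ℕ → ℕ → Prop),
      ofInput C A.encode = ⟨n, s, C * Nat.log 2 n + C, ini, fin, tr⟩ ∧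
        Describes ⟨n, s, C * Nat.log 2 n + C, ini, fin, tr⟩ A := by
  classical
  set l₁ := (List.finRange n).map fun q => decide (q ∈ A.init) with h₁
  set l₂ := (List.finRange n).map fun q => decide (q ∈ A.final) with h₂
  set l₃ := (List.finRange s).flatMap fun a => (List.finRange n).flatMap fun q =>
    (List.finRange n).map fun q' => decide (q' ∈ A.δ q a) with h₃
  set y := l₁ ++ (l₂ ++ l₃) with hy
  have hx : A.encode = (List.replicate n true ++ [false]) ++
      ((List.replicate s true ++ [false]) ++ y) := by
    rw [hy, h₁, h₂, h₃, NBA.encode]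
    simp only [List.append_assoc]
  have hrep : ∀ (m : ℕ) (z : List Bool), (∀ j < m, bitAt ((List.replicate m true ++ [false]) ++ z)
      j = 1) ∧ bitAt ((List.replicate m true ++ [false]) ++ z) m ≠ 1 := by
    intro m z
    constructor
    · intro j hj
      rw [List.append_assoc, bitAt_append_left (by simpa)]
      simp [bitAt, hj]
    · rw [bitAt_append_left (by simp), ← add_zero m, bitAt_append_right (by simp)]
      simp [bitAt]
  have hl : ∀ m, (List.replicate m true ++ [false]).length = m + 1 := by simp
  have hn : run A.encode 0 = n := by
    rw [hx]
    refine run_eq (by simp) (fun j hj => ?_) ?_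
    · rw [zero_add]; exact (hrep n _).1 j hj
    · rw [zero_add]; exact (hrep n _).2
  have hs : run A.encode (n + 1) = s := by
    rw [hx]
    refine run_eq (by simp; omega) (fun j hj => ?_) ?_
    · rw [bitAt_append_right (hl n)]; exact (hrep s _).1 j hj
    · rw [bitAt_append_right (hl n)]; exact (hrep s _).2
  have hb : ∀ i, bitAt A.encode (n + 1 + (s + 1 + i)) = bitAt y i := fun i => by
    rw [hx, bitAt_append_right (hl n), bitAt_append_right (hl s)]
  have hl₁ : l₁.length = n := by simp [h₁]
  have hl₂ : l₂.length = n := by simp [h₂]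
  have hof : ofInput C A.encode = ⟨n, s, C * Nat.log 2 n + C, fun q => bitAt y q = 1,
      fun q => bitAt y (n + q) = 1,
      fun a q q' => bitAt y (n + (n + (a * (n * n) + (q * n + q')))) = 1⟩ := by
    simp only [ofInput, hn, hs, hb]
  refine ⟨_, _, _, hof, ⟨fun q => ?_, fun q => ?_, fun a q q' => ?_⟩⟩
  · change bitAt y q = 1 ↔ _
    rw [hy, bitAt_append_left (by rw [hl₁]; exact q.2)]
    exact bitAt_map_finRange q
  · change bitAt y (n + q) = 1 ↔ _
    rw [hy, bitAt_append_right hl₁, bitAt_append_left (by rw [hl₂]; exact q.2)]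
    exact bitAt_map_finRange q
  · change bitAt y (n + (n + (a * (n * n) + (q * n + q')))) = 1 ↔ _
    have hq : (q : ℕ) < n := q.2
    have hq' : (q' : ℕ) < n := q'.2
    have hlen : ∀ a (q : Fin n),
        ((List.finRange n).map fun q' => decide (q' ∈ A.δ q a)).length = n := by simp
    rw [hy, bitAt_append_right hl₁, bitAt_append_right hl₂, h₃, bitAt_flatMap (L := n * n)
      (by intro; simp) _ (by nlinarith) (by simp), bitAt_flatMap (hlen _) _ hq' (by simp)]
    exact (bitAt_map_finRange q').trans (by simp)

end AutData

/-- The function `κ` may be uncomputable; the machine uses this explicit majorant in its place. -/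
theorem exists_le_mul_log_add {κ : ℕ → ℕ}
    (hκ : (fun n : ℕ => (κ n : ℝ)) =O[atTop] fun n : ℕ => Real.log n) :
    ∃ C, ∀ n, κ n ≤ C * Nat.log 2 n + C := by
  obtain ⟨c, hc⟩ := hκ.bound
  obtain ⟨N, hN⟩ := eventually_atTop.1 hc
  -- The sum absorbs the finitely many `n` for which the asymptotic bound may fail.
  refine ⟨⌈c⌉₊ + ∑ i ∈ Finset.range (N + 1), κ i, fun n => ?_⟩
  rcases Nat.lt_or_ge n (N + 1) with h | h
  · have h1 : κ n ≤ ∑ i ∈ Finset.range (N + 1), κ i :=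
      Finset.single_le_sum (fun _ _ => Nat.zero_le _) (Finset.mem_range.2 h)
    exact h1.trans ((Nat.le_add_left _ _).trans (Nat.le_add_left _ _))
  · have h1 := hN n (by omega)
    rw [Real.norm_of_nonneg (Nat.cast_nonneg _)] at h1
    have hn : (1 : ℝ) ≤ n := by exact_mod_cast (by omega : 1 ≤ n)
    rw [Real.norm_of_nonneg (Real.log_nonneg hn)] at h1
    have h2 : Real.log n ≤ (Nat.log 2 n + 1 : ℕ) := by
      have h3 : (n : ℝ) ≤ 2 ^ (Nat.log 2 n + 1) := by
        exact_mod_cast (Nat.lt_pow_succ_log_self one_lt_two n).le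
      calc Real.log n ≤ Real.log (2 ^ (Nat.log 2 n + 1)) := Real.log_le_log (by linarith) h3
        _ = (Nat.log 2 n + 1 : ℕ) * Real.log 2 := Real.log_pow _ _
        _ ≤ (Nat.log 2 n + 1 : ℕ) * 1 := by
          refine mul_le_mul_of_nonneg_left ?_ (Nat.cast_nonneg _)
          have := Real.log_two_lt_d9
          linarith
        _ = _ := mul_one _
    have h4 : (κ n : ℝ) ≤ (⌈c⌉₊ * (Nat.log 2 n + 1) : ℕ) := by
      refine h1.trans ?_
      rw [Nat.cast_mul]
      exact mul_le_mul (Nat.le_ceil c) h2 (Real.log_nonneg hn) (Nat.cast_nonneg _)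
    have h5 : κ n ≤ ⌈c⌉₊ * (Nat.log 2 n + 1) := by exact_mod_cast h4
    refine h5.trans ?_
    rw [← mul_add_one]
    exact Nat.mul_le_mul_right _ (Nat.le_add_right _ _)

theorem mainTheorem7 (κ : ℕ → ℕ)
    (hκ : (fun n : ℕ => (κ n : ℝ)) =O[atTop] fun n : ℕ => Real.log n) :
    (∃ g : ℕ → ℝ, (g =O[atTop] fun n : ℕ => Real.log n) ∧
      ∀ (Q S : Type*) [Fintype Q] (A : NBA Q S) (k : ℕ),
        k ≤ κ (Fintype.card Q) → A.IsAmbiguous k →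
        (Nat.card (A.KdisState k) : ℝ) ≤
          (2 * (Fintype.card Q : ℝ)) ^ g (Fintype.card Q)) ∧
    ∃ T : Transducer Bool (Option Bool), T.IsPolylogSpace ∧
      ∀ (n s : ℕ) (A : NBA (Fin n) (Fin s)) (k : ℕ),
        k ≤ κ n → A.IsAmbiguous k →
        ∃ (m : ℕ) (e : Fin m ≃ A.KdisState k), T.HaltsWith A.encode (A.encodeKdis k e) := by
  refine ⟨exists_card_kdisState_le κ hκ, ?_⟩
  obtain ⟨C, hC⟩ := exists_le_mul_log_add hκ
  obtain ⟨T, hT, hT'⟩ := (AutData.isPL_ofInput C).out.transducer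
  refine ⟨T, hT, fun n s A k hk hA => ?_⟩
  obtain ⟨ini, fin, tr, h1, h2⟩ := AutData.describes_ofInput A C
  -- The output is computed with the bound `C * log n + C`, yet it encodes the disambiguation for
  -- the given `k`, since the lasso vectors do not depend on the bound.
  obtain ⟨m, e, he⟩ := h2.exists_encodeKdis hA (hk.trans (hC n))
  exact ⟨m, e, by rw [he, ← h1]; exact hT' A.encode⟩
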